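/- **Setting.** A C$^*$-planar algebra is a shaded planar algebra $\mathscr P=\{\mathscr P_{n,\pm}\}_{n\ge 0}$ such that every $\mathscr P_{n,\pm}$ is a finite-dimensional C$^*$-algebra whose multiplication and unit are given by the multiplication tangle and by the tangle of vertical strings, the involution being compatible with the reflection of tangles, together with linear functionals on $\mathscr P_{0,\pm}$ such that composing them with the tangle that closes all strings on the right gives a positive faithful functional on each $\mathscr P_{n,\pm}$. Draw $1$-boxes with one string on the top and one at the bottom, and $2$-boxes with two on the top and two at the bottom. For $x\in\mathscr P_{2,\pm}$ let $\widehat x\in\mathscr P_{2,\mp}$ be its clockwise rotation by $90^\circ$; $x$ is $\mathfrak F$-positive if $\widehat x=aa^*$ for some $a$. For $y\in\mathscr P_{1,\pm}$ let $\overline y\in\mathscr P_{1,\mp}$ be its rotation by $180^\circ$, and for $w\in\mathscr P_{2,\mp}$ let $y*w\in\mathscr P_{1,\pm}$ be the convolution: $y$ is placed to the left of $w$, and the top and the bottom of $y$ are joined to the upper left and the lower left string of $w$. Let $x\in\mathscr P_{2,\pm}$ be $\mathfrak F$-positive with spectral radius $r$. * The Perron–Frobenius (PF) eigenspace is $\mathcal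 E=\{y\in\mathscr P_{1,\pm}: y*\widehat x=ry\}$. * $p_{\max}$ is the largest element of the set of the range projections of the positive elements of $\mathcal E$ (the range projection of $y$ is the smallest projection $q$ with $qy=y$). * The maximal-support PF eigenvector is $$\zeta=\lim_{z\to r^+}(z-r)\sum_{j=0}^\infty \frac{p_{\max}*\widehat x^{\,*j}}{z^{j+1}},$$ where $p_{\max}*\widehat x^{\,*j}=(\cdots((p_{\max}*\widehat x)*\widehat x)\cdots)*\widehat x$ with $j$ factors $\widehat x$. * The exchange algebra is $$\mathcal C=\{y\in\mathscr P_{1,\pm}:\ x(1\otimes\overline y)=(1\otimes\overline y)x\ \text{ and }\ x(y\otimes 1)=(y\otimes 1)x\},$$ where $y\otimes 1$ is $y$ on the left string next to a bare string on the right, and $1\otimes\overline y$ is a bare string on the left next to $\overline y$ on the right string. For a projection $e\in\mathscr P_{1,\pm}$ and $b\in e\mathscr P_{1,\pm}e$ let $\{b\}''$ be the double commutant of $b$ acting by left multiplication on $e\mathscr P_{1,\pm}$, regarded as a subset of $e\mathscr P_{1,\pm}e$; it is a $*$-algebra with unit $e$ if $b=b^*$. For $\zeta$ this is taken with $e=1$,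 and for $p_{\mathcal D}\zeta$ below with $e=p_{\mathcal D}$. For sets $M,\mathcal D\subseteq\mathscr P_{1,\pm}$ let $M\mathcal D$ be the linear span of all products $bd$ with $b\in M$ and $d\in\mathcal D$. **Theorem.** Let $\mathscr P$ be a C$^*$-planar algebra and let $x\in\mathscr P_{2,\pm}$ be $\mathfrak F$-positive. Then $p_{\max}$ exists; the series defining $\zeta$ converges for all real $z>r$ and its limit exists; $\zeta$ is a positive element of $\mathcal E$ with range projection $p_{\max}$; $\mathcal C$ is a unital $*$-subalgebra of $\mathscr P_{1,\pm}$; and 1. $p_{\max}y=yp_{\max}$ and $\zeta y=y\zeta$ for all $y\in\mathcal C$. 2. $\zeta\,\mathcal C\subseteq\mathcal E$. 3. Let $\mathcal D$ be a direct summand of the $*$-algebra $\mathcal C$ with $\mathcal D\cong M_n(\mathbb C)$, and let $p_{\mathcal D}$ be the union (supremum) of the projections in $\mathcal D$. Then $$\{\zeta\}''\mathcal D=\{p_{\mathcal D}\zeta\}''\mathcal D\cong\{p_{\mathcal D}\zeta\}''\otimes\mathcal D,$$ where both sides of the last relation are $*$-algebras and $b\otimes d\mapsto bd$ is a $*$-isomorphism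 from $\{p_{\mathcal D}\zeta\}''\otimes\mathcal D$ onto $\{p_{\mathcal D}\zeta\}''\mathcal D$. -/

import Mathlib

universe u

namespace PFPlanar

/-- The type `(n, ±)` of a box: `2 n` boundary points, and the shading of the distinguished
(`$`) boundary interval; `shaded = false` is the sign `+`. -/
structure BoxType where
  n : ℕ
  shaded : Bool

namespace BoxType

/-- Shading of the `j`-th boundary interval of a box (`true` means shaded). -/
def shadeAt (B : BoxType) (j : ℕ) : Bool := Bool.xor B.shaded (decide (j % 2 = 1))

end BoxType

section Tangles

variable {ι : Type}

/-- The box type of a disc; `none` is the output disc, `some i` is the `i`-th input disc. -/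
abbrev boxOf (b : ι → BoxType) (b₀ : BoxType) (d : Option ι) : BoxType := d.elim b₀ b

/-- The boundary points of all discs. The points of each disc are numbered
`0, …, 2 n - 1` clockwise, beginning after the `$` interval. -/
abbrev TPoint (b : ι → BoxType) (b₀ : BoxType) : Type :=
  Σ d : Option ι, Fin (2 * (boxOf b b₀ d).n)

/-- The boundary intervals of all discs. The interval `j` of a disc ends at the point `j`, and the
interval `j + 1` begins there. The numbers `0` and `2 n` both denote the `$` interval
(they are identified by `SideRel.wrap`); if `n = 0` the whole boundary circle is the only one. -/
abbrev TInterval (b : ι → BoxType) (b₀ : BoxType) : Type :=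
  Σ d : Option ι, Fin (2 * (boxOf b b₀ d).n + 1)

variable {b : ι → BoxType} {b₀ : BoxType}

/-- The interval just before a point (clockwise). -/
def before (p : TPoint b b₀) : TInterval b b₀ := ⟨p.1, p.2.castSucc⟩

/-- The interval just after a point (clockwise). -/
def after (p : TPoint b b₀) : TInterval b b₀ := ⟨p.1, p.2.succ⟩

/-- Given the other end `q` of the string that starts at `p`: the interval next to `q` which lies on
the same side of the string as `before p`. Strings run outside the input discs and inside the output
disc, so the clockwise order is reversed exactly when both ends are on input discs
or both are on the output disc. -/
def acrossBefore (p q : TPoint b b₀) : TInterval b b₀ :=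
  if p.1.isNone = q.1.isNone then after q else before q

/-- The interval next to `q` which lies on the same side of the string from `p` to `q`
as `after p`. -/
def acrossAfter (p q : TPoint b b₀) : TInterval b b₀ :=
  if p.1.isNone = q.1.isNone then before q else after q

/-- Two boundary intervals are consecutive along the boundary of a region. The classes of the
generated equivalence relation are the boundary components of the regions which meet a disc. -/
inductive SideRel (strand : TPoint b b₀ → TPoint b b₀) : TInterval b b₀ → TInterval b b₀ → Prop
  | wrap (d : Option ι) : SideRel strand ⟨d, 0⟩ ⟨d, Fin.last _⟩
  | before (p : TPoint b b₀) : SideRel strand (before p) (acrossBefore p (strand p))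
  | after (p : TPoint b b₀) : SideRel strand (after p) (acrossAfter p (strand p))

/-- Two regions are adjacent to a common disc or to a common closed loop. -/
inductive AdjRel {Region Loop : Type} (reg : TInterval b b₀ → Region) (side : Loop → Bool → Region) :
    Region → Region → Prop
  | disc (d : Option ι) (j j' : Fin (2 * (boxOf b b₀ d).n + 1)) :
      AdjRel reg side (reg ⟨d, j⟩) (reg ⟨d, j'⟩)
  | loop (l : Loop) (s s' : Bool) : AdjRel reg side (side l s) (side l s')

variable (b b₀) in
/-- A shaded planar tangle with input discs of types `b i` and output disc of type `b₀`,
up to planar isotopy. The boundary points are joined in pairs by the strings (`strand`); besides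
there are closed loops. `reg` and `side` say which regions lie along a boundary interval and on the
unshaded (`false`) and shaded (`true`) side of a loop. A region with `k` boundary components stands
for a sphere with `k` holes. Glue the regions, the discs, the strings and the loops, thickened to
strips and annuli, along their boundaries: the result is a closed oriented surface. It has to be
connected (`connected`) and of Euler characteristic two (`euler`), that is, it is the sphere; the
complement of the output disc in the sphere is the planar disc in which the tangle is drawn. -/
structure PlanarTangle where
  Region : Type
  Loop : Type
  finite_discs : Finite ι
  finite_region : Finite Region
  finite_loop : Finite Loop
  strand : TPoint b b₀ → TPoint b b₀
  strand_strand : ∀ p, strand (strand p) = p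
  strand_ne : ∀ p, strand p ≠ p
  reg : TInterval b b₀ → Region
  shade : Region → Bool
  side : Loop → Bool → Region
  reg_side : ∀ a a', SideRel strand a a' → reg a = reg a'
  shade_reg : ∀ a, shade (reg a) = (boxOf b b₀ a.1).shadeAt a.2
  shade_side : ∀ l s, shade (side l s) = s
  connected : ∀ u v, Relation.EqvGen (AdjRel reg side) u v
  /-- `2 (#discs - #strings + ∑ (2 - #boundary components of the region)) = 4`; the number of
  strings is half the number of points, and each loop contributes two boundary components. -/
  euler : 2 * Nat.card (Option ι) + 4 * Nat.card Region =
    4 + Nat.card (TPoint b b₀) + 2 * Nat.card (Quot (SideRel strand)) + 4 * Nat.card Loop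

end Tangles

section Operations

/-- The map on points induced by a relabelling of the input discs. -/
def mapPoint {ι ι' : Type} (e : ι ≃ ι') {b : ι' → BoxType} {b₀ : BoxType} :
    TPoint (fun i => b (e i)) b₀ → TPoint b b₀
  | ⟨none, j⟩ => ⟨none, j⟩
  | ⟨some i, j⟩ => ⟨some (e i), j⟩

/-- The map on intervals induced by a relabelling of the input discs. -/
def mapInterval {ι ι' : Type} (e : ι ≃ ι') {b : ι' → BoxType} {b₀ : BoxType} :
    TInterval (fun i => b (e i)) b₀ → TInterval b b₀
  | ⟨none, j⟩ => ⟨none, j⟩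
  | ⟨some i, j⟩ => ⟨some (e i), j⟩

/-- `T'` is the tangle `T` (up to isotopy), with the input discs relabelled by `e`. -/
structure TangleIso {ι ι' : Type} (e : ι ≃ ι') {b : ι' → BoxType} {b₀ : BoxType}
    (T : PlanarTangle (fun i => b (e i)) b₀) (T' : PlanarTangle b b₀) where
  region : T.Region ≃ T'.Region
  loop : T.Loop ≃ T'.Loop
  strand : ∀ p, T'.strand (mapPoint e p) = mapPoint e (T.strand p)
  reg : ∀ a, T'.reg (mapInterval e a) = region (T.reg a)
  side : ∀ l s, T'.side (loop l) s = region (T.side l s)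

/-- `T'` is the mirror image of `T`: an orientation reversing homeomorphism which fixes the `$`
interval of each disc reverses the numbering of its points. -/
structure TangleReflection {ι : Type} {b : ι → BoxType} {b₀ : BoxType}
    (T T' : PlanarTangle b b₀) where
  region : T.Region ≃ T'.Region
  loop : T.Loop ≃ T'.Loop
  strand : ∀ p : TPoint b b₀,
    T'.strand ⟨p.1, p.2.rev⟩ = ⟨(T.strand p).1, (T.strand p).2.rev⟩
  reg : ∀ a : TInterval b b₀, T'.reg ⟨a.1, a.2.rev⟩ = region (T.reg a)
  side : ∀ l s, T'.side (loop l) s = region (T.side l s)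

section Composition

variable {ι : Type} {κ : ι → Type} {b : ι → BoxType} {c : ∀ i, κ i → BoxType} {b₀ : BoxType}

variable (b c b₀) in
/-- The marked points after each tangle `S i` has been glued into the `i`-th disc of `T`: the points
of the output disc, the points on the seams, the points of the input discs of the `S i`. -/
inductive GluePoint
  | outer (j : Fin (2 * b₀.n))
  | seam (i : ι) (j : Fin (2 * (b i).n))
  | inner (i : ι) (k : κ i) (j : Fin (2 * (c i k).n))

/-- The points of the tangle `T` among the marked points. -/
def glueT : TPoint b b₀ → GluePoint b c b₀
  | ⟨none, j⟩ => .outer j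
  | ⟨some i, j⟩ => .seam i j

/-- The points of the tangle `S i` among the marked points. -/
def glueS (i : ι) : TPoint (c i) (b i) → GluePoint b c b₀
  | ⟨none, j⟩ => .seam i j
  | ⟨some k, j⟩ => .inner i k j

/-- The points of the composite among the marked points. -/
def glueU : TPoint (fun k : Σ i, κ i => c k.1 k.2) b₀ → GluePoint b c b₀
  | ⟨none, j⟩ => .outer j
  | ⟨some k, j⟩ => .inner k.1 k.2 j

variable (T : PlanarTangle b b₀) (S : ∀ i, PlanarTangle (c i) (b i))

/-- Two marked points are the ends of a string of `T` or of some `S i`. -/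
inductive PathRel : GluePoint b c b₀ → GluePoint b c b₀ → Prop
  | left (p : TPoint b b₀) : PathRel (glueT p) (glueT (T.strand p))
  | right (i : ι) (p : TPoint (c i) (b i)) : PathRel (glueS i p) (glueS i ((S i).strand p))

/-- A region of `T` and a region of `S i` meet along an interval of the seam. -/
inductive SeamRel : T.Region ⊕ (Σ i, (S i).Region) → T.Region ⊕ (Σ i, (S i).Region) → Prop
  | mk (i : ι) (j : Fin (2 * (b i).n + 1)) :
      SeamRel (Sum.inl (T.reg ⟨some i, j⟩)) (Sum.inr ⟨i, (S i).reg ⟨none, j⟩⟩)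

/-- The new closed loops: the closed paths of strings. -/
def ClosedPath : Type :=
  {w : Quot (PathRel T S) // ∀ p, Quot.mk (PathRel T S) (glueU p) ≠ w}

/-- The region on the side of colour `s` of the string at the point `p`. -/
def PlanarTangle.sideAt {ι : Type} {b : ι → BoxType} {b₀ : BoxType} (T : PlanarTangle b b₀)
    (p : TPoint b b₀) (s : Bool) : T.Region :=
  if T.shade (T.reg (before p)) = s then T.reg (before p) else T.reg (after p)

/-- `U` is the composite of tangles obtained by gluing `S i` into the `i`-th input disc of `T`,
for all `i`, with the `$` intervals matched. -/
structure TangleComp (U : PlanarTangle (fun k : Σ i, κ i => c k.1 k.2) b₀) where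
  region : Quot (SeamRel T S) ≃ U.Region
  loop : T.Loop ⊕ (Σ i, (S i).Loop) ⊕ ClosedPath T S ≃ U.Loop
  strand : ∀ p, Quot.mk (PathRel T S) (glueU p) = Quot.mk (PathRel T S) (glueU (U.strand p))
  reg_outer : ∀ j, U.reg ⟨none, j⟩ = region (Quot.mk _ (Sum.inl (T.reg ⟨none, j⟩)))
  reg_inner : ∀ i k j, U.reg ⟨some ⟨i, k⟩, j⟩ =
    region (Quot.mk _ (Sum.inr ⟨i, (S i).reg ⟨some k, j⟩⟩))
  side_left : ∀ l s, U.side (loop (Sum.inl l)) s = region (Quot.mk _ (Sum.inl (T.side l s)))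
  side_right : ∀ i l s, U.side (loop (Sum.inr (Sum.inl ⟨i, l⟩))) s =
    region (Quot.mk _ (Sum.inr ⟨i, (S i).side l s⟩))
  side_closed : ∀ (w : ClosedPath T S) (i : ι) (j : Fin (2 * (b i).n)),
    Quot.mk (PathRel T S) (GluePoint.seam i j) = w.1 →
    ∀ s, U.side (loop (Sum.inr (Sum.inr w))) s =
      region (Quot.mk _ (Sum.inl (T.sideAt ⟨some i, j⟩ s)))

end Composition

end Operations

section Construction

theorem card_quot_eq {I X : Type} {r : I → I → Prop} (f : I → X) (s : X → I)
    (hr : ∀ a a', r a a' → f a = f a') (hf : ∀ x, f (s x) = x)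
    (hs : ∀ a, Quot.mk r a = Quot.mk r (s (f a))) : Nat.card (Quot r) = Nat.card X :=
  Nat.card_congr
    { toFun := Quot.lift f hr
      invFun := fun x => Quot.mk r (s x)
      left_inv := fun q => Quot.inductionOn q fun a => (hs a).symm
      right_inv := hf }

variable {ι : Type} {b : ι → BoxType} {b₀ : BoxType}

theorem connected_of_common {Region Loop : Type}
    (reg : TInterval b b₀ → Region) (side : Loop → Bool → Region) (u : Region)
    (h : ∀ d, ∃ j, reg ⟨d, j⟩ = u) (hs : Function.Surjective reg) (v w : Region) :
    Relation.EqvGen (AdjRel reg side) v w := by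
  have key : ∀ v, Relation.EqvGen (AdjRel reg side) v u := by
    intro v
    obtain ⟨⟨d, j⟩, rfl⟩ := hs v
    obtain ⟨j', rfl⟩ := h d
    exact .rel _ _ (.disc d j j')
  exact (key v).trans _ _ _ ((key w).symm _ _)

theorem card_tpoint [Fintype ι] (b : ι → BoxType) (b₀ : BoxType) :
    Nat.card (TPoint b b₀) = 2 * b₀.n + ∑ i, 2 * (b i).n := by
  simp [TPoint, boxOf]

theorem interval_ext {p q : TInterval b b₀} (h : p.1 = q.1) (h' : p.2.1 = q.2.1) : p = q := by
  obtain ⟨d, j⟩ := p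
  obtain ⟨d', j'⟩ := q
  obtain rfl : d = d' := h
  rw [show j = j' from Fin.ext h']

theorem point_ext {p q : TPoint b b₀} (h : p.1 = q.1) (h' : p.2.1 = q.2.1) : p = q := by
  obtain ⟨d, j⟩ := p
  obtain ⟨d', j'⟩ := q
  obtain rfl : d = d' := h
  rw [show j = j' from Fin.ext h']

/-- A tangle without loops, from its strings and a description of the boundary components of its
regions: `f` maps an interval to its boundary component, `s` chooses an interval on each one, and
`g` maps a boundary component to its region. -/
def PlanarTangle.ofStrands [Finite ι] (X Region : Type) [Finite Region]
    (strand : TPoint b b₀ → TPoint b b₀)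
    (strand_strand : ∀ p, strand (strand p) = p)
    (strand_ne : ∀ p, strand p ≠ p)
    (f : TInterval b b₀ → X) (s : X → TInterval b b₀) (g : X → Region)
    (hr : ∀ a a', SideRel strand a a' → f a = f a') (hf : ∀ x, f (s x) = x)
    (hs : ∀ a, Quot.mk (SideRel strand) a = Quot.mk (SideRel strand) (s (f a)))
    (hg : Function.Surjective g)
    (shade : Region → Bool)
    (shade_reg : ∀ a, shade (g (f a)) = (boxOf b b₀ a.1).shadeAt a.2)
    (u : Region) (hu : ∀ d, ∃ j, g (f ⟨d, j⟩) = u)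
    (euler : 2 * Nat.card (Option ι) + 4 * Nat.card Region =
      4 + Nat.card (TPoint b b₀) + 2 * Nat.card X) : PlanarTangle b b₀ where
  Region := Region
  Loop := Empty
  finite_discs := inferInstance
  finite_region := inferInstance
  finite_loop := inferInstance
  strand := strand
  strand_strand := strand_strand
  strand_ne := strand_ne
  reg := fun a => g (f a)
  shade := shade
  side := fun l => l.elim
  reg_side := fun a a' h => by rw [hr a a' h]
  shade_reg := shade_reg
  shade_side := fun l => l.elim
  connected := connected_of_common _ _ u hu
    (hg.comp (fun x => ⟨s x, hf x⟩))
  euler := by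
    rw [card_quot_eq f s hr hf hs]
    simpa using euler

/-- The next boundary interval along the boundary of a region. -/
def nextInterval (strand : TPoint b b₀ → TPoint b b₀) : TInterval b b₀ → TInterval b b₀
  | ⟨none, j⟩ =>
    if h : j.1 = 0 then ⟨none, Fin.last _⟩
    else acrossAfter ⟨none, ⟨j.1 - 1, by omega⟩⟩ (strand ⟨none, ⟨j.1 - 1, by omega⟩⟩)
  | ⟨some i, j⟩ =>
    if h : j.1 < 2 * (b i).n then acrossBefore ⟨some i, ⟨j.1, h⟩⟩ (strand ⟨some i, ⟨j.1, h⟩⟩)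
    else ⟨some i, 0⟩

theorem quot_next (strand : TPoint b b₀ → TPoint b b₀) (a : TInterval b b₀) :
    Quot.mk (SideRel strand) a = Quot.mk (SideRel strand) (nextInterval strand a) := by
  rcases a with ⟨_ | i, j⟩
  · by_cases h : j.1 = 0
    · simp only [nextInterval, h, dite_true]
      refine Eq.trans ?_ (Quot.sound (SideRel.wrap none))
      exact congrArg _ (interval_ext rfl h)
    · simp only [nextInterval, h, dite_false]
      refine Eq.trans ?_ (Quot.sound (SideRel.after _))
      refine congrArg _ (interval_ext rfl ?_)
      change j.1 = j.1 - 1 + 1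
      omega
  · by_cases h : j.1 < 2 * (b i).n
    · simp only [nextInterval, h, dite_true]
      exact Quot.sound (SideRel.before ⟨some i, ⟨j.1, h⟩⟩)
    · simp only [nextInterval, h, dite_false]
      refine Eq.trans ?_ (Quot.sound (SideRel.wrap (some i))).symm
      refine congrArg _ (interval_ext rfl ?_)
      have := j.2
      change j.1 = 2 * (b i).n
      change j.1 < 2 * (b i).n + 1 at this
      omega

theorem quot_of_iterate (strand : TPoint b b₀ → TPoint b b₀) (a a' : TInterval b b₀)
    (h : ∃ k : Fin 9, (nextInterval strand)^[k] a = a') :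
    Quot.mk (SideRel strand) a = Quot.mk (SideRel strand) a' := by
  obtain ⟨k, rfl⟩ := h
  induction (k : ℕ) with
  | zero => rfl
  | succ m ih => rw [Function.iterate_succ_apply', ← quot_next, ih]

theorem sideRel_inv {X : Type} {strand : TPoint b b₀ → TPoint b b₀} {f : TInterval b b₀ → X}
    (h1 : ∀ d, f ⟨d, 0⟩ = f ⟨d, Fin.last _⟩)
    (h2 : ∀ p, f (before p) = f (acrossBefore p (strand p)))
    (h3 : ∀ p, f (after p) = f (acrossAfter p (strand p))) (a a' : TInterval b b₀)
    (h : SideRel strand a a') : f a = f a' := by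
  rcases h with d | p | p
  · exact h1 d
  · exact h2 p
  · exact h3 p

end Construction

section BasicTangles

/-- The tangle without input discs consisting of `n` vertical strings. -/
def oneTangle (B : BoxType) : PlanarTangle (ι := Empty) (fun _ => B) B :=
  PlanarTangle.ofStrands (Fin (B.n + 1)) (Fin (B.n + 1))
    (strand := fun
      | ⟨none, j⟩ => ⟨none, j.rev⟩)
    (strand_strand := by
      rintro ⟨_ | i, j⟩
      · exact point_ext rfl (congrArg Fin.val (Fin.rev_rev j))
      · exact i.elim)
    (strand_ne := by
      rintro ⟨_ | i, j, hj⟩ h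
      · have h1 := congrArg (fun x => x.2.1) h
        change j < 2 * B.n at hj
        change 2 * B.n - (j + 1) = j at h1
        omega
      · exact i.elim)
    (f := fun
      | ⟨none, j⟩ => ⟨min j.1 (2 * B.n - j.1), by omega⟩)
    (s := fun k => ⟨none, ⟨k.1, by have := k.2; change k.1 < 2 * B.n + 1; omega⟩⟩)
    (g := id)
    (hr := by
      apply sideRel_inv
      · rintro (_ | i)
        · simp
        · exact i.elim
      · rintro ⟨_ | i, j, hj⟩
        · change j < 2 * B.n at hj
          ext
          change min j (2 * B.n - j) =
            min (2 * B.n - (j + 1) + 1) (2 * B.n - (2 * B.n - (j + 1) + 1))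
          omega
        · exact i.elim
      · rintro ⟨_ | i, j, hj⟩
        · change j < 2 * B.n at hj
          ext
          change min (j + 1) (2 * B.n - (j + 1)) =
            min (2 * B.n - (j + 1)) (2 * B.n - (2 * B.n - (j + 1)))
          omega
        · exact i.elim)
    (hf := by
      intro k
      have hk := k.2
      ext
      change min k.1 (2 * B.n - k.1) = k.1
      omega)
    (hs := by
      rintro ⟨_ | i, j, hj⟩
      · change j < 2 * B.n + 1 at hj
        by_cases hjn : j ≤ B.n
        · refine congrArg _ (interval_ext rfl ?_)
          change j = min j (2 * B.n - j)
          omega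
        · refine (quot_next _ _).trans (congrArg _ ?_)
          rw [nextInterval, dif_neg (by change ¬ j = 0; omega)]
          refine interval_ext rfl ?_
          change 2 * B.n - (j - 1 + 1) = min j (2 * B.n - j)
          omega
      · exact i.elim)
    (hg := Function.surjective_id)
    (shade := fun k => B.shadeAt k)
    (shade_reg := by
      rintro ⟨_ | i, j, hj⟩
      · change j < 2 * B.n + 1 at hj
        change B.shadeAt (min j (2 * B.n - j)) = B.shadeAt j
        have : min j (2 * B.n - j) % 2 = j % 2 := by omega
        simp only [BoxType.shadeAt, this]
      · exact i.elim)
    (u := 0)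
    (hu := by
      rintro (_ | i)
      · exact ⟨0, by simp⟩
      · exact i.elim)
    (euler := by
      rw [card_tpoint]
      simp
      omega)

/-- The rotation by one click of a `1`-box (by `180°`). -/
def barTangle (ε : Bool) : PlanarTangle (ι := Unit) (fun _ => ⟨1, ε⟩) ⟨1, !ε⟩ :=
  PlanarTangle.ofStrands (Fin 2) (Fin 2)
    (strand := fun
      | ⟨none, j⟩ => (![⟨some (), (1 : Fin 2)⟩, ⟨some (), (0 : Fin 2)⟩] :
          Fin 2 → TPoint (fun _ : Unit => ⟨1, ε⟩) ⟨1, !ε⟩) j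
      | ⟨some (), j⟩ => (![⟨none, (1 : Fin 2)⟩, ⟨none, (0 : Fin 2)⟩] :
          Fin 2 → TPoint (fun _ : Unit => ⟨1, ε⟩) ⟨1, !ε⟩) j)
    (strand_strand := by revert ε; decide)
    (strand_ne := by revert ε; decide)
    (f := fun
      | ⟨none, j⟩ => ⟨(j + 1) % 2, by omega⟩
      | ⟨some _, j⟩ => ⟨j % 2, by omega⟩)
    (s := fun k => ⟨some (), k.castSucc⟩)
    (g := id)
    (hr := sideRel_inv (by revert ε; decide) (by revert ε; decide) (by revert ε; decide))
    (hf := by revert ε; decide)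
    (hs := fun a => quot_of_iterate _ _ _ (by revert ε a; decide))
    (hg := Function.surjective_id)
    (shade := fun k => BoxType.shadeAt ⟨1, ε⟩ k)
    (shade_reg := by revert ε; decide)
    (u := 0)
    (hu := by revert ε; decide)
    (euler := by simp)

/-- The Fourier transform: the clockwise rotation of a `2`-box by one click (by `90°`). -/
def fourierTangle (ε : Bool) : PlanarTangle (ι := Unit) (fun _ => ⟨2, ε⟩) ⟨2, !ε⟩ :=
  PlanarTangle.ofStrands (Fin 4) (Fin 4)
    (strand := fun
      | ⟨none, j⟩ => (![⟨some (), (3 : Fin 4)⟩, ⟨some (), (0 : Fin 4)⟩, ⟨some (), (1 : Fin 4)⟩, ⟨some (), (2 : Fin 4)⟩] :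
          Fin 4 → TPoint (fun _ : Unit => ⟨2, ε⟩) ⟨2, !ε⟩) j
      | ⟨some (), j⟩ => (![⟨none, (1 : Fin 4)⟩, ⟨none, (2 : Fin 4)⟩, ⟨none, (3 : Fin 4)⟩, ⟨none, (0 : Fin 4)⟩] :
          Fin 4 → TPoint (fun _ : Unit => ⟨2, ε⟩) ⟨2, !ε⟩) j)
    (strand_strand := by revert ε; decide)
    (strand_ne := by revert ε; decide)
    (f := fun
      | ⟨none, j⟩ => ⟨(j + 3) % 4, by omega⟩
      | ⟨some _, j⟩ => ⟨j % 4, by omega⟩)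
    (s := fun k => ⟨some (), k.castSucc⟩)
    (g := id)
    (hr := sideRel_inv (by revert ε; decide) (by revert ε; decide) (by revert ε; decide))
    (hf := by revert ε; decide)
    (hs := fun a => quot_of_iterate _ _ _ (by revert ε a; decide))
    (hg := Function.surjective_id)
    (shade := fun k => BoxType.shadeAt ⟨2, ε⟩ k)
    (shade_reg := by revert ε; decide)
    (u := 0)
    (hu := by revert ε; decide)
    (euler := by simp)

/-- A `1`-box with a vertical string on its right. -/
def rightStringTangle (ε : Bool) : PlanarTangle (ι := Unit) (fun _ => ⟨1, ε⟩) ⟨2, ε⟩ :=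
  PlanarTangle.ofStrands (Fin 3) (Fin 3)
    (strand := fun
      | ⟨none, j⟩ => (![⟨some (), (0 : Fin 2)⟩, ⟨none, (2 : Fin 4)⟩, ⟨none, (1 : Fin 4)⟩,
          ⟨some (), (1 : Fin 2)⟩] : Fin 4 → TPoint (fun _ : Unit => ⟨1, ε⟩) ⟨2, ε⟩) j
      | ⟨some (), j⟩ => (![⟨none, (0 : Fin 4)⟩, ⟨none, (3 : Fin 4)⟩] :
          Fin 2 → TPoint (fun _ : Unit => ⟨1, ε⟩) ⟨2, ε⟩) j)
    (strand_strand := by revert ε; decide)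
    (strand_ne := by revert ε; decide)
    (f := fun
      | ⟨none, j⟩ => (![0, 1, 2, 1, 0] : Fin 5 → Fin 3) j
      | ⟨some _, j⟩ => (![0, 1, 0] : Fin 3 → Fin 3) j)
    (s := fun k => ⟨none, (k.castLE (by decide) : Fin 5)⟩)
    (g := id)
    (hr := sideRel_inv (by revert ε; decide) (by revert ε; decide) (by revert ε; decide))
    (hf := by revert ε; decide)
    (hs := fun a => quot_of_iterate _ _ _ (by revert ε a; decide))
    (hg := Function.surjective_id)
    (shade := fun k => BoxType.shadeAt ⟨2, ε⟩ k)
    (shade_reg := by revert ε; decide)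
    (u := 0)
    (hu := by revert ε; decide)
    (euler := by simp)

/-- A `1`-box with a vertical string on its left. -/
def leftStringTangle (ε : Bool) : PlanarTangle (ι := Unit) (fun _ => ⟨1, !ε⟩) ⟨2, ε⟩ :=
  PlanarTangle.ofStrands (Fin 3) (Fin 3)
    (strand := fun
      | ⟨none, j⟩ => (![⟨none, (3 : Fin 4)⟩, ⟨some (), (0 : Fin 2)⟩, ⟨some (), (1 : Fin 2)⟩,
          ⟨none, (0 : Fin 4)⟩] : Fin 4 → TPoint (fun _ : Unit => ⟨1, !ε⟩) ⟨2, ε⟩) j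
      | ⟨some (), j⟩ => (![⟨none, (1 : Fin 4)⟩, ⟨none, (2 : Fin 4)⟩] :
          Fin 2 → TPoint (fun _ : Unit => ⟨1, !ε⟩) ⟨2, ε⟩) j)
    (strand_strand := by revert ε; decide)
    (strand_ne := by revert ε; decide)
    (f := fun
      | ⟨none, j⟩ => (![0, 1, 2, 1, 0] : Fin 5 → Fin 3) j
      | ⟨some _, j⟩ => (![1, 2, 1] : Fin 3 → Fin 3) j)
    (s := fun k => ⟨none, (k.castLE (by decide) : Fin 5)⟩)
    (g := id)
    (hr := sideRel_inv (by revert ε; decide) (by revert ε; decide) (by revert ε; decide))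
    (hf := by revert ε; decide)
    (hs := fun a => quot_of_iterate _ _ _ (by revert ε a; decide))
    (hg := Function.surjective_id)
    (shade := fun k => BoxType.shadeAt ⟨2, ε⟩ k)
    (shade_reg := by revert ε; decide)
    (u := 1)
    (hu := by revert ε; decide)
    (euler := by simp)

/-- The box types of the convolution of a `1`-box with a `2`-box. -/
abbrev convBox (ε : Bool) : Fin 2 → BoxType
  | 0 => ⟨1, ε⟩
  | 1 => ⟨2, !ε⟩

/-- The convolution of a `1`-box (disc `0`, on the left) and a `2`-box (disc `1`, on the right): the
top and the bottom of the `1`-box are joined to the upper left and lower left point of the `2`-box,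
whose upper right and lower right points are the top and the bottom of the result. -/
def convTangle (ε : Bool) : PlanarTangle (convBox ε) ⟨1, ε⟩ :=
  PlanarTangle.ofStrands (Fin 3) (Fin 3)
    (strand := fun
      | ⟨none, j⟩ => (![⟨some 1, (1 : Fin 4)⟩, ⟨some 1, (2 : Fin 4)⟩] :
          Fin 2 → TPoint (convBox ε) ⟨1, ε⟩) j
      | ⟨some 0, j⟩ => (![⟨some 1, (0 : Fin 4)⟩, ⟨some 1, (3 : Fin 4)⟩] :
          Fin 2 → TPoint (convBox ε) ⟨1, ε⟩) j
      | ⟨some 1, j⟩ => (![⟨some 0, (0 : Fin 2)⟩, ⟨none, (0 : Fin 2)⟩, ⟨none, (1 : Fin 2)⟩,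
          ⟨some 0, (1 : Fin 2)⟩] : Fin 4 → TPoint (convBox ε) ⟨1, ε⟩) j)
    (strand_strand := by revert ε; decide)
    (strand_ne := by revert ε; decide)
    (f := fun
      | ⟨none, j⟩ => (![0, 2, 0] : Fin 3 → Fin 3) j
      | ⟨some 0, j⟩ => (![0, 1, 0] : Fin 3 → Fin 3) j
      | ⟨some 1, j⟩ => (![1, 0, 2, 0, 1] : Fin 5 → Fin 3) j)
    (s := fun k => ⟨some 1, (![1, 0, 2] : Fin 3 → Fin 5) k⟩)
    (g := id)
    (hr := sideRel_inv (by revert ε; decide) (by revert ε; decide) (by revert ε; decide))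
    (hf := by revert ε; decide)
    (hs := fun a => quot_of_iterate _ _ _ (by revert ε a; decide))
    (hg := Function.surjective_id)
    (shade := fun k => Bool.xor ε (decide (k ≠ 0)))
    (shade_reg := by revert ε; decide)
    (u := 0)
    (hu := by revert ε; decide)
    (euler := by simp [convBox])

/-- The identity tangle: the point `j` of the input disc is joined to the point `j` of the output
disc, for all `j`. -/
def idTangle : (B : BoxType) → PlanarTangle (ι := Unit) (fun _ => B) B
  | ⟨0, ε⟩ => PlanarTangle.ofStrands (Option Unit) Unit
      (strand := id)
      (strand_strand := by revert ε; decide)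
      (strand_ne := by revert ε; decide)
      (f := fun a => a.1)
      (s := fun d => ⟨d, ⟨0, by omega⟩⟩)
      (g := fun _ => ())
      (hr := sideRel_inv (by revert ε; decide) (by revert ε; decide) (by revert ε; decide))
      (hf := by revert ε; decide)
      (hs := fun a => quot_of_iterate _ _ _ (by revert ε a; decide))
      (hg := fun _ => ⟨none, rfl⟩)
      (shade := fun _ => ε)
      (shade_reg := by revert ε; decide)
      (u := ())
      (hu := by revert ε; decide)
      (euler := by simp)
  | ⟨n + 1, ε⟩ => PlanarTangle.ofStrands (Fin (2 * (n + 1))) (Fin (2 * (n + 1)))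
      (strand := fun
        | ⟨none, j⟩ => ⟨some (), j⟩
        | ⟨some (), j⟩ => ⟨none, j⟩)
      (strand_strand := by rintro ⟨_ | _, j⟩ <;> rfl)
      (strand_ne := by rintro ⟨_ | _, j⟩ <;> exact fun h => by cases congrArg Sigma.fst h)
      (f := fun a => ⟨a.2 % (2 * (n + 1)), Nat.mod_lt _ (by omega)⟩)
      (s := fun k => ⟨none, Fin.castSucc k⟩)
      (g := id)
      (hr := by
        apply sideRel_inv
        · rintro (_ | _) <;>
          · ext
            change 0 % (2 * (n + 1)) = (2 * (n + 1)) % (2 * (n + 1))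
            simp
        · rintro ⟨_ | _, j⟩ <;> rfl
        · rintro ⟨_ | _, j⟩ <;> rfl)
      (hf := fun k => Fin.ext (Nat.mod_eq_of_lt k.2))
      (hs := by
        have main : ∀ j (hj : j < 2 * (n + 1) + 1), Quot.mk (SideRel (b := fun _ : Unit => ⟨n + 1, ε⟩)
            (b₀ := ⟨n + 1, ε⟩) fun
              | ⟨none, j⟩ => ⟨some (), j⟩
              | ⟨some (), j⟩ => ⟨none, j⟩) ⟨none, ⟨j, hj⟩⟩ =
            Quot.mk _ ⟨none, ⟨j % (2 * (n + 1)), by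
              have := Nat.mod_lt j (y := 2 * (n + 1)) (by omega)
              change j % (2 * (n + 1)) < 2 * (n + 1) + 1
              omega⟩⟩ := by
          intro j hj
          by_cases h : j < 2 * (n + 1)
          · exact congrArg _ (interval_ext rfl (Nat.mod_eq_of_lt h).symm)
          · obtain rfl : j = 2 * (n + 1) := by omega
            refine (Quot.sound (SideRel.wrap none)).symm.trans (congrArg _ (interval_ext rfl ?_))
            change 0 = 2 * (n + 1) % (2 * (n + 1))
            simp
        rintro ⟨_ | _, j, hj⟩
        · exact main j hj
        · refine Eq.trans ?_ (main j hj)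
          by_cases h : j < 2 * (n + 1)
          · exact Quot.sound (SideRel.before (b := fun _ : Unit => ⟨n + 1, ε⟩)
              (b₀ := ⟨n + 1, ε⟩) ⟨some (), ⟨j, h⟩⟩)
          · have hj' : j < 2 * (n + 1) + 1 := hj
            obtain rfl : j = 2 * (n + 1) := by omega
            exact Quot.sound (SideRel.after (b := fun _ : Unit => ⟨n + 1, ε⟩) (b₀ := ⟨n + 1, ε⟩)
              ⟨some (), ⟨2 * n + 1, by change _ < 2 * (n + 1); omega⟩⟩))
      (hg := Function.surjective_id)
      (shade := fun k => BoxType.shadeAt ⟨n + 1, ε⟩ k)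
      (shade_reg := by
        have main : ∀ j, BoxType.shadeAt ⟨n + 1, ε⟩ (j % (2 * (n + 1))) =
            BoxType.shadeAt ⟨n + 1, ε⟩ j := by
          intro j
          simp only [BoxType.shadeAt, Nat.mod_mul_right_mod]
        rintro ⟨_ | _, j⟩
        · exact main j
        · exact main j)
      (u := 0)
      (hu := by rintro (_ | _) <;> exact ⟨0, rfl⟩)
      (euler := by
        rw [card_tpoint]
        simp
        omega)

/-- The trace tangle: the point `j` is joined to the point `2 n - 1 - j` by a string which passes
to the right of the input disc. -/
def traceTangle (B : BoxType) : PlanarTangle (ι := Unit) (fun _ => B) ⟨0, B.shaded⟩ :=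
  PlanarTangle.ofStrands (Option (Fin (B.n + 1))) (Fin (B.n + 1))
    (strand := fun
      | ⟨none, j⟩ => ⟨none, j⟩
      | ⟨some (), j⟩ => ⟨some (), j.rev⟩)
    (strand_strand := by
      rintro ⟨_ | _, j⟩
      · rfl
      · exact point_ext rfl (congrArg Fin.val (Fin.rev_rev j)))
    (strand_ne := by
      rintro ⟨_ | _, j, hj⟩ h
      · exact absurd hj (Nat.not_lt_zero _)
      · have h1 := congrArg (fun x => x.2.1) h
        change j < 2 * B.n at hj
        change 2 * B.n - (j + 1) = j at h1
        omega)
    (f := fun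
      | ⟨none, _⟩ => none
      | ⟨some (), j⟩ => some ⟨min j.1 (2 * B.n - j.1), by omega⟩)
    (s := fun
      | none => ⟨none, ⟨0, by omega⟩⟩
      | some k => ⟨some (), ⟨k.1, by have := k.2; change k.1 < 2 * B.n + 1; omega⟩⟩)
    (g := fun k => k.getD 0)
    (hr := by
      apply sideRel_inv
      · rintro (_ | _)
        · rfl
        · refine congrArg some (Fin.ext ?_)
          change min 0 (2 * B.n - 0) = min (2 * B.n) (2 * B.n - 2 * B.n)
          omega
      · rintro ⟨_ | _, j, hj⟩
        · exact absurd hj (Nat.not_lt_zero _)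
        · refine congrArg some (Fin.ext ?_)
          change j < 2 * B.n at hj
          change min j (2 * B.n - j) =
            min (2 * B.n - (j + 1) + 1) (2 * B.n - (2 * B.n - (j + 1) + 1))
          omega
      · rintro ⟨_ | _, j, hj⟩
        · exact absurd hj (Nat.not_lt_zero _)
        · refine congrArg some (Fin.ext ?_)
          change j < 2 * B.n at hj
          change min (j + 1) (2 * B.n - (j + 1)) =
            min (2 * B.n - (j + 1)) (2 * B.n - (2 * B.n - (j + 1)))
          omega)
    (hf := by
      rintro (_ | k)
      · rfl
      · have hk := k.2
        refine congrArg some (Fin.ext ?_)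
        change min k.1 (2 * B.n - k.1) = k.1
        omega)
    (hs := by
      rintro ⟨_ | _, j, hj⟩
      · refine congrArg _ (interval_ext rfl ?_)
        change j < 0 + 1 at hj
        change j = 0
        omega
      · change j < 2 * B.n + 1 at hj
        by_cases hjn : j ≤ B.n
        · refine congrArg _ (interval_ext rfl ?_)
          change j = min j (2 * B.n - j)
          omega
        · by_cases hj2 : j < 2 * B.n
          · refine (Quot.sound (SideRel.before (b := fun _ : Unit => B)
              (b₀ := ⟨0, B.shaded⟩) ⟨some (), ⟨j, hj2⟩⟩)).trans
              (congrArg _ (interval_ext rfl ?_))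
            change 2 * B.n - (j + 1) + 1 = min j (2 * B.n - j)
            omega
          · obtain rfl : j = 2 * B.n := by omega
            refine (Quot.sound (SideRel.wrap (some ()))).symm.trans
              (congrArg _ (interval_ext rfl ?_))
            change 0 = min (2 * B.n) (2 * B.n - 2 * B.n)
            omega)
    (hg := fun k => ⟨some k, rfl⟩)
    (shade := fun k => B.shadeAt k)
    (shade_reg := by
      rintro ⟨_ | _, j, hj⟩
      · change j < 0 + 1 at hj
        obtain rfl : j = 0 := by omega
        rfl
      · change j < 2 * B.n + 1 at hj
        change B.shadeAt (min j (2 * B.n - j)) = B.shadeAt j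
        have : min j (2 * B.n - j) % 2 = j % 2 := by omega
        simp only [BoxType.shadeAt, this])
    (u := 0)
    (hu := by
      rintro (_ | _)
      · exact ⟨⟨0, by omega⟩, rfl⟩
      · refine ⟨⟨0, by omega⟩, ?_⟩
        ext
        change min 0 (2 * B.n - 0) = 0
        omega)
    (euler := by
      rw [card_tpoint]
      simp
      omega)

/-- The regions of the multiplication tangle of `(n + 1)`-boxes: the left one (`inl false`), the
right one (`inl true`), and `3 n` regions between vertical strings in three levels. This is the
region at the interval `j` of a disc with the level `l` above and the level `l'` below it. -/
def mulRegion (n : ℕ) (l l' : Fin 3) (j : ℕ) : Bool ⊕ Fin 3 × Fin n :=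
  if h : 1 ≤ j ∧ j ≤ n then .inr (l, ⟨j - 1, by omega⟩)
  else if j = n + 1 then .inl true
  else if h : n + 2 ≤ j ∧ j ≤ 2 * n + 1 then .inr (l', ⟨2 * n + 1 - j, by omega⟩)
  else .inl false

theorem mulRegion_upper (n : ℕ) (l a c : Fin 3) (j : ℕ) (hj : j ≤ n + 1) :
    mulRegion n l a j = mulRegion n l c j := by
  unfold mulRegion
  split_ifs <;> first | rfl | omega

theorem mulRegion_lower (n : ℕ) (l a c : Fin 3) (j : ℕ) (hj : n + 1 ≤ j) :
    mulRegion n a l j = mulRegion n c l j := by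
  unfold mulRegion
  split_ifs <;> first | rfl | omega

theorem mulRegion_middle (n : ℕ) (l a c : Fin 3) (j j' : ℕ) (hj : j ≤ n + 1)
    (hj' : j + j' = 2 * (n + 1)) : mulRegion n a l j' = mulRegion n l c j := by
  unfold mulRegion
  split_ifs <;> first | rfl | omega | (congr 3; omega)

/-- The regions at the intervals of the multiplication tangle. -/
def mulReg (n : ℕ) (ε : Bool) :
    TInterval (fun _ : Fin 2 => ⟨n + 1, ε⟩) ⟨n + 1, ε⟩ → Bool ⊕ Fin 3 × Fin n
  | ⟨none, j⟩ => mulRegion n 0 2 j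
  | ⟨some 1, j⟩ => mulRegion n 0 1 j
  | ⟨some 0, j⟩ => mulRegion n 1 2 j

/-- An interval at each region of the multiplication tangle. -/
def mulRep (n : ℕ) (ε : Bool) :
    Bool ⊕ Fin 3 × Fin n → TInterval (fun _ : Fin 2 => ⟨n + 1, ε⟩) ⟨n + 1, ε⟩
    | .inl false => ⟨none, (⟨0, by omega⟩ : Fin (2 * (n + 1) + 1))⟩
    | .inl true => ⟨none, (⟨n + 1, by omega⟩ : Fin (2 * (n + 1) + 1))⟩
    | .inr (0, k) => ⟨none, (⟨k + 1, by omega⟩ : Fin (2 * (n + 1) + 1))⟩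
    | .inr (1, k) => ⟨some 0, (⟨k + 1, by omega⟩ : Fin (2 * (n + 1) + 1))⟩
    | .inr (2, k) => ⟨none, (⟨2 * n + 1 - k, by omega⟩ : Fin (2 * (n + 1) + 1))⟩

/-- The strings of the multiplication tangle. -/
def mulStrand (B : BoxType) : TPoint (fun _ : Fin 2 => B) B → TPoint (fun _ : Fin 2 => B) B
  | ⟨none, j⟩ => if j.1 < B.n then ⟨some 1, j⟩ else ⟨some 0, j⟩
  | ⟨some 1, j⟩ => if j.1 < B.n then ⟨none, j⟩ else ⟨some 0, j.rev⟩
  | ⟨some 0, j⟩ => if j.1 < B.n then ⟨some 1, j.rev⟩ else ⟨none, j⟩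

section

variable {B : BoxType} {j : Fin (2 * B.n)}

theorem mulStrand_none_lt (h : j.1 < B.n) : mulStrand B ⟨none, j⟩ = ⟨some 1, j⟩ := if_pos h

theorem mulStrand_none_ge (h : ¬ j.1 < B.n) : mulStrand B ⟨none, j⟩ = ⟨some 0, j⟩ := if_neg h

theorem mulStrand_one_lt (h : j.1 < B.n) : mulStrand B ⟨some 1, j⟩ = ⟨none, j⟩ := if_pos h

theorem mulStrand_one_ge (h : ¬ j.1 < B.n) : mulStrand B ⟨some 1, j⟩ = ⟨some 0, j.rev⟩ := if_neg h

theorem mulStrand_zero_lt (h : j.1 < B.n) : mulStrand B ⟨some 0, j⟩ = ⟨some 1, j.rev⟩ := if_pos h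

theorem mulStrand_zero_ge (h : ¬ j.1 < B.n) : mulStrand B ⟨some 0, j⟩ = ⟨none, j⟩ := if_neg h

/-- An eliminator for the cases of `mulStrand`. -/
theorem mulStrand_cases {C : TPoint (fun _ : Fin 2 => B) B → TPoint (fun _ : Fin 2 => B) B → Prop}
    (h1 : ∀ j : Fin (2 * B.n), j.1 < B.n → C ⟨none, j⟩ ⟨some 1, j⟩)
    (h2 : ∀ j : Fin (2 * B.n), ¬ j.1 < B.n → C ⟨none, j⟩ ⟨some 0, j⟩)
    (h3 : ∀ j : Fin (2 * B.n), j.1 < B.n → C ⟨some 1, j⟩ ⟨none, j⟩)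
    (h4 : ∀ j : Fin (2 * B.n), ¬ j.1 < B.n → C ⟨some 1, j⟩ ⟨some 0, j.rev⟩)
    (h5 : ∀ j : Fin (2 * B.n), j.1 < B.n → C ⟨some 0, j⟩ ⟨some 1, j.rev⟩)
    (h6 : ∀ j : Fin (2 * B.n), ¬ j.1 < B.n → C ⟨some 0, j⟩ ⟨none, j⟩)
    (p : TPoint (fun _ : Fin 2 => B) B) : C p (mulStrand B p) := by
  rcases p with ⟨_ | i, (j : Fin (2 * B.n))⟩
  · by_cases h : j.1 < B.n
    · rw [mulStrand_none_lt h]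
      exact h1 j h
    · rw [mulStrand_none_ge h]
      exact h2 j h
  · obtain rfl | rfl : i = 0 ∨ i = 1 := by fin_cases i <;> simp
    · by_cases h : j.1 < B.n
      · rw [mulStrand_zero_lt h]
        exact h5 j h
      · rw [mulStrand_zero_ge h]
        exact h6 j h
    · by_cases h : j.1 < B.n
      · rw [mulStrand_one_lt h]
        exact h3 j h
      · rw [mulStrand_one_ge h]
        exact h4 j h

theorem mulStrand_mulStrand (p : TPoint (fun _ : Fin 2 => B) B) :
    mulStrand B (mulStrand B p) = p := by
  refine mulStrand_cases (C := fun p q => mulStrand B q = p) ?_ ?_ ?_ ?_ ?_ ?_ p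
  · exact fun j h => mulStrand_one_lt h
  · exact fun j h => mulStrand_zero_ge h
  · exact fun j h => mulStrand_none_lt h
  · intro j h
    rw [mulStrand_zero_lt (by rw [Fin.val_rev]; omega), Fin.rev_rev]
  · intro j h
    rw [mulStrand_one_ge (by rw [Fin.val_rev]; omega), Fin.rev_rev]
  · exact fun j h => mulStrand_none_ge h

theorem mulStrand_ne (p : TPoint (fun _ : Fin 2 => B) B) : mulStrand B p ≠ p := by
  refine mulStrand_cases (C := fun p q => q ≠ p) ?_ ?_ ?_ ?_ ?_ ?_ p <;>
  exact fun j _ h => by cases congrArg Sigma.fst h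

end

/-- The multiplication tangle: disc `0` (the first factor) is below disc `1` (the second factor). -/
def mulTangle : (B : BoxType) → PlanarTangle (ι := Fin 2) (fun _ => B) B
  | ⟨0, ε⟩ => PlanarTangle.ofStrands (Option (Fin 2)) Unit
      (strand := mulStrand ⟨0, ε⟩)
      (strand_strand := mulStrand_mulStrand)
      (strand_ne := mulStrand_ne)
      (f := fun a => a.1)
      (s := fun d => ⟨d, ⟨0, by omega⟩⟩)
      (g := fun _ => ())
      (hr := sideRel_inv (by revert ε; decide) (by revert ε; decide) (by revert ε; decide))
      (hf := by revert ε; decide)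
      (hs := fun a => quot_of_iterate _ _ _ (by revert ε a; decide))
      (hg := fun _ => ⟨none, rfl⟩)
      (shade := fun _ => ε)
      (shade_reg := by revert ε; decide)
      (u := ())
      (hu := by revert ε; decide)
      (euler := by simp)
  | ⟨n + 1, ε⟩ => PlanarTangle.ofStrands (Bool ⊕ Fin 3 × Fin n) (Bool ⊕ Fin 3 × Fin n)
      (strand := mulStrand ⟨n + 1, ε⟩)
      (strand_strand := mulStrand_mulStrand)
      (strand_ne := mulStrand_ne)
      (f := mulReg n ε)
      (s := mulRep n ε)
      (g := id)
      (hr := by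
        have hw : ∀ l l', mulRegion n l l' 0 = mulRegion n l l' (2 * (n + 1)) := by
          intro l l'
          unfold mulRegion
          rw [dif_neg (by omega), if_neg (by omega), dif_neg (by omega), dif_neg (by omega),
            if_neg (by omega), dif_neg (by omega)]
        apply sideRel_inv
        · rintro (_ | i)
          · exact hw 0 2
          · obtain rfl | rfl : i = 0 ∨ i = 1 := by fin_cases i <;> simp
            · exact hw 1 2
            · exact hw 0 1
        · intro p
          refine mulStrand_cases (B := ⟨n + 1, ε⟩)
            (C := fun p q => mulReg n ε (before p) = mulReg n ε (acrossBefore p q)) ?_ ?_ ?_ ?_ ?_ ?_ p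
          · rintro ⟨j, hj⟩ (h : j < n + 1)
            exact mulRegion_upper n 0 2 1 j (by omega)
          · rintro ⟨j, hj⟩ (h : ¬ j < n + 1)
            exact mulRegion_lower n 2 0 1 j (by omega)
          · rintro ⟨j, hj⟩ (h : j < n + 1)
            exact mulRegion_upper n 0 1 2 j (by omega)
          · rintro ⟨j, hj : j < 2 * (n + 1)⟩ (h : ¬ j < n + 1)
            exact mulRegion_middle n 1 0 2 (2 * (n + 1) - (j + 1) + 1) j (by omega) (by omega)
          · rintro ⟨j, hj : j < 2 * (n + 1)⟩ (h : j < n + 1)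
            exact (mulRegion_middle n 1 0 2 j (2 * (n + 1) - (j + 1) + 1)
              (by omega) (by omega)).symm
          · rintro ⟨j, hj⟩ (h : ¬ j < n + 1)
            exact mulRegion_lower n 2 1 0 j (by omega)
        · intro p
          refine mulStrand_cases (B := ⟨n + 1, ε⟩)
            (C := fun p q => mulReg n ε (after p) = mulReg n ε (acrossAfter p q)) ?_ ?_ ?_ ?_ ?_ ?_ p
          · rintro ⟨j, hj⟩ (h : j < n + 1)
            exact mulRegion_upper n 0 2 1 (j + 1) (by omega)
          · rintro ⟨j, hj⟩ (h : ¬ j < n + 1)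
            exact mulRegion_lower n 2 0 1 (j + 1) (by omega)
          · rintro ⟨j, hj⟩ (h : j < n + 1)
            exact mulRegion_upper n 0 1 2 (j + 1) (by omega)
          · rintro ⟨j, hj : j < 2 * (n + 1)⟩ (h : ¬ j < n + 1)
            exact mulRegion_middle n 1 0 2 (2 * (n + 1) - (j + 1)) (j + 1) (by omega) (by omega)
          · rintro ⟨j, hj : j < 2 * (n + 1)⟩ (h : j < n + 1)
            exact (mulRegion_middle n 1 0 2 (j + 1) (2 * (n + 1) - (j + 1))
              (by omega) (by omega)).symm
          · rintro ⟨j, hj⟩ (h : ¬ j < n + 1)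
            exact mulRegion_lower n 2 1 0 (j + 1) (by omega))
      (hf := by
        rintro ((_ | _) | ⟨l, k⟩)
        · change mulRegion n 0 2 0 = _
          simp [mulRegion]
        · change mulRegion n 0 2 (n + 1) = _
          simp [mulRegion]
        · have hk := k.2
          obtain rfl | rfl | rfl : l = 0 ∨ l = 1 ∨ l = 2 := by fin_cases l <;> simp
          · change mulRegion n 0 2 (k + 1) = _
            unfold mulRegion
            rw [dif_pos (by omega)]
            simp
          · change mulRegion n 1 2 (k + 1) = _
            unfold mulRegion
            rw [dif_pos (by omega)]
            simp
          · change mulRegion n 0 2 (2 * n + 1 - k) = _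
            unfold mulRegion
            rw [dif_neg (by omega), if_neg (by omega), dif_pos (by omega)]
            congr 3
            omega)
      (hs := by
        obtain ⟨Q, hQ⟩ : ∃ Q : Option (Fin 2) → ℕ → Quot (SideRel (mulStrand ⟨n + 1, ε⟩)),
            ∀ d j (hj : j < 2 * (n + 1) + 1) hj', Q d j = Quot.mk _ ⟨d, ⟨j, hj'⟩⟩ := by
          refine ⟨fun d j => if hj : j < 2 * (n + 1) + 1 then
            Quot.mk _ ⟨d, ⟨j, by rcases d with _ | i <;> exact hj⟩⟩ else
            Quot.mk _ ⟨none, (⟨0, by omega⟩ : Fin (2 * (n + 1) + 1))⟩, ?_⟩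
          intro d j hj hj'
          simp only [hj, dite_true]
        have step : ∀ p q : TPoint (fun _ : Fin 2 => ⟨n + 1, ε⟩) ⟨n + 1, ε⟩,
            mulStrand ⟨n + 1, ε⟩ p = q →
            Quot.mk (SideRel (mulStrand ⟨n + 1, ε⟩)) (before p) = Quot.mk _ (acrossBefore p q) ∧
            Quot.mk (SideRel (mulStrand ⟨n + 1, ε⟩)) (after p) = Quot.mk _ (acrossAfter p q) := by
          rintro p _ rfl
          exact ⟨Quot.sound (.before p), Quot.sound (.after p)⟩
        have hA : ∀ j, j ≤ n + 1 → Q none j = Q (some 1) j := by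
          intro j hj
          rw [hQ none j (by omega) (by change j < 2 * (n + 1) + 1; omega),
            hQ (some 1) j (by omega) (by change j < 2 * (n + 1) + 1; omega)]
          rcases j with _ | j
          · exact (step ⟨none, (⟨0, by omega⟩ : Fin (2 * (n + 1)))⟩ _
              (mulStrand_none_lt (B := ⟨n + 1, ε⟩) (by change 0 < n + 1; omega))).1
          · exact (step ⟨none, (⟨j, by omega⟩ : Fin (2 * (n + 1)))⟩ _
              (mulStrand_none_lt (B := ⟨n + 1, ε⟩) (by change j < n + 1; omega))).2
        have hC : ∀ j, n + 1 ≤ j → j ≤ 2 * (n + 1) → Q none j = Q (some 0) j := by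
          intro j hj hj'
          rw [hQ none j (by omega) (by change j < 2 * (n + 1) + 1; omega),
            hQ (some 0) j (by omega) (by change j < 2 * (n + 1) + 1; omega)]
          by_cases h : j < 2 * (n + 1)
          · exact (step ⟨none, (⟨j, by omega⟩ : Fin (2 * (n + 1)))⟩ _
              (mulStrand_none_ge (B := ⟨n + 1, ε⟩) (by change ¬ j < n + 1; omega))).1
          · obtain rfl : j = 2 * n + 1 + 1 := by omega
            exact (step ⟨none, (⟨2 * n + 1, by omega⟩ : Fin (2 * (n + 1)))⟩ _
              (mulStrand_none_ge (B := ⟨n + 1, ε⟩) (by change ¬ 2 * n + 1 < n + 1; omega))).2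
        have hB : ∀ j, j ≤ n + 1 → Q (some 0) j = Q (some 1) (2 * (n + 1) - j) := by
          intro j hj
          rw [hQ (some 0) j (by omega) (by change j < 2 * (n + 1) + 1; omega),
            hQ (some 1) _ (by omega) (by change _ < 2 * (n + 1) + 1; omega)]
          rcases j with _ | j
          · refine (step ⟨some 0, (⟨0, by omega⟩ : Fin (2 * (n + 1)))⟩ _
              (mulStrand_zero_lt (B := ⟨n + 1, ε⟩) (by change 0 < n + 1; omega))).1.trans
              (congrArg _ (interval_ext rfl ?_))
            change 2 * (n + 1) - (0 + 1) + 1 = 2 * (n + 1) - 0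
            omega
          · refine (step ⟨some 0, (⟨j, by omega⟩ : Fin (2 * (n + 1)))⟩ _
              (mulStrand_zero_lt (B := ⟨n + 1, ε⟩) (by change j < n + 1; omega))).2.trans
              (congrArg _ (interval_ext rfl ?_))
            rfl
        have hW : ∀ d, Q d 0 = Q d (2 * (n + 1)) := by
          intro d
          have h0 : 0 < 2 * (boxOf (fun _ : Fin 2 => (⟨n + 1, ε⟩ : BoxType)) ⟨n + 1, ε⟩ d).n + 1 := by
            omega
          have h1 : 2 * (n + 1) <
              2 * (boxOf (fun _ : Fin 2 => (⟨n + 1, ε⟩ : BoxType)) ⟨n + 1, ε⟩ d).n + 1 := by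
            rcases d with _ | i <;> exact Nat.lt_succ_self _
          rw [hQ d 0 (by omega) h0, hQ d _ (by omega) h1]
          refine Eq.trans (b := Quot.mk _ ⟨d, Fin.last _⟩) (Quot.sound (.wrap d))
            (congrArg _ (interval_ext rfl ?_))
          rcases d with _ | i <;> rfl
        have main : ∀ (d : Option (Fin 2)) (l l' : Fin 3),
            (d = none ∧ l = 0 ∧ l' = 2) ∨ (d = some 1 ∧ l = 0 ∧ l' = 1) ∨
              (d = some 0 ∧ l = 1 ∧ l' = 2) →
            ∀ j, j < 2 * (n + 1) + 1 → Q d j = (match mulRegion n l l' j with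
              | .inl false => Q none 0
              | .inl true => Q none (n + 1)
              | .inr (0, k) => Q none (k + 1)
              | .inr (1, k) => Q (some 0) (k + 1)
              | .inr (2, k) => Q none (2 * n + 1 - k)) := by
          intro d l l' hd j hj
          have e1 : 2 * (n + 1) - (n + 1) = n + 1 := by omega
          have e0 : Q (some 1) 0 = Q none 0 := (hA 0 (by omega)).symm
          have e0' : Q (some 0) 0 = Q none 0 := by
            rw [hW (some 0), ← hC _ (by omega) le_rfl, ← hW none]
          have eN : Q (some 1) (n + 1) = Q none (n + 1) := (hA _ le_rfl).symm
          have eN' : Q (some 0) (n + 1) = Q none (n + 1) := (hC _ le_rfl (by omega)).symm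
          unfold mulRegion
          by_cases h1 : 1 ≤ j ∧ j ≤ n
          · rw [dif_pos h1]
            have e : j - 1 + 1 = j := by omega
            rcases hd with ⟨rfl, rfl, rfl⟩ | ⟨rfl, rfl, rfl⟩ | ⟨rfl, rfl, rfl⟩
            · change _ = Q none (j - 1 + 1)
              rw [e]
            · change _ = Q none (j - 1 + 1)
              rw [e, hA j (by omega)]
            · change _ = Q (some 0) (j - 1 + 1)
              rw [e]
          rw [dif_neg h1]
          by_cases h2 : j = n + 1
          · rw [if_pos h2, h2]
            rcases hd with ⟨rfl, rfl, rfl⟩ | ⟨rfl, rfl, rfl⟩ | ⟨rfl, rfl, rfl⟩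
            · rfl
            · exact eN
            · exact eN'
          rw [if_neg h2]
          by_cases h3 : n + 2 ≤ j ∧ j ≤ 2 * n + 1
          · rw [dif_pos h3]
            have e : 2 * n + 1 - (2 * n + 1 - j) = j := by omega
            rcases hd with ⟨rfl, rfl, rfl⟩ | ⟨rfl, rfl, rfl⟩ | ⟨rfl, rfl, rfl⟩
            · change _ = Q none (2 * n + 1 - (2 * n + 1 - j))
              rw [e]
            · change _ = Q (some 0) (2 * n + 1 - j + 1)
              rw [hB _ (by omega)]
              congr 1
              omega
            · change _ = Q none (2 * n + 1 - (2 * n + 1 - j))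
              rw [e, hC j (by omega) (by omega)]
          · rw [dif_neg h3]
            change _ = Q none 0
            obtain rfl | rfl : j = 0 ∨ j = 2 * (n + 1) := by omega
            · rcases hd with ⟨rfl, rfl, rfl⟩ | ⟨rfl, rfl, rfl⟩ | ⟨rfl, rfl, rfl⟩
              · rfl
              · exact e0
              · exact e0'
            · rw [← hW]
              rcases hd with ⟨rfl, rfl, rfl⟩ | ⟨rfl, rfl, rfl⟩ | ⟨rfl, rfl, rfl⟩
              · rfl
              · exact e0
              · exact e0'
        have fin : ∀ (d : Option (Fin 2)) (l l' : Fin 3) (j : ℕ) (hj : j < 2 * (n + 1) + 1) hj'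
            (a : TInterval (fun _ : Fin 2 => ⟨n + 1, ε⟩) ⟨n + 1, ε⟩),
            a = ⟨d, ⟨j, hj'⟩⟩ → mulReg n ε a = mulRegion n l l' j →
            ((d = none ∧ l = 0 ∧ l' = 2) ∨ (d = some 1 ∧ l = 0 ∧ l' = 1) ∨
              (d = some 0 ∧ l = 1 ∧ l' = 2)) →
            Quot.mk (SideRel (mulStrand ⟨n + 1, ε⟩)) a = Quot.mk _ (mulRep n ε (mulReg n ε a)) := by
          intro d l l' j hj hj' a ha hr hd
          rw [hr, ha, ← hQ d j hj hj', main d l l' hd j hj]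
          rcases mulRegion n l l' j with (_ | _) | ⟨m, k⟩
          · exact hQ _ _ (by omega) _
          · exact hQ _ _ (by omega) _
          · have hk := k.2
            obtain rfl | rfl | rfl : m = 0 ∨ m = 1 ∨ m = 2 := by fin_cases m <;> simp
            · exact hQ _ _ (by omega) _
            · exact hQ _ _ (by omega) _
            · exact hQ _ _ (by omega) _
        rintro ⟨_ | i, j, hj⟩
        · exact fin none 0 2 j hj hj _ rfl rfl (by simp)
        · obtain rfl | rfl : i = 0 ∨ i = 1 := by fin_cases i <;> simp
          · exact fin (some 0) 1 2 j hj hj _ rfl rfl (by simp)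
          · exact fin (some 1) 0 1 j hj hj _ rfl rfl (by simp))
      (hg := Function.surjective_id)
      (shade := fun
        | .inl false => ε
        | .inl true => BoxType.shadeAt ⟨n + 1, ε⟩ (n + 1)
        | .inr (_, k) => BoxType.shadeAt ⟨n + 1, ε⟩ (k + 1))
      (shade_reg := by
        have main : ∀ l l' j, j < 2 * (n + 1) + 1 → (match mulRegion n l l' j with
            | .inl false => ε
            | .inl true => BoxType.shadeAt ⟨n + 1, ε⟩ (n + 1)
            | .inr (_, k) => BoxType.shadeAt ⟨n + 1, ε⟩ (k + 1)) =
            BoxType.shadeAt ⟨n + 1, ε⟩ j := by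
          intro l l' j hj
          unfold mulRegion
          by_cases h1 : 1 ≤ j ∧ j ≤ n
          · rw [dif_pos h1]
            change BoxType.shadeAt _ (j - 1 + 1) = _
            rw [Nat.sub_add_cancel h1.1]
          rw [dif_neg h1]
          by_cases h2 : j = n + 1
          · rw [if_pos h2, h2]
          rw [if_neg h2]
          by_cases h3 : n + 2 ≤ j ∧ j ≤ 2 * n + 1
          · rw [dif_pos h3]
            change BoxType.shadeAt _ (2 * n + 1 - j + 1) = _
            have : (2 * n + 1 - j + 1) % 2 = j % 2 := by omega
            simp only [BoxType.shadeAt, this]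
          · rw [dif_neg h3]
            have : j % 2 = 0 := by omega
            simp [BoxType.shadeAt, this]
        rintro ⟨_ | i, j⟩
        · exact main 0 2 j j.2
        · obtain rfl | rfl : i = 0 ∨ i = 1 := by fin_cases i <;> simp
          · exact main 1 2 j j.2
          · exact main 0 1 j j.2)
      (u := .inl false)
      (hu := by
        rintro (_ | i)
        · exact ⟨0, rfl⟩
        · obtain rfl | rfl : i = 0 ∨ i = 1 := by fin_cases i <;> simp
          · exact ⟨0, rfl⟩
          · exact ⟨0, rfl⟩)
      (euler := by
        rw [card_tpoint]
        simp
        omega)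

end BasicTangles

/-- A C*-planar algebra: finite dimensional C*-algebras `P_{n,±}` on which the shaded planar tangles
act by multilinear maps, compatibly with isotopy, relabelling, gluing and reflection of tangles;
the product and the unit are given by the usual tangles; there are linear functionals `tr_{0,±}` such
that all the traces `tr_{n,±}` obtained from them by closing a box on its right are positive and
faithful. (The traces satisfy `tr (x y) = tr (y x)` by isotopy.) -/
structure CStarPlanarAlgebra where
  V : BoxType → Type u
  [cstar : ∀ B, CStarAlgebra (V B)]
  [finiteDimensional : ∀ B, FiniteDimensional ℂ (V B)]
  Z : ∀ {ι : Type} {b : ι → BoxType} {b₀ : BoxType}, PlanarTangle b b₀ →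
    MultilinearMap ℂ (fun i => V (b i)) (V b₀)
  Z_iso : ∀ {ι ι' : Type} (e : ι ≃ ι') {b : ι' → BoxType} {b₀ : BoxType}
    (T : PlanarTangle (fun i => b (e i)) b₀) (T' : PlanarTangle b b₀), TangleIso e T T' →
    ∀ v : ∀ i, V (b i), Z T' v = Z T (fun i => v (e i))
  Z_id : ∀ (B : BoxType) (v : Unit → V B), Z (idTangle B) v = v ()
  Z_comp : ∀ {ι : Type} {κ : ι → Type} {b : ι → BoxType} {c : ∀ i, κ i → BoxType} {b₀ : BoxType}
    (T : PlanarTangle b b₀) (S : ∀ i, PlanarTangle (c i) (b i))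
    (U : PlanarTangle (fun k : Σ i, κ i => c k.1 k.2) b₀), TangleComp T S U →
    ∀ v : ∀ k : Σ i, κ i, V (c k.1 k.2), Z U v = Z T (fun i => Z (S i) (fun k => v ⟨i, k⟩))
  Z_star : ∀ {ι : Type} {b : ι → BoxType} {b₀ : BoxType} (T T' : PlanarTangle b b₀),
    TangleReflection T T' → ∀ v : ∀ i, V (b i), star (Z T v) = Z T' (fun i => star (v i))
  Z_mul : ∀ (B : BoxType) (v : Fin 2 → V B), Z (mulTangle B) v = v 0 * v 1
  Z_one : ∀ (B : BoxType) (v : Empty → V B), Z (oneTangle B) v = 1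
  tr₀ : ∀ ε : Bool, V ⟨0, ε⟩ →ₗ[ℂ] ℂ
  tr_pos : ∀ (B : BoxType) (x : V B), x ≠ 0 →
    0 < (tr₀ B.shaded (Z (traceTangle B) (fun _ => star x * x))).re ∧
      (tr₀ B.shaded (Z (traceTangle B) (fun _ => star x * x))).im = 0

attribute [instance] CStarPlanarAlgebra.cstar CStarPlanarAlgebra.finiteDimensional

noncomputable section StarAlgebras

variable {A : Type u} [CStarAlgebra A]

/-- Positive elements of a C*-algebra. -/
def IsPos (y : A) : Prop := ∃ a, y = a * star a

/-- `q` is the range projection of `y`: the smallest projection with `q y = y`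
(`q ≤ e` for projections means `e q = q`). -/
def IsRangeProjection (y q : A) : Prop :=
  IsStarProjection q ∧ q * y = y ∧ ∀ e, IsStarProjection e → e * y = y → e * q = q

/-- `p` is the union (supremum among the projections of `A`) of the projections in `D`. -/
def IsUnionOfProjections (D : Set A) (p : A) : Prop :=
  IsStarProjection p ∧ (∀ q ∈ D, IsStarProjection q → p * q = q) ∧
    ∀ e, IsStarProjection e → (∀ q ∈ D, IsStarProjection q → e * q = q) → e * p = p

/-- The space `e A`. If `A` acts on itself by left multiplication (for finite dimensional `A` this is
the GNS representation of a faithful trace), this is the range of the projection `e`. -/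
def cornerSpace (e : A) : Submodule ℂ A := LinearMap.range (LinearMap.mulLeft ℂ e)

/-- The operator `v ↦ e a v` on `e A`. -/
def cornerRep (e a : A) : Module.End ℂ (cornerSpace e) :=
  ((LinearMap.mulLeft ℂ e).rangeRestrict ∘ₗ LinearMap.mulLeft ℂ a) ∘ₗ (cornerSpace e).subtype

/-- The double commutant `{a}''` of an element `a` of the corner `e A e`, acting on `e A`:
all `b` in `e A e` which commute with every operator on `e A` that commutes with `a`. It contains the
identity operator `e` of this space. For `e = 1` it is the usual double commutant. -/
def doubleCommutant (e a : A) : Set A :=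
  {b | e * b * e = b ∧ cornerRep e b ∈ Set.centralizer (Set.centralizer {cornerRep e a})}

/-- The linear span of all products `b d` with `b ∈ M` and `d ∈ D`. -/
def productSpan (M D : Set A) : Submodule ℂ A :=
  Submodule.span ℂ {w | ∃ b ∈ M, ∃ d ∈ D, w = b * d}

/-- The *-subalgebra `D` is a direct summand of `C`: there is a *-subalgebra `D'` with
`C = D + D'` and `D D' = D' D = 0` (whence `D ∩ D' = 0`). -/
def IsDirectSummand (D : NonUnitalStarSubalgebra ℂ A) (C : StarSubalgebra ℂ A) : Prop :=
  ∃ D' : NonUnitalStarSubalgebra ℂ A, (∀ c, c ∈ C ↔ ∃ d ∈ D, ∃ d' ∈ D', c = d + d') ∧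
    ∀ d ∈ D, ∀ d' ∈ D', d * d' = 0 ∧ d' * d = 0

end StarAlgebras

noncomputable section

namespace CStarPlanarAlgebra

variable (P : CStarPlanarAlgebra.{u}) {ε : Bool}

/-- The Fourier transform `x ↦ x̂` of `2`-boxes. -/
def fourier (x : P.V ⟨2, ε⟩) : P.V ⟨2, !ε⟩ := P.Z (fourierTangle ε) (fun _ => x)

/-- The rotation `y ↦ ȳ` of `1`-boxes by `180°`. -/
def bar (y : P.V ⟨1, ε⟩) : P.V ⟨1, !ε⟩ := P.Z (barTangle ε) (fun _ => y)

/-- The convolution `y * w` of a `1`-box and a `2`-box. -/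
def conv (y : P.V ⟨1, ε⟩) (w : P.V ⟨2, !ε⟩) : P.V ⟨1, ε⟩ :=
  P.Z (convTangle ε) (fun
    | 0 => y
    | 1 => w)

/-- The `2`-box with `y` on the left string and a bare string on the right. -/
def onLeft (y : P.V ⟨1, ε⟩) : P.V ⟨2, ε⟩ := P.Z (rightStringTangle ε) (fun _ => y)

/-- The `2`-box with `y` on the right string and a bare string on the left. -/
def onRight (y : P.V ⟨1, !ε⟩) : P.V ⟨2, ε⟩ := P.Z (leftStringTangle ε) (fun _ => y)

/-- `x` is `𝔉`-positive: its Fourier transform is positive. -/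
def FPositive (x : P.V ⟨2, ε⟩) : Prop := IsPos (P.fourier x)

/-- The spectral radius of `x`. -/
def radius (x : P.V ⟨2, ε⟩) : ℝ := (spectralRadius ℂ x).toReal

/-- The PF eigenspace `E` of all `y` with `y * x̂ = r y`. -/
def eigenspace (x : P.V ⟨2, ε⟩) : Set (P.V ⟨1, ε⟩) :=
  {y | P.conv y (P.fourier x) = (P.radius x : ℂ) • y}

/-- The set of the range projections of the positive elements of the PF eigenspace. -/
def rangeProjections (x : P.V ⟨2, ε⟩) : Set (P.V ⟨1, ε⟩) :=
  {q | ∃ y ∈ P.eigenspace x, IsPos y ∧ IsRangeProjection y q}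

/-- `p` is the largest range projection of a positive PF eigenvector. -/
def IsPMax (x : P.V ⟨2, ε⟩) (p : P.V ⟨1, ε⟩) : Prop :=
  p ∈ P.rangeProjections x ∧ ∀ q ∈ P.rangeProjections x, p * q = q

/-- `p * x̂ * ⋯ * x̂`, with `j` factors `x̂`. -/
def convPow (x : P.V ⟨2, ε⟩) (p : P.V ⟨1, ε⟩) (j : ℕ) : P.V ⟨1, ε⟩ :=
  (fun y => P.conv y (P.fourier x))^[j] p

/-- `ζ` is the limit, as the real number `z` decreases to `r`, of
`(z - r) ∑_j (p * x̂^{*j}) / z^(j + 1)`; in particular the series converges for `z > r`. -/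
def IsPerronLimit (x : P.V ⟨2, ε⟩) (p ζ : P.V ⟨1, ε⟩) : Prop :=
  (∀ z : ℝ, P.radius x < z → Summable fun j : ℕ => ((z : ℂ) ^ (j + 1))⁻¹ • P.convPow x p j) ∧
  Filter.Tendsto
    (fun z : ℝ => ((z : ℂ) - P.radius x) • ∑' j : ℕ, ((z : ℂ) ^ (j + 1))⁻¹ • P.convPow x p j)
    (nhdsWithin (P.radius x) (Set.Ioi (P.radius x))) (nhds ζ)

/-- `ζ` is the PF eigenvector of maximal support: the limit above with `p = p_max`, which is a
positive element of the PF eigenspace with range projection `p_max`. -/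
def IsMaxSupportEigenvector (x : P.V ⟨2, ε⟩) (p ζ : P.V ⟨1, ε⟩) : Prop :=
  P.IsPerronLimit x p ζ ∧ ζ ∈ P.eigenspace x ∧ IsPos ζ ∧ IsRangeProjection ζ p

/-- The exchange algebra `𝒜`: `ȳ` on the right string passes through `x`. -/
def exchangeA (x : P.V ⟨2, ε⟩) : Set (P.V ⟨1, ε⟩) :=
  {y | x * P.onRight (P.bar y) = P.onRight (P.bar y) * x}

/-- The exchange algebra `ℬ`: `y` on the left string passes through `x`. -/
def exchangeB (x : P.V ⟨2, ε⟩) : Set (P.V ⟨1, ε⟩) :=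
  {y | x * P.onLeft y = P.onLeft y * x}

/-- The exchange algebra `𝒞 = 𝒜 ∩ ℬ`. -/
def exchangeC (x : P.V ⟨2, ε⟩) : Set (P.V ⟨1, ε⟩) := P.exchangeA x ∩ P.exchangeB x

end CStarPlanarAlgebra

end

end PFPlanar

/-! ### Finite numerical codes of planar tangles -/

namespace PFPlanar

/-! Convolution with x̂ is a linear map Φ on the 1-boxes, and the theorem rests on two properties of
Φ.

Φ is positive. Let b = (c c*) * (a a*) and let t be self-adjoint. The closed diagram of b t² can be
cut in a second way, into T T*, where T (`triple`) is the 2-box a with c and t attached to its lower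
strings. Hence tr(b t²) ≥ 0. For t = b⁻ this number is the trace of -(b⁻)³, so faithfulness forces
b⁻ = 0 (`conv_nonneg`).

Φ is a bimodule map over 𝒞. A 1-box on the left string of x, below or above x, becomes after the
rotation a right factor of the argument or of the value of Φ, so elements of ℬ can be pulled out of
Φ on the right. Since x̂ is self-adjoint, x* is x turned by 180°, whence y ∈ 𝒜 iff y* ∈ ℬ. So 𝒞 = ℬ
∩ ℬ* is a *-algebra, and its elements can be pulled out on both sides (`mem_exchangeA_iff`,
`conv_mul_of_mem_exchangeC`).

What remains is the theory of a positive map Φ on a finite-dimensional C*-algebra with a number r ≥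
0 (`exists_perron_eigenvector`). Among the positive solutions of Φ y = r y choose one whose kernel
has least dimension. Adding solutions shows that its kernel lies in all the others, so its range
projection p is p_max. By functional calculus c y ≤ p ≤ C y with c > 0, hence 0 ≤ Φ^j p ≤ C r^j y:
the orbit of p grows at most like r^j, whatever the spectral radius of Φ may be. On the vectors with
such orbits r can only be a semisimple eigenvalue, because a Jordan block would grow like j r^j. So
p = u + (r - Φ) v with Φ u = r u, and the Abel limit ζ exists and equals u. The limit preserves the
order and fixes the multiples of y, so c y ≤ ζ ≤ C y, and ζ has the range projection p. If 0 is the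
only positive solution, then y, p and ζ all vanish.

For a ∈ 𝒞 the element a y a* is again a positive solution, so p a p = a p. The same for a* gives p a
= a p. Then every Φ^j p commutes with a, and so does ζ. Moreover Φ(ζ a) = Φ(ζ) a = r ζ a.

For the last assertion let e be the unit of 𝒟. It is the supremum of the projections of 𝒟. Since e ζ
acts semisimply on e A, its double commutant consists of the elements f(ζ) e with f a polynomial
(`mem_doubleCommutant_iff`). Therefore both spans agree, the double commutant commutes with 𝒟, and
the matrix units of 𝒟 recover the coefficients of Σ b_ij E_ij, so that b ⊗ d ↦ b d is injective
(`tensorMul_injective`).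

The planar identities are reduced to finite computation. A tangle is recorded as a code, a few lists
of natural numbers, for which planarity, reflection and gluing are decidable. An identity between
boxes then means that one code is a composite in two ways. -/

/-- A numerical description of a planar tangle without closed loops. The discs are numbered, the
output disc is number `0`. `strand` lists for each disc the other ends (disc, point) of the strings
at its points, `label` lists the regions at its boundary intervals, `shade` the shading of the
regions and `rep` one boundary interval (disc, interval) of each region. -/
structure Code where
  strand : List (List (ℕ × ℕ))
  label : List (List ℕ)
  shade : List Bool
  rep : List (ℕ × ℕ)

namespace Code

section

variable (C : Code)

/-- The number of boundary points of a disc. -/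
def size (d : ℕ) : ℕ := (C.strand.getD d []).length

/-- The other end of the string at a point. -/
def pt (d j : ℕ) : ℕ × ℕ := (C.strand.getD d []).getD j (0, 0)

/-- The region at a boundary interval. -/
def lab (d j : ℕ) : ℕ := (C.label.getD d []).getD j 0

/-- The number of regions. -/
def regions : ℕ := C.shade.length

/-- The shading of a region. -/
def shadeOf (l : ℕ) : Bool := C.shade.getD l false

/-- A boundary interval at a region. -/
def repOf (l : ℕ) : ℕ × ℕ := C.rep.getD l (0, 0)

/-- The next boundary interval along the boundary of a region. -/
def next (a : ℕ × ℕ) : ℕ × ℕ :=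
  if a.1 = 0 then
    if a.2 = 0 then (0, C.size 0)
    else if (C.pt 0 (a.2 - 1)).1 = 0 then C.pt 0 (a.2 - 1)
    else ((C.pt 0 (a.2 - 1)).1, (C.pt 0 (a.2 - 1)).2 + 1)
  else if a.2 < C.size a.1 then
    if (C.pt a.1 a.2).1 = 0 then C.pt a.1 a.2 else ((C.pt a.1 a.2).1, (C.pt a.1 a.2).2 + 1)
  else (a.1, 0)

/-- `1` if the strings at the two discs run in the same direction, `0` otherwise. -/
def shift (d d' : ℕ) : ℕ := if (d = 0 ↔ d' = 0) then 1 else 0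

/-- The code describes a planar tangle with `k` input discs. -/
def Planar (k : ℕ) : Prop :=
  (∀ d < k + 1, ∀ j < C.size d, (C.pt d j).1 < k + 1 ∧ (C.pt d j).2 < C.size (C.pt d j).1 ∧
    C.pt d j ≠ (d, j) ∧ C.pt (C.pt d j).1 (C.pt d j).2 = (d, j) ∧
    C.lab d j = C.lab (C.pt d j).1 ((C.pt d j).2 + shift d (C.pt d j).1) ∧
    C.lab d (j + 1) = C.lab (C.pt d j).1 ((C.pt d j).2 + (1 - shift d (C.pt d j).1))) ∧
  (∀ d < k + 1, ∀ j < C.size d + 1, C.lab d j < C.regions ∧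
    C.shadeOf (C.lab d j) = xor (C.shadeOf (C.lab d 0)) (decide (j % 2 = 1)) ∧
    -- The circle of an output disc without points meets no string, so no walk leads from it to a
    -- representative. Twenty steps are enough for every tangle coded below.
    ((d = 0 ∧ C.size 0 = 0) ∨ ∃ n < 20, C.next^[n] (d, j) = C.repOf (C.lab d j))) ∧
  (∀ d < k + 1, C.lab d 0 = C.lab d (C.size d)) ∧
  (∀ l < C.regions, (C.repOf l).1 < k + 1 ∧ (C.repOf l).2 < C.size (C.repOf l).1 + 1 ∧
    C.lab (C.repOf l).1 (C.repOf l).2 = l ∧ ¬ ((C.repOf l).1 = 0 ∧ C.size 0 = 0)) ∧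
  (∃ u < C.regions, ∀ d < k + 1, ∃ j < C.size d + 1, C.lab d j = u) ∧
  -- Euler's formula when each region has a single boundary component, apart from the extra circle
  -- of an output disc without points.
  2 * (k + 1) + 4 * C.regions = 4 + ∑ d ∈ Finset.range (k + 1), C.size d +
    2 * (C.regions + if C.size 0 = 0 then 1 else 0)

theorem next_zero_zero : C.next (0, 0) = (0, C.size 0) := by simp [next]

theorem next_zero {j : ℕ} (hj : j ≠ 0) : C.next (0, j) = if (C.pt 0 (j - 1)).1 = 0 then
    C.pt 0 (j - 1) else ((C.pt 0 (j - 1)).1, (C.pt 0 (j - 1)).2 + 1) := by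
  simp [next, hj]

theorem next_of_lt {d j : ℕ} (hd : d ≠ 0) (hj : j < C.size d) : C.next (d, j) =
    if (C.pt d j).1 = 0 then C.pt d j else ((C.pt d j).1, (C.pt d j).2 + 1) := by
  simp [next, hd, hj]

theorem next_of_not_lt {d j : ℕ} (hd : d ≠ 0) (hj : ¬ j < C.size d) : C.next (d, j) = (d, 0) := by
  simp [next, hd, hj]

set_option synthInstance.maxSize 2000 in
set_option synthInstance.maxHeartbeats 200000 in
instance (k : ℕ) : Decidable (C.Planar k) := by
  unfold Planar
  infer_instance

end

variable {ι : Type} {k : ℕ} (e : ι ≃ Fin k)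

/-- The number of a disc. -/
def num : Option ι → ℕ
  | none => 0
  | some i => e i + 1

/-- The disc with a given number. -/
def disc (n : ℕ) : Option ι :=
  if h : 0 < n ∧ n - 1 < k then some (e.symm ⟨n - 1, h.2⟩) else none

theorem num_lt (d : Option ι) : num e d < k + 1 := by
  rcases d with _ | i
  · simp [num]
  · simp [num]

theorem num_disc {n : ℕ} (h : n < k + 1) : num e (disc e n) = n := by
  unfold disc
  split_ifs with h1
  · simp only [num, Equiv.apply_symm_apply]
    omega
  · simp only [num]
    omega

theorem disc_num (d : Option ι) : disc e (num e d) = d := by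
  rcases d with _ | i
  · simp [disc, num]
  · simp [disc, num]

theorem num_injective : Function.Injective (num e) := fun d d' h => by
  rw [← disc_num e d, h, disc_num]

theorem num_eq_zero {d : Option ι} : num e d = 0 ↔ d = none := by
  rcases d with _ | i <;> simp [num]

variable {b : ι → BoxType} {b₀ : BoxType}

theorem point_ext_num {p q : TPoint b b₀} (h : num e p.1 = num e q.1) (h' : p.2.1 = q.2.1) : p = q
    :=
  point_ext (num_injective e h) h'

theorem interval_ext_num {p q : TInterval b b₀} (h : num e p.1 = num e q.1) (h' : p.2.1 = q.2.1) :
    p = q :=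
  interval_ext (num_injective e h) h'

variable (C : Code)

/-- The discs of the code have the given box types, if the shading `false` in the code stands
for `ε`. -/
def Fits (ε : Bool) (b : ι → BoxType) (b₀ : BoxType) : Prop :=
  ∀ d : Option ι, 2 * (boxOf b b₀ d).n = C.size (num e d) ∧
    (boxOf b b₀ d).shaded = xor ε (C.shadeOf (C.lab (num e d) 0))

instance [Fintype ι] (ε : Bool) (b : ι → BoxType) (b₀ : BoxType) :
    Decidable (C.Fits e ε b b₀) := by
  unfold Fits
  infer_instance

variable {C} {e} {ε : Bool}

theorem Fits.lt_size (h : C.Fits e ε b b₀) (p : TPoint b b₀) : p.2.1 < C.size (num e p.1) := by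
  rw [← (h p.1).1]
  exact p.2.2

theorem Fits.lt_size_succ (h : C.Fits e ε b b₀) (p : TInterval b b₀) :
    p.2.1 < C.size (num e p.1) + 1 := by
  rw [← (h p.1).1]
  exact p.2.2

variable (e) in
theorem Fits.lt_of (h : C.Fits e ε b b₀) {n j : ℕ} (hn : n < k + 1) (hj : j < C.size n) :
    j < 2 * (boxOf b b₀ (disc e n)).n := by
  rwa [(h _).1, num_disc e hn]

/-- The boundary point with a given number. -/
def point (h : C.Fits e ε b b₀) (q : ℕ × ℕ) (hn : q.1 < k + 1) (hj : q.2 < C.size q.1) :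
    TPoint b b₀ :=
  ⟨disc e q.1, ⟨q.2, h.lt_of e hn hj⟩⟩

/-- The boundary interval with a given number. -/
def interval (h : C.Fits e ε b b₀) (q : ℕ × ℕ) (hn : q.1 < k + 1) (hj : q.2 < C.size q.1 + 1) :
    TInterval b b₀ :=
  ⟨disc e q.1, ⟨q.2, by rwa [(h _).1, num_disc e hn]⟩⟩

/-- The strings of the tangle. -/
def strandFun (hC : C.Planar k) (h : C.Fits e ε b b₀) (p : TPoint b b₀) : TPoint b b₀ :=
  point h (C.pt (num e p.1) p.2) (hC.1 _ (num_lt e _) _ (h.lt_size p)).1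
    (hC.1 _ (num_lt e _) _ (h.lt_size p)).2.1

variable (hC : C.Planar k) (h : C.Fits e ε b b₀)

theorem num_strandFun (p : TPoint b b₀) :
    num e (strandFun hC h p).1 = (C.pt (num e p.1) p.2).1 :=
  num_disc e (hC.1 _ (num_lt e _) _ (h.lt_size p)).1

theorem snd_strandFun (p : TPoint b b₀) :
    (strandFun hC h p).2.1 = (C.pt (num e p.1) p.2).2 := rfl

theorem isNone_eq_iff {d d' : Option ι} : (d.isNone = d'.isNone) ↔ (num e d = 0 ↔ num e d' = 0) :=
    by
  rcases d with _ | i <;> rcases d' with _ | i' <;> simp [num]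

/-- `shift` is the offset by one in `acrossBefore`: the clockwise order is reversed along a string
between two input discs, or between two points of the output disc, and then the side before `p`
continues as the side after `q`. -/
theorem lab_acrossBefore (p q : TPoint b b₀) :
    C.lab (num e (acrossBefore p q).1) (acrossBefore p q).2 =
      C.lab (num e q.1) (q.2 + shift (num e p.1) (num e q.1)) := by
  unfold acrossBefore shift
  by_cases hpq : p.1.isNone = q.1.isNone
  · rw [if_pos hpq, if_pos ((isNone_eq_iff (e := e)).1 hpq)]
    rfl
  · rw [if_neg hpq, if_neg (fun h1 => hpq ((isNone_eq_iff (e := e)).2 h1))]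
    rfl

theorem lab_acrossAfter (p q : TPoint b b₀) :
    C.lab (num e (acrossAfter p q).1) (acrossAfter p q).2 =
      C.lab (num e q.1) (q.2 + (1 - shift (num e p.1) (num e q.1))) := by
  unfold acrossAfter shift
  by_cases hpq : p.1.isNone = q.1.isNone
  · rw [if_pos hpq, if_pos ((isNone_eq_iff (e := e)).1 hpq)]
    rfl
  · rw [if_neg hpq, if_neg (fun h1 => hpq ((isNone_eq_iff (e := e)).2 h1))]
    rfl

theorem numbers_acrossAfter {p : TPoint b b₀} (hp : p.1 = none) (q : TPoint b b₀) :
    (num e (acrossAfter p q).1, (acrossAfter p q).2.1) =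
      if num e q.1 = 0 then (num e q.1, q.2.1) else (num e q.1, q.2.1 + 1) := by
  unfold acrossAfter
  by_cases hq : q.1 = none
  · rw [if_pos (by rw [hp, hq]), if_pos ((num_eq_zero e).2 hq)]
    rfl
  · rw [if_neg (by rw [hp, Option.isNone_eq_false_iff.2 (Option.isSome_iff_ne_none.2 hq)]; simp),
      if_neg (fun h1 => hq ((num_eq_zero e).1 h1))]
    rfl

theorem numbers_acrossBefore {p : TPoint b b₀} (hp : p.1 ≠ none) (q : TPoint b b₀) :
    (num e (acrossBefore p q).1, (acrossBefore p q).2.1) =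
      if num e q.1 = 0 then (num e q.1, q.2.1) else (num e q.1, q.2.1 + 1) := by
  have hp' : p.1.isNone = false := Option.isNone_eq_false_iff.2 (Option.isSome_iff_ne_none.2 hp)
  unfold acrossBefore
  by_cases hq : q.1 = none
  · rw [if_neg (by rw [hp', hq]; simp), if_pos ((num_eq_zero e).2 hq)]
    rfl
  · rw [if_pos (by rw [hp', Option.isNone_eq_false_iff.2 (Option.isSome_iff_ne_none.2 hq)]),
      if_neg (fun h1 => hq ((num_eq_zero e).1 h1))]
    rfl

/-- Walking along the boundary of a region is thereby a computation with pairs of numbers, and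
iterating `next` certifies that two intervals lie on the same boundary component. -/
theorem numbers_nextInterval (a : TInterval b b₀) :
    (num e (nextInterval (strandFun hC h) a).1, (nextInterval (strandFun hC h) a).2.1) =
      C.next (num e a.1, a.2.1) := by
  rcases a with ⟨_ | i, j⟩
  · by_cases hj : j.1 = 0
    · have h1 : nextInterval (strandFun hC h) ⟨none, j⟩ = ⟨none, Fin.last _⟩ := dif_pos hj
      rw [h1]
      change _ = C.next (0, j.1)
      rw [hj, next_zero_zero]
      exact congrArg (Prod.mk 0) (h none).1
    · have h1 : nextInterval (strandFun hC h) ⟨none, j⟩ =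
          acrossAfter ⟨none, ⟨j.1 - 1, by omega⟩⟩ (strandFun hC h ⟨none, ⟨j.1 - 1, by omega⟩⟩) :=
        dif_neg hj
      rw [h1]
      change _ = C.next (0, j.1)
      rw [numbers_acrossAfter (by rfl), next_zero C hj, num_strandFun, snd_strandFun]
      rfl
  · have h1 := (h (some i)).1
    change 2 * (b i).n = C.size (num e (some i)) at h1
    have hi : num e (some i) ≠ 0 := by simp [num]
    by_cases hj : j.1 < 2 * (b i).n
    · have h2 : nextInterval (strandFun hC h) ⟨some i, j⟩ =
          acrossBefore ⟨some i, ⟨j.1, hj⟩⟩ (strandFun hC h ⟨some i, ⟨j.1, hj⟩⟩) :=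
        dif_pos hj
      rw [h2]
      change _ = C.next (num e (some i), j.1)
      rw [numbers_acrossBefore (by simp), next_of_lt C hi (by rwa [← h1]), num_strandFun,
        snd_strandFun]
    · have h2 : nextInterval (strandFun hC h) ⟨some i, j⟩ = ⟨some i, 0⟩ := dif_neg hj
      rw [h2]
      change _ = C.next (num e (some i), j.1)
      rw [next_of_not_lt C hi (by rwa [← h1])]
      rfl

theorem quot_eq_of_iterate (a a' : TInterval b b₀) (n : ℕ)
    (hn : C.next^[n] (num e a.1, a.2.1) = (num e a'.1, a'.2.1)) :
    Quot.mk (SideRel (strandFun hC h)) a = Quot.mk (SideRel (strandFun hC h)) a' := by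
  induction n generalizing a with
  | zero =>
    rw [Function.iterate_zero, id, Prod.mk.injEq] at hn
    rw [interval_ext_num e hn.1 hn.2]
  | succ n ih =>
    rw [Function.iterate_succ_apply, ← numbers_nextInterval hC h] at hn
    rw [quot_next, ih _ hn]

theorem lab_eq_of_sideRel (a a' : TInterval b b₀) (ha : SideRel (strandFun hC h) a a') :
    C.lab (num e a.1) a.2 = C.lab (num e a'.1) a'.2 := by
  revert ha
  refine sideRel_inv (f := fun a : TInterval b b₀ => C.lab (num e a.1) a.2) ?_ ?_ ?_ a a'
  · intro d
    refine (hC.2.2.1 _ (num_lt e d)).trans ?_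
    change _ = C.lab (num e d) (2 * (boxOf b b₀ d).n)
    rw [(h d).1]
  · intro p
    rw [lab_acrossBefore, num_strandFun, snd_strandFun]
    exact (hC.1 _ (num_lt e _) _ (h.lt_size p)).2.2.2.2.1
  · intro p
    rw [lab_acrossAfter, num_strandFun, snd_strandFun]
    exact (hC.1 _ (num_lt e _) _ (h.lt_size p)).2.2.2.2.2

/-- The region at a boundary interval. -/
def regFun (a : TInterval b b₀) : Fin C.regions :=
  ⟨C.lab (num e a.1) a.2, (hC.2.1 _ (num_lt e _) _ (h.lt_size_succ a)).1⟩

/-- The chosen boundary interval at a region. -/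
def repFun (l : Fin C.regions) : TInterval b b₀ :=
  interval h (C.repOf l) (hC.2.2.2.1 l l.2).1 (hC.2.2.2.1 l l.2).2.1

theorem num_repFun (l : Fin C.regions) :
    num e (repFun hC h l).1 = (C.repOf l).1 := num_disc e (hC.2.2.2.1 l l.2).1

theorem regFun_repFun (l : Fin C.regions) : regFun hC h (repFun hC h l) = l := by
  ext
  change C.lab (num e (repFun hC h l).1) (C.repOf l).2 = l
  rw [num_repFun]
  exact (hC.2.2.2.1 l l.2).2.2.1

theorem quot_repFun (a : TInterval b b₀) (ha : ¬ (a.1 = none ∧ C.size 0 = 0)) :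
    Quot.mk (SideRel (strandFun hC h)) a =
      Quot.mk (SideRel (strandFun hC h)) (repFun hC h (regFun hC h a)) := by
  rcases (hC.2.1 _ (num_lt e _) _ (h.lt_size_succ a)).2.2 with h1 | ⟨n, -, hn⟩
  · exact absurd ⟨(num_eq_zero e).1 h1.1, h1.2⟩ ha
  · refine quot_eq_of_iterate hC h _ _ n ?_
    rw [hn, num_repFun]
    rfl

/-- Labels are constant on boundary components, and every interval can be walked to the
representative of its label. So there is one component per region; only the circle of an output disc
without points is left over. -/
theorem card_quot : Nat.card (Quot (SideRel (strandFun hC h))) =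
    C.regions + if C.size 0 = 0 then 1 else 0 := by
  have h0 := (h none).1
  by_cases hs : C.size 0 = 0
  · rw [if_pos hs]
    have hb : b₀.n = 0 := by
      change 2 * b₀.n = C.size 0 at h0
      omega
    -- `none` stands for the isolated circle of the output disc.
    rw [card_quot_eq (X := Option (Fin C.regions))
      (fun a => if a.1 = none then none else some (regFun hC h a))
      (fun o => o.elim ⟨none, 0⟩ (repFun hC h))]
    · simp
    · intro a a' ha
      have h1 : a.1 = none ↔ a'.1 = none := by
        rcases ha with d | p | p
        · rfl
        · rcases p with ⟨_ | i, j⟩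
          · have := j.2
            change j.1 < 2 * b₀.n at this
            omega
          -- A string from an input disc cannot end on the output disc, which has no points. So
          -- `SideRel` never links the isolated circle with anything else.
          · have hq : (strandFun hC h ⟨some i, j⟩).1 ≠ none := by
              intro hq
              have h2 := (hC.1 _ (num_lt e _) _ (h.lt_size ⟨some i, j⟩)).2.1
              rw [← num_strandFun hC h, hq] at h2
              change _ < C.size 0 at h2
              omega
            unfold acrossBefore
            split_ifs <;> simpa [before, after] using hq
        · rcases p with ⟨_ | i, j⟩
          · have := j.2
            change j.1 < 2 * b₀.n at this
            omega
          · have hq : (strandFun hC h ⟨some i, j⟩).1 ≠ none := by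
              intro hq
              have h2 := (hC.1 _ (num_lt e _) _ (h.lt_size ⟨some i, j⟩)).2.1
              rw [← num_strandFun hC h, hq] at h2
              change _ < C.size 0 at h2
              omega
            unfold acrossAfter
            split_ifs <;> simpa [before, after] using hq
      by_cases h2 : a.1 = none
      · rw [if_pos h2, if_pos (h1.1 h2)]
      · rw [if_neg h2, if_neg (fun h3 => h2 (h1.2 h3))]
        exact congrArg some (Fin.ext (lab_eq_of_sideRel hC h a a' ha))
    · rintro (_ | l)
      · rfl
      · have : (repFun hC h l).1 ≠ none := by
          intro h1
          have h2 := num_repFun hC h l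
          rw [h1] at h2
          exact (hC.2.2.2.1 l l.2).2.2.2 ⟨h2.symm, hs⟩
        simp [this, regFun_repFun]
    · intro a
      by_cases h2 : a.1 = none
      · simp only [h2, if_true, Option.elim]
        refine congrArg _ (interval_ext h2 ?_)
        have := h.lt_size_succ a
        rw [(num_eq_zero e).2 h2] at this
        change a.2.1 = 0
        omega
      · simp only [h2, if_false, Option.elim]
        exact quot_repFun hC h a (fun h3 => h2 h3.1)
  · rw [if_neg hs, card_quot_eq (regFun hC h) (repFun hC h)]
    · simp
    · exact fun a a' ha => Fin.ext (lab_eq_of_sideRel hC h a a' ha)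
    · exact regFun_repFun hC h
    · exact fun a => quot_repFun hC h a (fun h3 => hs h3.2)

/-- The planar tangle described by a code. -/
def tangle : PlanarTangle b b₀ where
  Region := Fin C.regions
  Loop := Empty
  finite_discs := Finite.of_equiv _ e.symm
  finite_region := inferInstance
  finite_loop := inferInstance
  strand := strandFun hC h
  strand_strand := fun p => by
    have h1 := (hC.1 _ (num_lt e _) _ (h.lt_size p)).2.2.2.1
    apply point_ext_num e
    · rw [num_strandFun, num_strandFun, snd_strandFun, h1]
    · rw [snd_strandFun, num_strandFun, snd_strandFun, h1]
  strand_ne := fun p hp => by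
    refine (hC.1 _ (num_lt e _) _ (h.lt_size p)).2.2.1 (Prod.ext ?_ ?_)
    · rw [← num_strandFun hC h, hp]
    · rw [← snd_strandFun hC h, hp]
  reg := regFun hC h
  shade := fun l => xor ε (C.shadeOf l)
  side := fun l => l.elim
  reg_side := fun a a' ha => Fin.ext (lab_eq_of_sideRel hC h a a' ha)
  shade_reg := fun a => by
    change xor ε (C.shadeOf (C.lab (num e a.1) a.2)) = _
    rw [(hC.2.1 _ (num_lt e _) _ (h.lt_size_succ a)).2.1, BoxType.shadeAt, (h a.1).2,
      Bool.xor_assoc]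
  shade_side := fun l => l.elim
  connected := by
    obtain ⟨u, hu, hd⟩ := hC.2.2.2.2.1
    refine connected_of_common _ _ ⟨u, hu⟩ ?_ (fun l => ⟨_, regFun_repFun hC h l⟩)
    intro d
    obtain ⟨j, hj, hj'⟩ := hd _ (num_lt e d)
    exact ⟨⟨j, by rwa [(h d).1]⟩, Fin.ext hj'⟩
  euler := by
    rw [card_quot hC h]
    have : Fintype ι := Fintype.ofEquiv _ e.symm
    have h1 : Nat.card (Option ι) = k + 1 := by
      rw [Nat.card_congr (Equiv.optionCongr e)]
      simp
    have h2 : Nat.card (TPoint b b₀) = ∑ d ∈ Finset.range (k + 1), C.size d := by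
      rw [card_tpoint, Finset.sum_range_succ', add_comm, ← Fin.sum_univ_eq_sum_range
        (fun d => C.size (d + 1))]
      congr 1
      · rw [← Equiv.sum_comp e.symm]
        refine Finset.sum_congr rfl fun i _ => ?_
        have := (h (some (e.symm i))).1
        simpa [num] using this
      · exact (h none).1
    rw [h1, h2]
    simpa using hC.2.2.2.2.2

end Code
end PFPlanar

/-! ### Isomorphism, reflection and gluing of tangles, decided on codes -/

namespace PFPlanar

namespace Code

instance {ι : Type} {k : ℕ} {e : ι ≃ Fin k} {b : ι → BoxType} {b₀ : BoxType} {C : Code} {ε : Bool}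
    (hC : C.Planar k) (h : C.Fits e ε b b₀) : IsEmpty (tangle hC h).Loop :=
  inferInstanceAs (IsEmpty Empty)

section Isomorphism

variable {ι : Type} {k : ℕ} {e : ι ≃ Fin k} {b : Fin k → BoxType} {b₀ : BoxType} {C : Code}
  {ε : Bool}

theorem num_mapPoint (p : TPoint (fun i => b (e i)) b₀) :
    num (Equiv.refl _) (mapPoint e p).1 = num e p.1 := by
  rcases p with ⟨_ | i, j⟩ <;> rfl

theorem snd_mapPoint (p : TPoint (fun i => b (e i)) b₀) : (mapPoint e p).2.1 = p.2.1 := by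
  rcases p with ⟨_ | i, j⟩ <;> rfl

theorem num_mapInterval (p : TInterval (fun i => b (e i)) b₀) :
    num (Equiv.refl _) (mapInterval e p).1 = num e p.1 := by
  rcases p with ⟨_ | i, j⟩ <;> rfl

theorem snd_mapInterval (p : TInterval (fun i => b (e i)) b₀) : (mapInterval e p).2.1 = p.2.1 := by
  rcases p with ⟨_ | i, j⟩ <;> rfl

theorem mapInterval_surjective (a : TInterval b b₀) :
    ∃ a' : TInterval (fun i => b (e i)) b₀, mapInterval e a' = a := by
  rcases a with ⟨_ | i, j⟩
  · exact ⟨⟨none, j⟩, rfl⟩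
  · obtain ⟨i, rfl⟩ := e.surjective i
    exact ⟨⟨some i, j⟩, rfl⟩

/-- A tangle is determined by a code. -/
noncomputable def tangleIso (hC : C.Planar k) (h : C.Fits (Equiv.refl _) ε b b₀)
    (T : PlanarTangle (fun i => b (e i)) b₀) [IsEmpty T.Loop] (g : T.Region → ℕ)
    (hg : Function.Injective g) (hlt : ∀ r, g r < C.regions)
    (hreg : ∀ a, g (T.reg a) = C.lab (num e a.1) a.2)
    (hstrand : ∀ p, num e (T.strand p).1 = (C.pt (num e p.1) p.2).1 ∧
      (T.strand p).2.1 = (C.pt (num e p.1) p.2).2) :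
    TangleIso e T (tangle hC h) where
  region := Equiv.ofBijective (fun r => (⟨g r, hlt r⟩ : Fin C.regions)) (by
    have hlab : ∀ a, regFun hC h (mapInterval e a) = ⟨g (T.reg a), hlt _⟩ := by
      intro a
      ext
      change C.lab _ _ = g (T.reg a)
      rw [num_mapInterval, snd_mapInterval, hreg]
    constructor
    · intro r r' hr
      exact hg (congrArg Fin.val hr)
    · intro l
      -- Every region of the code lies along its representative interval, and `T` has the same
      -- boundary intervals; so no region of the code is missed.
      obtain ⟨a, ha⟩ := mapInterval_surjective (e := e) (repFun hC h l)
      refine ⟨T.reg a, ?_⟩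
      refine (hlab a).symm.trans ?_
      exact (congrArg _ ha).trans (regFun_repFun hC h l))
  loop := Equiv.equivOfIsEmpty _ _
  strand := fun p => by
    refine point_ext_num (Equiv.refl _) ?_ ?_
    · rw [num_mapPoint, (hstrand p).1]
      refine (num_strandFun hC h _).trans ?_
      rw [num_mapPoint, snd_mapPoint]
    · rw [snd_mapPoint, (hstrand p).2]
      refine (snd_strandFun hC h _).trans ?_
      rw [num_mapPoint, snd_mapPoint]
  reg := fun a => by
    refine Fin.ext ?_
    change C.lab _ _ = g (T.reg a)
    rw [num_mapInterval, snd_mapInterval, hreg]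
  side := fun l => isEmptyElim l

/-- The action of a tangle is given by the action of its code. -/
theorem Z_tangle (P : CStarPlanarAlgebra.{u}) (hC : C.Planar k) (h : C.Fits (Equiv.refl _) ε b b₀)
    {b' : ι → BoxType} (hb : ∀ i, b' i = b (e i)) (T : PlanarTangle b' b₀) [IsEmpty T.Loop]
    (g : T.Region → ℕ) (hg : Function.Injective g) (hlt : ∀ r, g r < C.regions)
    (hreg : ∀ a, g (T.reg a) = C.lab (num e a.1) a.2)
    (hstrand : ∀ p, num e (T.strand p).1 = (C.pt (num e p.1) p.2).1 ∧
      (T.strand p).2.1 = (C.pt (num e p.1) p.2).2)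
    (v : ∀ i, P.V (b i)) (w : ∀ i, P.V (b' i)) (hw : ∀ i, HEq (w i) (v (e i))) :
    P.Z (tangle hC h) v = P.Z T w := by
  -- The box types of the two tangles are equal only propositionally, hence the heterogeneous
  -- equality of the inputs. After this substitution it is an ordinary one.
  obtain rfl : b' = fun i => b (e i) := funext hb
  rw [P.Z_iso e T (tangle hC h) (tangleIso hC h T g hg hlt hreg hstrand) v]
  exact congrArg _ (funext fun i => (eq_of_heq (hw i)).symm)

end Isomorphism

section Reflection

/-- The second code describes the mirror image of the first one. -/
def Mirror (C C' : Code) (k : ℕ) : Prop :=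
  C.regions = C'.regions ∧
  (∀ d < k + 1, ∀ j < C.size d, C'.pt d (C.size d - (j + 1)) =
    ((C.pt d j).1, C.size (C.pt d j).1 - ((C.pt d j).2 + 1))) ∧
  ∀ d < k + 1, ∀ j < C.size d + 1, C'.lab d (C.size d - j) = C.lab d j

instance (C C' : Code) (k : ℕ) : Decidable (Mirror C C' k) := by
  unfold Mirror
  infer_instance

variable {k : ℕ} {b : Fin k → BoxType} {b₀ : BoxType} {C C' : Code} {ε : Bool}

/-- The mirror image of a tangle. -/
def tangleReflection (hC : C.Planar k) (h : C.Fits (Equiv.refl _) ε b b₀) (hC' : C'.Planar k)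
    (h' : C'.Fits (Equiv.refl _) ε b b₀) (hm : Mirror C C' k) :
    TangleReflection (tangle hC h) (tangle hC' h') where
  region := finCongr hm.1
  loop := Equiv.equivOfIsEmpty Empty Empty
  strand := fun p => by
    have h1 := hm.2.1 _ (num_lt (Equiv.refl _) p.1) _ (h.lt_size p)
    have h2 : (2 * (boxOf b b₀ p.1).n) - (p.2.1 + 1) = C.size (num (Equiv.refl _) p.1) - (p.2.1 +
      1) :=
      congrArg (· - (p.2.1 + 1)) (h p.1).1
    have h4 : ((tangle hC h).strand p).2.1 = (C.pt (num (Equiv.refl _) p.1) p.2).2 := rfl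
    have h3 : 2 * (boxOf b b₀ ((tangle hC h).strand p).1).n -
        (((tangle hC h).strand p).2.1 + 1) =
        C.size (C.pt (num (Equiv.refl _) p.1) p.2).1 -
          ((C.pt (num (Equiv.refl _) p.1) p.2).2 + 1) := by
      refine (congrArg (· - (((tangle hC h).strand p).2.1 + 1)) (h _).1).trans ?_
      rw [h4]
      exact congrArg (fun n => C.size n - _) (num_strandFun hC h p)
    refine point_ext_num (Equiv.refl _) ?_ ?_
    · refine (num_strandFun hC' h' _).trans ?_
      refine Eq.trans ?_ (num_strandFun hC h p).symm
      change (C'.pt (num (Equiv.refl _) p.1) p.2.rev.1).1 = _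
      rw [Fin.val_rev, h2, h1]
    · refine (snd_strandFun hC' h' _).trans ?_
      change (C'.pt (num (Equiv.refl _) p.1) p.2.rev.1).2 =
        (((tangle hC h).strand p).2.rev).1
      rw [Fin.val_rev, Fin.val_rev, h2, h1, h3]
  reg := fun a => by
    have h1 := hm.2.2 _ (num_lt (Equiv.refl _) a.1) _ (h.lt_size_succ a)
    refine Fin.ext ?_
    change C'.lab (num (Equiv.refl _) a.1) a.2.rev.1 = C.lab (num (Equiv.refl _) a.1) a.2.1
    rw [Fin.val_rev, ← h1, ← (h a.1).1]
    congr 1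
    omega
  side := fun l => isEmptyElim (α := Empty) l

end Reflection

section Composition

variable (CT : Code) (CS : ℕ → Code) (CU : Code) (dm : ℕ → ℕ → ℕ)

/-- The end of the path of strings which starts at a point of the tangle `CT` (`true`) or `CS i`
(`false`). The number of the disc `k` of `CS i` in the composite is `dm i k`. -/
def follow : ℕ → Bool → ℕ → ℕ → ℕ → Option (ℕ × ℕ)
  | 0, _, _, _, _ => none
  | n + 1, true, i, _, j =>
    if (CT.pt i j).1 = 0 then some (0, (CT.pt i j).2)
    else follow n false (CT.pt i j).1 0 (CT.pt i j).2
  | n + 1, false, i, k, j =>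
    if ((CS i).pt k j).1 = 0 then follow n true i 0 ((CS i).pt k j).2
    else some (dm i ((CS i).pt k j).1, ((CS i).pt k j).2)

/-- The pairs of regions which meet along a seam; `(0, l)` is the region `l` of `CT`, and
`(i, l)` is the region `l` of `CS i`. -/
def seams (k : ℕ) : List ((ℕ × ℕ) × (ℕ × ℕ)) :=
  (List.range k).flatMap fun i => (List.range (CT.size (i + 1) + 1)).map fun j =>
    ((0, CT.lab (i + 1) j), (i + 1, (CS (i + 1)).lab 0 j))

/-- Adds the end points of a seam to a list which contains one of them. -/
def addSeam (L : List (ℕ × ℕ)) (s : (ℕ × ℕ) × (ℕ × ℕ)) : List (ℕ × ℕ) :=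
  if s.1 ∈ L then (if s.2 ∈ L then L else s.2 :: L) else if s.2 ∈ L then s.1 :: L else L

/-- The regions connected with the regions in a list. -/
def reach (k n : ℕ) (L : List (ℕ × ℕ)) : List (ℕ × ℕ) :=
  (fun L => (seams CT CS k).foldl addSeam L)^[n] L

/-- The code `CU` describes the composite of `CT` with the codes `CS i`; the regions of `CT` are
mapped to the regions of `CU` by `rT`, the regions of `CS i` by `rS i`. In the composite, every
region of `CT` and `CS i` is connected to the region `root l`, if it becomes a part of the region
`l`. -/
def Composite (k : ℕ) (m : ℕ → ℕ) (rT : List ℕ) (rS : ℕ → List ℕ) (root : List (ℕ × ℕ)) : Prop :=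
  ((∀ j < CT.size 0, follow CT CS dm 20 true 0 0 j = some (CU.pt 0 j)) ∧
  (∀ i < k, ∀ n < m i, ∀ j < (CS (i + 1)).size (n + 1),
    follow CT CS dm 20 false (i + 1) (n + 1) j = some (CU.pt (dm (i + 1) (n + 1)) j)) ∧
  (∀ i < k, ∀ j < CT.size (i + 1), follow CT CS dm 20 true (i + 1) 0 j ≠ none)) ∧
  ((∀ l < CT.regions, rT.getD l 0 < CU.regions ∧
    root.getD (rT.getD l 0) (0, 0) ∈ reach CT CS k 6 [(0, l)]) ∧
  (∀ i < k, ∀ l < (CS (i + 1)).regions, (rS (i + 1)).getD l 0 < CU.regions ∧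
    root.getD ((rS (i + 1)).getD l 0) (0, 0) ∈ reach CT CS k 6 [(i + 1, l)])) ∧
  ((∀ i < k, ∀ j < CT.size (i + 1) + 1,
    rT.getD (CT.lab (i + 1) j) 0 = (rS (i + 1)).getD ((CS (i + 1)).lab 0 j) 0) ∧
  (∀ j < CT.size 0 + 1, rT.getD (CT.lab 0 j) 0 = CU.lab 0 j) ∧
  (∀ i < k, ∀ n < m i, ∀ j < (CS (i + 1)).size (n + 1) + 1,
    (rS (i + 1)).getD ((CS (i + 1)).lab (n + 1) j) 0 = CU.lab (dm (i + 1) (n + 1)) j))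

set_option synthInstance.maxSize 2000 in
set_option synthInstance.maxHeartbeats 200000 in
instance (k : ℕ) (m : ℕ → ℕ) (rT : List ℕ) (rS : ℕ → List ℕ) (root : List (ℕ × ℕ)) :
    Decidable (Composite CT CS CU dm k m rT rS root) := by
  unfold Composite
  infer_instance

variable {CT CS CU dm}
variable {k : ℕ} {m : Fin k → ℕ} {b : Fin k → BoxType} {c : ∀ i, Fin (m i) → BoxType} {b₀ : BoxType}
  {K : ℕ} {e : (Σ i, Fin (m i)) ≃ Fin K} {ε ε' : Bool} {εS : Fin k → Bool}
  (hT : CT.Planar k) (fT : CT.Fits (Equiv.refl _) ε b b₀)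
  (hS : ∀ i : Fin k, (CS (i + 1)).Planar (m i))
  (fS : ∀ i : Fin k, (CS (i + 1)).Fits (Equiv.refl _) (εS i) (c i) (b i))
  (hU : CU.Planar K) (fU : CU.Fits e ε' (fun x => c x.1 x.2) b₀)
  (hdm : ∀ (i : Fin k) (n : Fin (m i)), dm (i + 1) (n + 1) = e ⟨i, n⟩ + 1)

-- Induction on the fuel; each round of `follow` uses one string of the outer tangle or of an
-- inserted one. Only soundness matters: a returned value certifies a path, and `none` claims
-- nothing.
include hdm in
theorem follow_spec (n : ℕ) :
    (∀ (p : TPoint b b₀) (q : ℕ × ℕ), follow CT CS dm n true (num (Equiv.refl _) p.1) 0 p.2 = some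
      q →
      ∃ u : TPoint (fun x : Σ i, Fin (m i) => c x.1 x.2) b₀, (num e u.1, u.2.1) = q ∧
        Quot.mk (PathRel (tangle hT fT) fun i => tangle (hS i) (fS i)) (glueT p) =
          Quot.mk _ (glueU u)) ∧
    ∀ (i : Fin k) (p : TPoint (c i) (b i)) (q : ℕ × ℕ),
      follow CT CS dm n false (i + 1) (num (Equiv.refl _) p.1) p.2 = some q →
      ∃ u : TPoint (fun x : Σ i, Fin (m i) => c x.1 x.2) b₀, (num e u.1, u.2.1) = q ∧
        Quot.mk (PathRel (tangle hT fT) fun i => tangle (hS i) (fS i)) (glueS i p) =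
          Quot.mk _ (glueU u) := by
  induction n with
  | zero =>
    constructor
    · intro p q h
      simp [follow] at h
    · intro i p q h
      simp [follow] at h
  | succ n ih =>
    constructor
    · intro p q h
      have h1 := num_strandFun hT fT p
      have h2 := snd_strandFun hT fT p
      have h3 := Quot.sound (PathRel.left (T := tangle hT fT)
        (S := fun i => tangle (hS i) (fS i)) p)
      rw [follow, ← h1, ← h2] at h
      change _ = Quot.mk _ (glueT (strandFun hT fT p)) at h3
      rw [h3]
      revert h
      generalize strandFun hT fT p = p'
      rcases p' with ⟨_ | i, j⟩
      · intro h
        exact ⟨⟨none, j⟩, Option.some.inj h, rfl⟩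
      · intro h
        rw [if_neg (by simp [num])] at h
        exact ih.2 i ⟨none, j⟩ q h
    · intro i p q h
      have h1 := num_strandFun (hS i) (fS i) p
      have h2 := snd_strandFun (hS i) (fS i) p
      have h3 := Quot.sound (PathRel.right (T := tangle hT fT)
        (S := fun i => tangle (hS i) (fS i)) i p)
      rw [follow, ← h1, ← h2] at h
      change _ = Quot.mk _ (glueS i (strandFun (hS i) (fS i) p)) at h3
      rw [h3]
      revert h
      generalize strandFun (hS i) (fS i) p = p'
      rcases p' with ⟨_ | l, j⟩
      · intro h
        rw [if_pos (by simp [num])] at h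
        exact ih.1 ⟨some i, j⟩ q h
      · intro h
        rw [if_neg (by simp [num])] at h
        refine ⟨⟨some ⟨i, l⟩, j⟩, ?_, rfl⟩
        rw [← Option.some.inj h]
        exact Prod.ext (hdm i l).symm rfl

/-- The number of a region of the tangle or of one of the tangles which are glued into it. -/
def nodeNum : Fin CT.regions ⊕ (Σ i : Fin k, Fin (CS (i + 1)).regions) → ℕ × ℕ
  | .inl l => (0, l)
  | .inr x => (x.1 + 1, x.2)

omit hT fT hS fS in
theorem nodeNum_injective : Function.Injective (nodeNum (CT := CT) (CS := CS) (k := k)) := by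
  rintro (l | ⟨i, l⟩) (l' | ⟨i', l'⟩) h
  · simp only [nodeNum, Prod.mk.injEq] at h
    rw [Fin.ext h.2]
  · simp [nodeNum] at h
  · simp [nodeNum] at h
  · simp only [nodeNum, Prod.mk.injEq] at h
    obtain rfl : i = i' := Fin.ext (by omega)
    rw [Fin.ext h.2]

/-- `addSeam` adds a region only if a seam joins it to one already in the list. Again only soundness
is needed, so the number of rounds in `reach` may be fixed arbitrarily. -/
theorem reach_spec (x : Fin CT.regions ⊕ (Σ i : Fin k, Fin (CS (i + 1)).regions)) (n : ℕ) :
    ∀ y ∈ reach CT CS k n [nodeNum x], ∃ z, nodeNum z = y ∧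
      Quot.mk (SeamRel (tangle hT fT) fun i => tangle (hS i) (fS i)) x = Quot.mk _ z := by
  have step : ∀ L : List (ℕ × ℕ), (∀ y ∈ L, ∃ z, nodeNum z = y ∧
      Quot.mk (SeamRel (tangle hT fT) fun i => tangle (hS i) (fS i)) x = Quot.mk _ z) →
      ∀ s ∈ seams CT CS k, ∀ y ∈ addSeam L s, ∃ z, nodeNum z = y ∧
      Quot.mk (SeamRel (tangle hT fT) fun i => tangle (hS i) (fS i)) x = Quot.mk _ z := by
    intro L hL s hs
    simp only [seams, List.mem_flatMap, List.mem_range, List.mem_map] at hs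
    obtain ⟨i, hi, j, hj, rfl⟩ := hs
    have hj' : j < 2 * (b ⟨i, hi⟩).n + 1 := by
      have := (fT (some ⟨i, hi⟩)).1
      change 2 * (b ⟨i, hi⟩).n = CT.size (i + 1) at this
      rwa [this]
    have h1 := Quot.sound (SeamRel.mk (T := tangle hT fT) (S := fun i => tangle (hS i) (fS i))
      ⟨i, hi⟩ ⟨j, hj'⟩)
    have e1 : nodeNum (CT := CT) (CS := CS) (k := k)
      (Sum.inl ((tangle hT fT).reg ⟨some ⟨i, hi⟩, ⟨j, hj'⟩⟩)) = (0, CT.lab (i + 1) j) := rfl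
    have e2 : nodeNum (CT := CT) (CS := CS) (k := k)
      (Sum.inr ⟨⟨i, hi⟩, (tangle (hS ⟨i, hi⟩) (fS ⟨i, hi⟩)).reg ⟨none, ⟨j, hj'⟩⟩⟩) =
        (i + 1, (CS (i + 1)).lab 0 j) := rfl
    intro y hy
    simp only [addSeam] at hy
    split_ifs at hy with h2 h3 h3
    · exact hL y hy
    · rcases List.mem_cons.1 hy with rfl | hy
      · obtain ⟨z, hz, hz'⟩ := hL _ h2
        refine ⟨_, e2, ?_⟩
        exact hz'.trans ((congrArg _ (nodeNum_injective (hz.trans e1.symm))).trans h1)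
      · exact hL y hy
    · rcases List.mem_cons.1 hy with rfl | hy
      · obtain ⟨z, hz, hz'⟩ := hL _ h3
        refine ⟨_, e1, ?_⟩
        exact hz'.trans ((congrArg _ (nodeNum_injective (hz.trans e2.symm))).trans h1.symm)
      · exact hL y hy
    · exact hL y hy
  have fold : ∀ S : List ((ℕ × ℕ) × (ℕ × ℕ)), (∀ s ∈ S, s ∈ seams CT CS k) →
      ∀ L : List (ℕ × ℕ), (∀ y ∈ L, ∃ z, nodeNum z = y ∧
      Quot.mk (SeamRel (tangle hT fT) fun i => tangle (hS i) (fS i)) x = Quot.mk _ z) →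
      ∀ y ∈ S.foldl addSeam L, ∃ z, nodeNum z = y ∧
      Quot.mk (SeamRel (tangle hT fT) fun i => tangle (hS i) (fS i)) x = Quot.mk _ z := by
    intro S
    induction S with
    | nil => exact fun _ L hL => hL
    | cons s S ih =>
      intro hS' L hL
      exact ih (fun s' hs' => hS' s' (List.mem_cons_of_mem _ hs')) _
        (step L hL s (hS' s List.mem_cons_self))
  induction n with
  | zero =>
    intro y hy
    exact ⟨x, (List.mem_singleton.1 hy).symm, rfl⟩
  | succ n ih =>
    unfold reach at ih ⊢
    rw [Function.iterate_succ_apply']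
    exact fold _ (fun s hs => hs) _ ih

/-- The composite of tangles is described by the composite code. -/
theorem nonempty_tangleComp {mN : ℕ → ℕ} (hm : ∀ i : Fin k, mN i = m i)
    {rT : List ℕ} {rS : ℕ → List ℕ} {root : List (ℕ × ℕ)}
    (hdm : ∀ (i : Fin k) (n : Fin (m i)), dm (i + 1) (n + 1) = e ⟨i, n⟩ + 1)
    (hc : Composite CT CS CU dm k mN rT rS root) :
    Nonempty (TangleComp (tangle hT fT) (fun i => tangle (hS i) (fS i)) (tangle hU fU)) := by
  obtain ⟨⟨hA, hB, hC⟩, ⟨hD, hE⟩, hF, hG, hH⟩ := hc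
  have hout : ∀ j : Fin (2 * b₀.n + 1), j.1 < CT.size 0 + 1 := fun j => by
    have := fT.lt_size_succ ⟨none, j⟩
    exact this
  let φ : Fin CT.regions ⊕ (Σ i : Fin k, Fin (CS (i + 1)).regions) → Fin CU.regions :=
    Sum.elim (fun l => ⟨rT.getD l 0, (hD l l.2).1⟩)
      (fun x => ⟨(rS (x.1 + 1)).getD x.2 0, (hE x.1 x.1.2 x.2 x.2.2).1⟩)
  have hφ : ∀ x y, SeamRel (tangle hT fT) (fun i => tangle (hS i) (fS i)) x y → φ x = φ y := by
    rintro _ _ ⟨i, j⟩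
    refine Fin.ext ?_
    have hj : j.1 < CT.size (i + 1) + 1 := fT.lt_size_succ ⟨some i, j⟩
    exact hF i i.2 j hj
  have outer : ∀ j, (tangle hU fU).reg ⟨none, j⟩ = φ (Sum.inl ((tangle hT fT).reg ⟨none, j⟩)) :=
    fun j => Fin.ext (hG j (hout j)).symm
  have inner : ∀ i n j, (tangle hU fU).reg ⟨some ⟨i, n⟩, j⟩ =
      φ (Sum.inr ⟨i, (tangle (hS i) (fS i)).reg ⟨some n, j⟩⟩) := fun i n j => by
    have hj : j.1 < (CS (i + 1)).size (n + 1) + 1 := (fS i).lt_size_succ ⟨some n, j⟩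
    refine Fin.ext ?_
    have := hH i i.2 n (by rw [hm]; exact n.2) j hj
    rw [hdm] at this
    exact this.symm
  have hbij : Function.Bijective (Quot.lift φ hφ) := by
    constructor
    · rintro ⟨x⟩ ⟨y⟩ (hxy : φ x = φ y)
      -- Injectivity: regions with the same image are both connected through seams to the root of
      -- this image, hence to each other. This is the purpose of `root`.
      have key : ∀ x, ∃ z, nodeNum z = root.getD (φ x) (0, 0) ∧
          Quot.mk (SeamRel (tangle hT fT) fun i => tangle (hS i) (fS i)) x = Quot.mk _ z := by
        rintro (l | ⟨i, l⟩)
        · exact reach_spec hT fT hS fS (Sum.inl l) 6 _ (hD l l.2).2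
        · exact reach_spec hT fT hS fS (Sum.inr ⟨i, l⟩) 6 _ (hE i i.2 l l.2).2
      obtain ⟨z, hz, hz'⟩ := key x
      obtain ⟨w, hw, hw'⟩ := key y
      rw [hxy] at hz
      exact hz'.trans ((congrArg _ (nodeNum_injective (hz.trans hw.symm))).trans hw'.symm)
    · intro l
      have hl : (tangle hU fU).reg (repFun hU fU l) = l := regFun_repFun hU fU l
      revert hl
      generalize repFun hU fU l = a
      rcases a with ⟨_ | ⟨i, n⟩, j⟩
      · exact fun hl => ⟨Quot.mk _ (Sum.inl ((tangle hT fT).reg ⟨none, j⟩)), (outer j).symm.trans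
        hl⟩
      · exact fun hl => ⟨Quot.mk _ (Sum.inr ⟨i, (tangle (hS i) (fS i)).reg ⟨some n, j⟩⟩),
          (inner i n j).symm.trans hl⟩
  -- A closed path would have to run through seam points, but from each of these `follow` arrives at
  -- a point of the composite.
  have hclosed : IsEmpty (ClosedPath (tangle hT fT) (fun i => tangle (hS i) (fS i))) := by
    refine ⟨fun w => ?_⟩
    obtain ⟨⟨g⟩, hw⟩ := w
    rcases g with j | ⟨i, j⟩ | ⟨i, n, j⟩
    · exact hw ⟨none, j⟩ rfl
    · have hj : j.1 < CT.size (i + 1) := fT.lt_size ⟨some i, j⟩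
      obtain ⟨q, hq⟩ := Option.ne_none_iff_exists'.1 (hC i i.2 j hj)
      obtain ⟨u, -, hu⟩ := (follow_spec hT fT hS fS hdm 20).1 ⟨some i, j⟩ q hq
      exact hw u hu.symm
    · exact hw ⟨some ⟨i, n⟩, j⟩ rfl
  have hloop : IsEmpty ((tangle hT fT).Loop ⊕ (Σ i, (tangle (hS i) (fS i)).Loop) ⊕
      ClosedPath (tangle hT fT) (fun i => tangle (hS i) (fS i))) := by
    refine ⟨?_⟩
    rintro (l | ⟨i, l⟩ | w)
    · exact isEmptyElim (α := Empty) l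
    · exact isEmptyElim (α := Empty) l
    · exact hclosed.elim w
  exact ⟨{
    region := Equiv.ofBijective _ hbij
    loop := @Equiv.equivOfIsEmpty _ Empty hloop _
    strand := by
      rintro ⟨_ | ⟨i, n⟩, j⟩
      · have hj : j.1 < CT.size 0 := fT.lt_size ⟨none, j⟩
        obtain ⟨u, hu, hu'⟩ := (follow_spec hT fT hS fS hdm 20).1 ⟨none, j⟩ _ (hA j hj)
        have : u = strandFun hU fU ⟨none, j⟩ := point_ext_num e
          ((congrArg Prod.fst hu).trans (num_strandFun hU fU ⟨none, j⟩).symm) (congrArg Prod.snd hu)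
        rw [this] at hu'
        exact hu'
      · have hj : j.1 < (CS (i + 1)).size (n + 1) := (fS i).lt_size ⟨some n, j⟩
        obtain ⟨u, hu, hu'⟩ := (follow_spec hT fT hS fS hdm 20).2 i ⟨some n, j⟩ _
          (hB i i.2 n (by rw [hm]; exact n.2) j hj)
        rw [hdm] at hu
        have : u = strandFun hU fU ⟨some ⟨i, n⟩, j⟩ := point_ext_num e
          ((congrArg Prod.fst hu).trans (num_strandFun hU fU ⟨some ⟨i, n⟩, j⟩).symm) (congrArg
            Prod.snd hu)
        rw [this] at hu'
        exact hu'
    reg_outer := outer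
    reg_inner := inner
    side_left := fun l => isEmptyElim (α := Empty) l
    side_right := fun i l => isEmptyElim (α := Empty) l
    side_closed := fun w => hclosed.elim w }⟩

/-- The action of a composite code. -/
theorem Z_comp (P : CStarPlanarAlgebra.{u}) {d : Fin K → BoxType}
    {hT : CT.Planar k} {fT : CT.Fits (Equiv.refl _) ε b b₀}
    (hS : ∀ i : Fin k, (CS (i + 1)).Planar (m i))
    (fS : ∀ i : Fin k, (CS (i + 1)).Fits (Equiv.refl _) (εS i) (c i) (b i))
    {hU : CU.Planar K} {fU : CU.Fits (Equiv.refl _) ε' d b₀}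
    (e : (Σ i, Fin (m i)) ≃ Fin K) {mN : ℕ → ℕ} (hm : ∀ i : Fin k, mN i = m i)
    {rT : List ℕ} {rS : ℕ → List ℕ} {root : List (ℕ × ℕ)}
    (hdm : ∀ (i : Fin k) (n : Fin (m i)), dm (i + 1) (n + 1) = e ⟨i, n⟩ + 1)
    (hc : Composite CT CS CU dm k mN rT rS root)
    (hd : ∀ i n, c i n = d (e ⟨i, n⟩))
    (v : ∀ x, P.V (d x)) (w : ∀ i n, P.V (c i n)) (hw : ∀ i n, HEq (w i n) (v (e ⟨i, n⟩))) :
    P.Z (tangle hU fU) v = P.Z (tangle hT fT) (fun i => P.Z (tangle (hS i) (fS i)) (w i)) := by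
  -- Gluing produces discs indexed by the sigma type. The composite is formed with this indexing and
  -- then renumbered along `e` by isotopy invariance.
  have fU' : CU.Fits e ε' (fun x : Σ i, Fin (m i) => c x.1 x.2) b₀ := by
    rintro (_ | ⟨i, n⟩)
    · exact fU none
    · have := fU (some (e ⟨i, n⟩))
      change 2 * (d (e ⟨i, n⟩)).n = _ ∧ (d (e ⟨i, n⟩)).shaded = _ at this
      rw [← hd] at this
      exact this
  obtain ⟨h⟩ := nonempty_tangleComp hT fT hS fS hU fU' hm hdm hc
  rw [← P.Z_comp _ _ _ h (fun x => w x.1 x.2)]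
  exact Z_tangle P hU fU (fun x => hd x.1 x.2) (tangle hU fU') (fun l : Fin CU.regions => l.1)
    Fin.val_injective (fun l => l.2) (fun a => rfl) (fun p => ⟨num_strandFun hU fU' p, rfl⟩) v _
    (fun x => hw x.1 x.2)

end Composition

end Code
end PFPlanar

/-! ### Families of boxes, and gluing into one or two discs -/

namespace PFPlanar

namespace CStarPlanarAlgebra

variable (P : CStarPlanarAlgebra.{u}) {A B C D E F : BoxType}

/-- The family consisting of one element. -/
def vec₁ (a : P.V A) : ∀ i, P.V (![A] i) := Fin.cons a finZeroElim

/-- The family consisting of two elements. -/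
def vec₂ (a : P.V A) (b : P.V B) : ∀ i, P.V (![A, B] i) := Fin.cons a (P.vec₁ b)

/-- The family consisting of three elements. -/
def vec₃ (a : P.V A) (b : P.V B) (c : P.V C) : ∀ i, P.V (![A, B, C] i) := Fin.cons a (P.vec₂ b c)

/-- The family consisting of four elements. -/
def vec₄ (a : P.V A) (b : P.V B) (c : P.V C) (d : P.V D) : ∀ i, P.V (![A, B, C, D] i) :=
  Fin.cons a (P.vec₃ b c d)

/-- The family consisting of six elements. -/
def vec₆ (a : P.V A) (b : P.V B) (c : P.V C) (d : P.V D) (e : P.V E) (f : P.V F) :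
    ∀ i, P.V (![A, B, C, D, E, F] i) :=
  Fin.cons a (Fin.cons b (P.vec₄ c d e f))

end CStarPlanarAlgebra

namespace Code

variable (P : CStarPlanarAlgebra.{u}) {CT C₁ C₂ CU : Code} {n m K : ℕ} {b₀ : BoxType}
  {ε ε₁ ε₂ ε' : Bool}

/-- The action of the composite of two tangles, the first one having one input disc. -/
theorem Z_comp_one {b : Fin 1 → BoxType} {c : Fin n → BoxType}
    {hT : CT.Planar 1} {fT : CT.Fits (Equiv.refl _) ε b b₀}
    {hS : C₁.Planar n} {fS : C₁.Fits (Equiv.refl _) ε₁ c (b 0)}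
    {hU : CU.Planar n} {fU : CU.Fits (Equiv.refl _) ε' c b₀}
    (rT rS : List ℕ) (root : List (ℕ × ℕ))
    (hc : Composite CT (fun _ => C₁) CU (fun _ k => k) 1 (fun _ => n) rT (fun _ => rS) root)
    {u : ∀ i, P.V (b i)} {v : ∀ i, P.V (c i)} (hu : u 0 = P.Z (tangle hS fS) v) :
    P.Z (tangle hU fU) v = P.Z (tangle hT fT) u := by
  have fS' : ∀ i : Fin 1, C₁.Fits (Equiv.refl _) ε₁ c (b i) := fun i => by
    obtain rfl := Subsingleton.elim i 0
    exact fS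
  rw [Z_comp (CS := fun _ => C₁) (c := fun _ => c) P (fun _ => hS) fS'
    ((Equiv.sigmaEquivProd _ _).trans (Equiv.uniqueProd (Fin n) (Fin 1))) (fun _ => rfl)
    (fun _ _ => rfl) hc (fun _ _ => rfl) v (fun _ => v) (fun _ _ => HEq.rfl)]
  refine congrArg _ (funext fun i => ?_)
  obtain rfl := Subsingleton.elim i 0
  exact hu.symm

/-- The numbers of the discs of two tangles in the composite. -/
def blockNum (f₁ : Fin n → Fin K) (f₂ : Fin m → Fin K) (i k : ℕ) : ℕ :=
  if i = 1 then (if h : k - 1 < n then f₁ ⟨k - 1, h⟩ + 1 else 0)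
  else (if h : k - 1 < m then f₂ ⟨k - 1, h⟩ + 1 else 0)

variable (n m) in
/-- A sigma type over `Fin 2` is a sum. -/
def sigmaFinTwo : (Σ i, Fin (![n, m] i)) ≃ Fin n ⊕ Fin m where
  toFun
    | ⟨0, k⟩ => Sum.inl k
    | ⟨1, k⟩ => Sum.inr k
  invFun
    | Sum.inl k => ⟨0, k⟩
    | Sum.inr k => ⟨1, k⟩
  left_inv := by
    rintro ⟨i, k⟩
    obtain rfl | rfl : i = 0 ∨ i = 1 := by fin_cases i <;> simp
    · rfl
    · rfl
  right_inv := by rintro (k | k) <;> rfl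

/-- The action of the composite of tangles, the first one having two input discs. -/
theorem Z_comp_two {b : Fin 2 → BoxType} {c₁ : Fin n → BoxType} {c₂ : Fin m → BoxType}
    {d : Fin K → BoxType} {hT : CT.Planar 2} {fT : CT.Fits (Equiv.refl _) ε b b₀}
    {hS₁ : C₁.Planar n} {fS₁ : C₁.Fits (Equiv.refl _) ε₁ c₁ (b 0)}
    {hS₂ : C₂.Planar m} {fS₂ : C₂.Fits (Equiv.refl _) ε₂ c₂ (b 1)}
    {hU : CU.Planar K} {fU : CU.Fits (Equiv.refl _) ε' d b₀}
    (f₁ : Fin n → Fin K) (f₂ : Fin m → Fin K) (hf : Function.Bijective (Sum.elim f₁ f₂))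
    (rT rS₁ rS₂ : List ℕ) (root : List (ℕ × ℕ))
    (hc : Composite CT (fun i => if i = 1 then C₁ else C₂) CU (blockNum f₁ f₂) 2
      (fun i => if i = 0 then n else m) rT (fun i => if i = 1 then rS₁ else rS₂) root)
    (hd₁ : ∀ i, c₁ i = d (f₁ i)) (hd₂ : ∀ i, c₂ i = d (f₂ i))
    {u : ∀ i, P.V (b i)} {v : ∀ i, P.V (d i)} {w₁ : ∀ i, P.V (c₁ i)} {w₂ : ∀ i, P.V (c₂ i)}
    (hw₁ : ∀ i, HEq (w₁ i) (v (f₁ i))) (hw₂ : ∀ i, HEq (w₂ i) (v (f₂ i)))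
    (hu₁ : u 0 = P.Z (tangle hS₁ fS₁) w₁) (hu₂ : u 1 = P.Z (tangle hS₂ fS₂) w₂) :
    P.Z (tangle hU fU) v = P.Z (tangle hT fT) u := by
  let c : ∀ i, Fin (![n, m] i) → BoxType := Fin.cons c₁ (Fin.cons c₂ finZeroElim)
  let w : ∀ i j, P.V (c i j) := Fin.cons w₁ (Fin.cons w₂ finZeroElim)
  let CS : ℕ → Code := fun i => if i = 1 then C₁ else C₂
  have hS : ∀ i : Fin 2, (CS (i + 1)).Planar (![n, m] i) := Fin.forall_fin_two.2 ⟨hS₁, hS₂⟩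
  have fS : ∀ i : Fin 2, (CS (i + 1)).Fits (Equiv.refl _) (![ε₁, ε₂] i) (c i) (b i) :=
    Fin.forall_fin_two.2 ⟨fS₁, fS₂⟩
  have hdm : ∀ (i : Fin 2) (j : Fin (![n, m] i)), blockNum f₁ f₂ (i + 1) (j + 1) =
      ((sigmaFinTwo n m).trans (Equiv.ofBijective _ hf)) ⟨i, j⟩ + 1 := by
    refine Fin.forall_fin_two.2 ⟨?_, ?_⟩
    · rintro ⟨j, hj : j < n⟩
      simp [blockNum, hj, sigmaFinTwo]
    · rintro ⟨j, hj : j < m⟩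
      simp [blockNum, hj, sigmaFinTwo]
  rw [Z_comp (CS := CS) (c := c) P hS fS ((sigmaFinTwo n m).trans (Equiv.ofBijective _ hf))
    (Fin.forall_fin_two.2 ⟨rfl, rfl⟩) hdm hc (Fin.forall_fin_two.2 ⟨hd₁, hd₂⟩) v w
    (Fin.forall_fin_two.2 ⟨hw₁, hw₂⟩)]
  refine congrArg _ (funext fun i => ?_)
  revert i
  exact Fin.forall_fin_two.2 ⟨hu₁.symm, hu₂.symm⟩

/-- The action of the mirror image of a tangle. -/
theorem star_Z {C C' : Code} {b : Fin n → BoxType} {hC : C.Planar n}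
    {h : C.Fits (Equiv.refl _) ε b b₀} {hC' : C'.Planar n} {h' : C'.Fits (Equiv.refl _) ε b b₀}
    (hm : Mirror C C' n) (v : ∀ i, P.V (b i)) :
    star (P.Z (tangle hC h) v) = P.Z (tangle hC' h') (fun i => star (v i)) :=
  P.Z_star _ _ (tangleReflection hC h hC' h' hm) v

end Code
end PFPlanar

/-! ### The codes of the tangles in use, and their actions -/

namespace PFPlanar

namespace Code

/-- The code of a vertical string. -/
def oneCode₁ : Code where
  strand := [[(0, 1), (0, 0)]]
  label := [[0, 1, 0]]
  shade := [false, true]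
  rep := [(0, 0), (0, 1)]

theorem oneCode₁_planar : oneCode₁.Planar 0 := by decide +kernel

theorem oneCode₁_fits (ε : Bool) : oneCode₁.Fits (Equiv.refl _) ε ![] ⟨1, ε⟩ := by
  revert ε
  decide +kernel

/-- The code of two vertical strings. -/
def oneCode₂ : Code where
  strand := [[(0, 3), (0, 2), (0, 1), (0, 0)]]
  label := [[0, 1, 2, 1, 0]]
  shade := [false, true, false]
  rep := [(0, 0), (0, 1), (0, 2)]

theorem oneCode₂_planar : oneCode₂.Planar 0 := by decide +kernel

theorem oneCode₂_fits (ε : Bool) : oneCode₂.Fits (Equiv.refl _) ε ![] ⟨2, ε⟩ := by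
  revert ε
  decide +kernel

/-- The code of the identity tangle of `1`-boxes. -/
def idCode₁ : Code where
  strand := [[(1, 0), (1, 1)], [(0, 0), (0, 1)]]
  label := [[0, 1, 0], [0, 1, 0]]
  shade := [false, true]
  rep := [(0, 0), (0, 1)]

theorem idCode₁_planar : idCode₁.Planar 1 := by decide +kernel

theorem idCode₁_fits (ε : Bool) : idCode₁.Fits (Equiv.refl _) ε ![⟨1, ε⟩] ⟨1, ε⟩ := by
  revert ε
  decide +kernel

/-- The code of the identity tangle of `2`-boxes. -/
def idCode₂ : Code where
  strand := [[(1, 0), (1, 1), (1, 2), (1, 3)], [(0, 0), (0, 1), (0, 2), (0, 3)]]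
  label := [[0, 1, 2, 3, 0], [0, 1, 2, 3, 0]]
  shade := [false, true, false, true]
  rep := [(0, 0), (0, 1), (0, 2), (0, 3)]

theorem idCode₂_planar : idCode₂.Planar 1 := by decide +kernel

theorem idCode₂_fits (ε : Bool) : idCode₂.Fits (Equiv.refl _) ε ![⟨2, ε⟩] ⟨2, ε⟩ := by
  revert ε
  decide +kernel

/-- The code of the product of `1`-boxes. -/
def mulCode₁ : Code where
  strand := [[(2, 0), (1, 1)], [(2, 1), (0, 1)], [(0, 0), (1, 0)]]
  label := [[0, 1, 0], [0, 1, 0], [0, 1, 0]]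
  shade := [false, true]
  rep := [(0, 0), (0, 1)]

theorem mulCode₁_planar : mulCode₁.Planar 2 := by decide +kernel

theorem mulCode₁_fits (ε : Bool) : mulCode₁.Fits (Equiv.refl _) ε ![⟨1, ε⟩, ⟨1, ε⟩] ⟨1, ε⟩ := by
  revert ε
  decide +kernel

/-- The code of the product of `2`-boxes. -/
def mulCode₂ : Code where
  strand := [[(2, 0), (2, 1), (1, 2), (1, 3)], [(2, 3), (2, 2), (0, 2), (0, 3)], [(0, 0), (0, 1),
    (1, 1), (1, 0)]]
  label := [[0, 1, 2, 3, 0], [0, 4, 2, 3, 0], [0, 1, 2, 4, 0]]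
  shade := [false, true, false, true, true]
  rep := [(0, 0), (0, 1), (0, 2), (0, 3), (1, 1)]

theorem mulCode₂_planar : mulCode₂.Planar 2 := by decide +kernel

theorem mulCode₂_fits (ε : Bool) : mulCode₂.Fits (Equiv.refl _) ε ![⟨2, ε⟩, ⟨2, ε⟩] ⟨2, ε⟩ := by
  revert ε
  decide +kernel

/-- The code of the rotation of `1`-boxes. -/
def barCode : Code where
  strand := [[(1, 1), (1, 0)], [(0, 1), (0, 0)]]
  label := [[1, 0, 1], [0, 1, 0]]
  shade := [false, true]
  rep := [(0, 1), (0, 0)]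

theorem barCode_planar : barCode.Planar 1 := by decide +kernel

theorem barCode_fits (ε : Bool) : barCode.Fits (Equiv.refl _) ε ![⟨1, ε⟩] ⟨1, !ε⟩ := by
  revert ε
  decide +kernel

/-- The code of the Fourier transform. -/
def fourierCode : Code where
  strand := [[(1, 3), (1, 0), (1, 1), (1, 2)], [(0, 1), (0, 2), (0, 3), (0, 0)]]
  label := [[3, 0, 1, 2, 3], [0, 1, 2, 3, 0]]
  shade := [false, true, false, true]
  rep := [(0, 1), (0, 2), (0, 3), (0, 0)]

theorem fourierCode_planar : fourierCode.Planar 1 := by decide +kernel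

theorem fourierCode_fits (ε : Bool) : fourierCode.Fits (Equiv.refl _) ε ![⟨2, ε⟩] ⟨2, !ε⟩ := by
  revert ε
  decide +kernel

/-- The code of a `1`-box with a string on its right. -/
def onLeftCode : Code where
  strand := [[(1, 0), (0, 2), (0, 1), (1, 1)], [(0, 0), (0, 3)]]
  label := [[0, 1, 2, 1, 0], [0, 1, 0]]
  shade := [false, true, false]
  rep := [(0, 0), (0, 1), (0, 2)]

theorem onLeftCode_planar : onLeftCode.Planar 1 := by decide +kernel

theorem onLeftCode_fits (ε : Bool) : onLeftCode.Fits (Equiv.refl _) ε ![⟨1, ε⟩] ⟨2, ε⟩ := by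
  revert ε
  decide +kernel

/-- The code of a `1`-box with a string on its left. -/
def onRightCode : Code where
  strand := [[(0, 3), (1, 0), (1, 1), (0, 0)], [(0, 1), (0, 2)]]
  label := [[0, 1, 2, 1, 0], [1, 2, 1]]
  shade := [false, true, false]
  rep := [(0, 0), (0, 1), (0, 2)]

theorem onRightCode_planar : onRightCode.Planar 1 := by decide +kernel

theorem onRightCode_fits (ε : Bool) : onRightCode.Fits (Equiv.refl _) ε ![⟨1, !ε⟩] ⟨2, ε⟩ := by
  revert ε
  decide +kernel

/-- The code of the convolution. -/
def convCode : Code where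
  strand := [[(2, 1), (2, 2)], [(2, 0), (2, 3)], [(1, 0), (0, 0), (0, 1), (1, 1)]]
  label := [[0, 2, 0], [0, 1, 0], [1, 0, 2, 0, 1]]
  shade := [false, true, true]
  rep := [(0, 0), (1, 1), (0, 1)]

theorem convCode_planar : convCode.Planar 2 := by decide +kernel

theorem convCode_fits (ε : Bool) : convCode.Fits (Equiv.refl _) ε ![⟨1, ε⟩, ⟨2, !ε⟩] ⟨1, ε⟩ := by
  revert ε
  decide +kernel

/-- The code of the trace tangle of `1`-boxes. -/
def traceCode₁ : Code where
  strand := [[], [(1, 1), (1, 0)]]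
  label := [[0], [0, 1, 0]]
  shade := [false, true]
  rep := [(1, 0), (1, 1)]

theorem traceCode₁_planar : traceCode₁.Planar 1 := by decide +kernel

theorem traceCode₁_fits (ε : Bool) : traceCode₁.Fits (Equiv.refl _) ε ![⟨1, ε⟩] ⟨0, ε⟩ := by
  revert ε
  decide +kernel

/-- The code of the trace tangle of `2`-boxes. -/
def traceCode₂ : Code where
  strand := [[], [(1, 3), (1, 2), (1, 1), (1, 0)]]
  label := [[0], [0, 1, 2, 1, 0]]
  shade := [false, true, false]
  rep := [(1, 0), (1, 1), (1, 2)]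

theorem traceCode₂_planar : traceCode₂.Planar 1 := by decide +kernel

theorem traceCode₂_fits (ε : Bool) : traceCode₂.Fits (Equiv.refl _) ε ![⟨2, ε⟩] ⟨0, ε⟩ := by
  revert ε
  decide +kernel

/-- The rotation of `2`-boxes by `180°`. -/
def halfTurnCode : Code where
  strand := [[(1, 2), (1, 3), (1, 0), (1, 1)], [(0, 2), (0, 3), (0, 0), (0, 1)]]
  label := [[2, 3, 0, 1, 2], [0, 1, 2, 3, 0]]
  shade := [false, true, false, true]
  rep := [(0, 2), (0, 3), (0, 0), (0, 1)]

theorem halfTurnCode_planar : halfTurnCode.Planar 1 := by decide +kernel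

theorem halfTurnCode_fits (ε : Bool) : halfTurnCode.Fits (Equiv.refl _) ε ![⟨2, ε⟩] ⟨2, ε⟩ := by
  revert ε
  decide +kernel

/-- The Fourier transform of `2`-boxes with the opposite shading. -/
def fourierCode₂ : Code where
  strand := [[(1, 3), (1, 0), (1, 1), (1, 2)], [(0, 1), (0, 2), (0, 3), (0, 0)]]
  label := [[3, 0, 1, 2, 3], [0, 1, 2, 3, 0]]
  shade := [true, false, true, false]
  rep := [(0, 1), (0, 2), (0, 3), (0, 0)]

theorem fourierCode₂_planar : fourierCode₂.Planar 1 := by decide +kernel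

theorem fourierCode₂_fits (ε : Bool) : fourierCode₂.Fits (Equiv.refl _) ε ![⟨2, !ε⟩] ⟨2, ε⟩ := by
  revert ε
  decide +kernel

/-- The counterclockwise rotation of `2`-boxes by `90°`. -/
def fourierInvCode : Code where
  strand := [[(1, 1), (1, 2), (1, 3), (1, 0)], [(0, 3), (0, 0), (0, 1), (0, 2)]]
  label := [[3, 2, 1, 0, 3], [0, 3, 2, 1, 0]]
  shade := [false, true, false, true]
  rep := [(0, 3), (0, 2), (0, 1), (0, 0)]

theorem fourierInvCode_planar : fourierInvCode.Planar 1 := by decide +kernel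

theorem fourierInvCode_fits (ε : Bool) : fourierInvCode.Fits (Equiv.refl _) ε ![⟨2, ε⟩] ⟨2, !ε⟩ :=
    by
  revert ε
  decide +kernel

/-- A `2`-box (disc `2`) whose lower left string is joined to the bottom of a `1`-box (disc `1`) on
its left and whose lower right string is joined to the top of a `1`-box (disc `3`) on its right. -/
def tripleCode : Code where
  strand := [[(1, 0), (2, 0), (2, 1), (3, 1)], [(0, 0), (2, 3)], [(0, 1), (0, 2), (3, 0), (1, 1)],
    [(2, 2), (0, 3)]]
  label := [[0, 1, 2, 3, 0], [0, 1, 0], [1, 2, 3, 0, 1], [0, 3, 0]]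
  shade := [false, true, false, true]
  rep := [(0, 0), (0, 1), (0, 2), (0, 3)]

theorem tripleCode_planar : tripleCode.Planar 3 := by decide +kernel

theorem tripleCode_fits (ε : Bool) : tripleCode.Fits (Equiv.refl _) ε ![⟨1, ε⟩, ⟨2, !ε⟩, ⟨1, ε⟩]
    ⟨2, ε⟩ := by
  revert ε
  decide +kernel

/-- The mirror image of `tripleCode`. -/
def tripleMirrorCode : Code where
  strand := [[(3, 0), (2, 2), (2, 3), (1, 1)], [(2, 0), (0, 3)], [(1, 0), (3, 1), (0, 1), (0, 2)],
    [(0, 0), (2, 1)]]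
  label := [[0, 3, 2, 1, 0], [0, 1, 0], [1, 0, 3, 2, 1], [0, 3, 0]]
  shade := [false, true, false, true]
  rep := [(0, 0), (0, 3), (0, 2), (0, 1)]

theorem tripleMirrorCode_planar : tripleMirrorCode.Planar 3 := by decide +kernel

theorem tripleMirrorCode_fits (ε : Bool) : tripleMirrorCode.Fits (Equiv.refl _) ε ![⟨1, ε⟩, ⟨2,
    !ε⟩, ⟨1, ε⟩] ⟨2, ε⟩ := by
  revert ε
  decide +kernel

/-- Two `1`-boxes on a string, with a string on their right. -/
def onLeftMulCode : Code where
  strand := [[(2, 0), (0, 2), (0, 1), (1, 1)], [(2, 1), (0, 3)], [(0, 0), (1, 0)]]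
  label := [[0, 1, 2, 1, 0], [0, 1, 0], [0, 1, 0]]
  shade := [false, true, false]
  rep := [(0, 0), (0, 1), (0, 2)]

theorem onLeftMulCode_planar : onLeftMulCode.Planar 2 := by decide +kernel

theorem onLeftMulCode_fits (ε : Bool) : onLeftMulCode.Fits (Equiv.refl _) ε ![⟨1, ε⟩, ⟨1, ε⟩] ⟨2,
    ε⟩ := by
  revert ε
  decide +kernel

/-- The rotation by `180°` of a product of `2`-boxes. -/
def halfTurnMulCode : Code where
  strand := [[(1, 2), (1, 3), (2, 0), (2, 1)], [(2, 3), (2, 2), (0, 0), (0, 1)], [(0, 2), (0, 3),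
    (1, 1), (1, 0)]]
  label := [[0, 1, 2, 3, 0], [2, 4, 0, 1, 2], [2, 3, 0, 4, 2]]
  shade := [false, true, false, true, true]
  rep := [(0, 0), (0, 1), (0, 2), (0, 3), (1, 1)]

theorem halfTurnMulCode_planar : halfTurnMulCode.Planar 2 := by decide +kernel

theorem halfTurnMulCode_fits (ε : Bool) : halfTurnMulCode.Fits (Equiv.refl _) ε ![⟨2, ε⟩, ⟨2, ε⟩]
    ⟨2, ε⟩ := by
  revert ε
  decide +kernel

/-- The rotation by `180°` of a `1`-box with a string on its right. -/
def halfTurnOnLeftCode : Code where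
  strand := [[(0, 3), (1, 1), (1, 0), (0, 0)], [(0, 2), (0, 1)]]
  label := [[0, 1, 2, 1, 0], [2, 1, 2]]
  shade := [false, true, false]
  rep := [(0, 0), (0, 1), (0, 2)]

theorem halfTurnOnLeftCode_planar : halfTurnOnLeftCode.Planar 1 := by decide +kernel

theorem halfTurnOnLeftCode_fits (ε : Bool) : halfTurnOnLeftCode.Fits (Equiv.refl _) ε ![⟨1, ε⟩]
    ⟨2, ε⟩ := by
  revert ε
  decide +kernel

/-- The convolution of a `1`-box with the Fourier transform of a `2`-box. -/
def convFourierCode : Code where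
  strand := [[(2, 0), (2, 1)], [(2, 3), (2, 2)], [(0, 0), (0, 1), (1, 1), (1, 0)]]
  label := [[0, 1, 0], [0, 2, 0], [0, 1, 0, 2, 0]]
  shade := [false, true, true]
  rep := [(0, 0), (0, 1), (1, 1)]

theorem convFourierCode_planar : convFourierCode.Planar 2 := by decide +kernel

theorem convFourierCode_fits (ε : Bool) : convFourierCode.Fits (Equiv.refl _) ε ![⟨1, ε⟩, ⟨2, ε⟩]
    ⟨1, ε⟩ := by
  revert ε
  decide +kernel

/-- The product of a `1`-box on the left string and a `2`-box. -/
def leftMulCode : Code where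
  strand := [[(2, 0), (2, 1), (2, 2), (1, 1)], [(2, 3), (0, 3)], [(0, 0), (0, 1), (0, 2), (1, 0)]]
  label := [[0, 1, 2, 3, 0], [0, 3, 0], [0, 1, 2, 3, 0]]
  shade := [false, true, false, true]
  rep := [(0, 0), (0, 1), (0, 2), (0, 3)]

theorem leftMulCode_planar : leftMulCode.Planar 2 := by decide +kernel

theorem leftMulCode_fits (ε : Bool) : leftMulCode.Fits (Equiv.refl _) ε ![⟨1, ε⟩, ⟨2, ε⟩] ⟨2, ε⟩
    := by
  revert ε
  decide +kernel

/-- The product of a `2`-box and a `1`-box on the left string. -/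
def rightMulCode : Code where
  strand := [[(2, 0), (1, 1), (1, 2), (1, 3)], [(2, 1), (0, 1), (0, 2), (0, 3)], [(0, 0), (1, 0)]]
  label := [[0, 1, 2, 3, 0], [0, 1, 2, 3, 0], [0, 1, 0]]
  shade := [false, true, false, true]
  rep := [(0, 0), (0, 1), (0, 2), (0, 3)]

theorem rightMulCode_planar : rightMulCode.Planar 2 := by decide +kernel

theorem rightMulCode_fits (ε : Bool) : rightMulCode.Fits (Equiv.refl _) ε ![⟨2, ε⟩, ⟨1, ε⟩] ⟨2, ε⟩
    := by
  revert ε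
  decide +kernel

/-- The convolution of a product of `1`-boxes with the Fourier transform of a `2`-box. -/
def convLeftCode : Code where
  strand := [[(3, 0), (3, 1)], [(2, 1), (3, 2)], [(3, 3), (1, 0)], [(0, 0), (0, 1), (1, 1), (2,
    0)]]
  label := [[0, 1, 0], [0, 2, 0], [0, 2, 0], [0, 1, 0, 2, 0]]
  shade := [false, true, true]
  rep := [(0, 0), (0, 1), (1, 1)]

theorem convLeftCode_planar : convLeftCode.Planar 3 := by decide +kernel

theorem convLeftCode_fits (ε : Bool) : convLeftCode.Fits (Equiv.refl _) ε ![⟨1, ε⟩, ⟨1, ε⟩, ⟨2,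
    ε⟩] ⟨1, ε⟩ := by
  revert ε
  decide +kernel

/-- The product of `convFourierCode` and a `1`-box. -/
def convRightCode : Code where
  strand := [[(3, 0), (2, 1)], [(2, 3), (2, 2)], [(3, 1), (0, 1), (1, 1), (1, 0)], [(0, 0), (2,
    0)]]
  label := [[0, 1, 0], [0, 2, 0], [0, 1, 0, 2, 0], [0, 1, 0]]
  shade := [false, true, true]
  rep := [(0, 0), (0, 1), (1, 1)]

theorem convRightCode_planar : convRightCode.Planar 3 := by decide +kernel

theorem convRightCode_fits (ε : Bool) : convRightCode.Fits (Equiv.refl _) ε ![⟨1, ε⟩, ⟨2, ε⟩, ⟨1,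
    ε⟩] ⟨1, ε⟩ := by
  revert ε
  decide +kernel

/-- The convolution of a product of `1`-boxes with a product of `2`-boxes. -/
def convMulCode : Code where
  strand := [[(4, 1), (3, 2)], [(2, 1), (3, 3)], [(4, 0), (1, 0)], [(4, 3), (4, 2), (0, 1), (1,
    1)], [(2, 0), (0, 0), (3, 1), (3, 0)]]
  label := [[0, 1, 0], [0, 2, 0], [0, 2, 0], [2, 3, 1, 0, 2], [2, 0, 1, 3, 2]]
  shade := [false, true, true, false]
  rep := [(0, 0), (0, 1), (1, 1), (3, 1)]

theorem convMulCode_planar : convMulCode.Planar 4 := by decide +kernel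

theorem convMulCode_fits (ε : Bool) : convMulCode.Fits (Equiv.refl _) ε ![⟨1, ε⟩, ⟨1, ε⟩, ⟨2, !ε⟩,
    ⟨2, !ε⟩] ⟨1, ε⟩ := by
  revert ε
  decide +kernel

/-- The product of `convMulCode` and a product of `1`-boxes. -/
def convMulMulCode : Code where
  strand := [[(6, 0), (3, 2)], [(2, 1), (3, 3)], [(4, 0), (1, 0)], [(4, 3), (4, 2), (0, 1), (1,
    1)], [(2, 0), (5, 1), (3, 1), (3, 0)], [(6, 1), (4, 1)], [(0, 0), (5, 0)]]
  label := [[0, 1, 0], [0, 2, 0], [0, 2, 0], [2, 3, 1, 0, 2], [2, 0, 1, 3, 2], [0, 1, 0], [0, 1,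
    0]]
  shade := [false, true, true, false]
  rep := [(0, 0), (0, 1), (1, 1), (3, 1)]

theorem convMulMulCode_planar : convMulMulCode.Planar 6 := by decide +kernel

theorem convMulMulCode_fits (ε : Bool) : convMulMulCode.Fits (Equiv.refl _) ε ![⟨1, ε⟩, ⟨1, ε⟩,
    ⟨2, !ε⟩, ⟨2, !ε⟩, ⟨1, ε⟩, ⟨1, ε⟩] ⟨1, ε⟩ := by
  revert ε
  decide +kernel

/-- The closure of `convMulMulCode`. -/
def traceConvCode : Code where
  strand := [[], [(2, 1), (3, 3)], [(4, 0), (1, 0)], [(4, 3), (4, 2), (6, 0), (1, 1)], [(2, 0),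
    (5, 1), (3, 1), (3, 0)], [(6, 1), (4, 1)], [(3, 2), (5, 0)]]
  label := [[0], [0, 1, 0], [0, 1, 0], [1, 2, 3, 0, 1], [1, 0, 3, 2, 1], [0, 3, 0], [0, 3, 0]]
  shade := [false, true, false, true]
  rep := [(1, 0), (1, 1), (3, 1), (3, 2)]

theorem traceConvCode_planar : traceConvCode.Planar 6 := by decide +kernel

theorem traceConvCode_fits (ε : Bool) : traceConvCode.Fits (Equiv.refl _) ε ![⟨1, ε⟩, ⟨1, ε⟩, ⟨2,
    !ε⟩, ⟨2, !ε⟩, ⟨1, ε⟩, ⟨1, ε⟩] ⟨0, ε⟩ := by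
  revert ε
  decide +kernel

/-- The product of `tripleCode` and its mirror image. -/
def tripleMulCode : Code where
  strand := [[(5, 0), (4, 2), (3, 1), (6, 1)], [(2, 1), (3, 3)], [(4, 0), (1, 0)], [(4, 3), (0,
    2), (6, 0), (1, 1)], [(2, 0), (5, 1), (0, 1), (3, 0)], [(0, 0), (4, 1)], [(3, 2), (0, 3)]]
  label := [[0, 1, 2, 3, 0], [0, 4, 0], [0, 4, 0], [4, 2, 3, 0, 4], [4, 0, 1, 2, 4], [0, 1, 0],
    [0, 3, 0]]
  shade := [false, true, false, true, true]
  rep := [(0, 0), (0, 1), (0, 2), (0, 3), (1, 1)]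

theorem tripleMulCode_planar : tripleMulCode.Planar 6 := by decide +kernel

theorem tripleMulCode_fits (ε : Bool) : tripleMulCode.Fits (Equiv.refl _) ε ![⟨1, ε⟩, ⟨1, ε⟩, ⟨2,
    !ε⟩, ⟨2, !ε⟩, ⟨1, ε⟩, ⟨1, ε⟩] ⟨2, ε⟩ := by
  revert ε
  decide +kernel

/-- The code describes the tangle, if the discs and the regions are numbered by `e` and `g`. -/
def Describes {ι : Type} {k : ℕ} (C : Code) (e : ι ≃ Fin k) {b : ι → BoxType} {b₀ : BoxType}
    (T : PlanarTangle b b₀) (g : T.Region → ℕ) : Prop :=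
  (∀ a, g (T.reg a) = C.lab (num e a.1) a.2) ∧
  ∀ p, num e (T.strand p).1 = (C.pt (num e p.1) p.2).1 ∧
    (T.strand p).2.1 = (C.pt (num e p.1) p.2).2

/-- The numbering of the only disc of a tangle. -/
def unitEquiv : Unit ≃ Fin 1 where
  toFun _ := 0
  invFun _ := ()
  left_inv _ := rfl
  right_inv _ := Subsingleton.elim _ _

variable (P : CStarPlanarAlgebra.{u}) {ε : Bool}

/-- A numbering of the regions of the multiplication tangles. -/
def mulRegionNum (n : ℕ) : Bool ⊕ Fin 3 × Fin n → ℕ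
  | .inl false => 0
  | .inl true => n + 1
  -- In `mulCode₂` the number 4 is the region enclosed between the two factors, which is the middle
  -- level; 1 and 3 are the regions at the top and the bottom. In `mulCode₁` no such regions occur.
  | .inr (l, _) => ![1, 4, 3] l

/-- Code and tangle have the same strings and regions under an explicit numbering, which is a finite
check for each shading; isotopy invariance then identifies their actions. The other tangles of the
definitions are treated in the same way. -/
theorem Z_oneCode₁ (v) : P.Z (tangle oneCode₁_planar (oneCode₁_fits ε)) v = 1 := by
  have : IsEmpty (oneTangle ⟨1, ε⟩).Loop := inferInstanceAs (IsEmpty Empty)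
  rw [← P.Z_one ⟨1, ε⟩ (fun i => i.elim)]
  have h : ∀ ε, Describes oneCode₁ (Equiv.equivOfIsEmpty Empty (Fin 0)) (oneTangle ⟨1, ε⟩)
    (fun l : Fin 2 => l.1) := by
    unfold Describes
    decide +kernel
  exact Z_tangle (e := Equiv.equivOfIsEmpty Empty (Fin 0)) P oneCode₁_planar (oneCode₁_fits ε) (fun
    i => i.elim)
    (oneTangle ⟨1, ε⟩) (fun l : Fin 2 => l.1) Fin.val_injective (fun l : Fin 2 => l.2) (h ε).1 (h
      ε).2 _ _
    (fun i => i.elim)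

theorem Z_idCode₁ (x : P.V ⟨1, ε⟩) : P.Z (tangle idCode₁_planar (idCode₁_fits ε)) (P.vec₁ x) = x :=
    by
  have : IsEmpty (idTangle ⟨1, ε⟩).Loop := inferInstanceAs (IsEmpty Empty)
  have h : ∀ ε, Describes idCode₁ unitEquiv (idTangle ⟨1, ε⟩) (fun l : Fin 2 => l.1) := by
    unfold Describes
    decide +kernel
  exact (Z_tangle (e := unitEquiv) (w := fun _ => x) P idCode₁_planar (idCode₁_fits ε) (fun _ =>
    rfl) (idTangle ⟨1, ε⟩)
    (fun l : Fin 2 => l.1) Fin.val_injective (fun l : Fin 2 => l.2) (h ε).1 (h ε).2 _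
    (fun _ => HEq.rfl)).trans (P.Z_id ⟨1, ε⟩ (fun _ => x))

theorem Z_mulCode₁ (x y : P.V ⟨1, ε⟩) :
    P.Z (tangle mulCode₁_planar (mulCode₁_fits ε)) (P.vec₂ x y) = x * y := by
  have : IsEmpty (mulTangle ⟨1, ε⟩).Loop := inferInstanceAs (IsEmpty Empty)
  have h : ∀ ε, Describes mulCode₁ (Equiv.refl _) (mulTangle ⟨1, ε⟩) (mulRegionNum 0) := by
    unfold Describes
    decide +kernel
  exact (Z_tangle (e := Equiv.refl _) (b' := fun _ => ⟨1, ε⟩) (w := ![x, y]) P mulCode₁_planar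
    (mulCode₁_fits ε) (Fin.forall_fin_two.2 ⟨rfl, rfl⟩)
    (mulTangle ⟨1, ε⟩) (mulRegionNum 0)
    (by change Function.Injective (mulRegionNum 0); decide)
    (by change ∀ r : Bool ⊕ Fin 3 × Fin 0, (mulRegionNum 0) r < 2; decide) (h ε).1 (h ε).2 _
    (Fin.forall_fin_two.2 ⟨HEq.rfl, HEq.rfl⟩)).trans (P.Z_mul ⟨1, ε⟩ ![x, y])

theorem Z_traceCode₁ (x : P.V ⟨1, ε⟩) : P.Z (tangle traceCode₁_planar (traceCode₁_fits ε)) (P.vec₁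
    x) =
    P.Z (traceTangle ⟨1, ε⟩) (fun _ => x) := by
  have : IsEmpty (traceTangle ⟨1, ε⟩).Loop := inferInstanceAs (IsEmpty Empty)
  have h : ∀ ε, Describes traceCode₁ unitEquiv (traceTangle ⟨1, ε⟩) (fun l : Fin 2 => l.1) := by
    unfold Describes
    decide +kernel
  exact Z_tangle (e := unitEquiv) (b' := fun _ => ⟨1, ε⟩) (w := fun _ => x) P traceCode₁_planar
    (traceCode₁_fits ε) (fun _ => rfl) (traceTangle ⟨1, ε⟩)
    (fun l : Fin 2 => l.1) Fin.val_injective (fun l : Fin 2 => l.2) (h ε).1 (h ε).2 _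
    (fun _ => HEq.rfl)

theorem Z_oneCode₂ (v) : P.Z (tangle oneCode₂_planar (oneCode₂_fits ε)) v = 1 := by
  have : IsEmpty (oneTangle ⟨2, ε⟩).Loop := inferInstanceAs (IsEmpty Empty)
  rw [← P.Z_one ⟨2, ε⟩ (fun i => i.elim)]
  have h : ∀ ε, Describes oneCode₂ (Equiv.equivOfIsEmpty Empty (Fin 0)) (oneTangle ⟨2, ε⟩)
    (fun l : Fin 3 => l.1) := by
    unfold Describes
    decide +kernel
  exact Z_tangle (e := Equiv.equivOfIsEmpty Empty (Fin 0)) P oneCode₂_planar (oneCode₂_fits ε) (fun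
    i => i.elim)
    (oneTangle ⟨2, ε⟩) (fun l : Fin 3 => l.1) Fin.val_injective (fun l : Fin 3 => l.2) (h ε).1 (h
      ε).2 _ _
    (fun i => i.elim)

theorem Z_idCode₂ (x : P.V ⟨2, ε⟩) : P.Z (tangle idCode₂_planar (idCode₂_fits ε)) (P.vec₁ x) = x :=
    by
  have : IsEmpty (idTangle ⟨2, ε⟩).Loop := inferInstanceAs (IsEmpty Empty)
  have h : ∀ ε, Describes idCode₂ unitEquiv (idTangle ⟨2, ε⟩) (fun l : Fin 4 => l.1) := by
    unfold Describes
    decide +kernel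
  exact (Z_tangle (e := unitEquiv) (w := fun _ => x) P idCode₂_planar (idCode₂_fits ε) (fun _ =>
    rfl) (idTangle ⟨2, ε⟩)
    (fun l : Fin 4 => l.1) Fin.val_injective (fun l : Fin 4 => l.2) (h ε).1 (h ε).2 _
    (fun _ => HEq.rfl)).trans (P.Z_id ⟨2, ε⟩ (fun _ => x))

theorem Z_mulCode₂ (x y : P.V ⟨2, ε⟩) :
    P.Z (tangle mulCode₂_planar (mulCode₂_fits ε)) (P.vec₂ x y) = x * y := by
  have : IsEmpty (mulTangle ⟨2, ε⟩).Loop := inferInstanceAs (IsEmpty Empty)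
  have h : ∀ ε, Describes mulCode₂ (Equiv.refl _) (mulTangle ⟨2, ε⟩) (mulRegionNum 1) := by
    unfold Describes
    decide +kernel
  exact (Z_tangle (e := Equiv.refl _) (b' := fun _ => ⟨2, ε⟩) (w := ![x, y]) P mulCode₂_planar
    (mulCode₂_fits ε) (Fin.forall_fin_two.2 ⟨rfl, rfl⟩)
    (mulTangle ⟨2, ε⟩) (mulRegionNum 1)
    (by change Function.Injective (mulRegionNum 1); decide)
    (by change ∀ r : Bool ⊕ Fin 3 × Fin 1, (mulRegionNum 1) r < 5; decide) (h ε).1 (h ε).2 _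
    (Fin.forall_fin_two.2 ⟨HEq.rfl, HEq.rfl⟩)).trans (P.Z_mul ⟨2, ε⟩ ![x, y])

theorem Z_traceCode₂ (x : P.V ⟨2, ε⟩) : P.Z (tangle traceCode₂_planar (traceCode₂_fits ε)) (P.vec₁
    x) =
    P.Z (traceTangle ⟨2, ε⟩) (fun _ => x) := by
  have : IsEmpty (traceTangle ⟨2, ε⟩).Loop := inferInstanceAs (IsEmpty Empty)
  have h : ∀ ε, Describes traceCode₂ unitEquiv (traceTangle ⟨2, ε⟩) (fun l : Fin 3 => l.1) := by
    unfold Describes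
    decide +kernel
  exact Z_tangle (e := unitEquiv) (b' := fun _ => ⟨2, ε⟩) (w := fun _ => x) P traceCode₂_planar
    (traceCode₂_fits ε) (fun _ => rfl) (traceTangle ⟨2, ε⟩)
    (fun l : Fin 3 => l.1) Fin.val_injective (fun l : Fin 3 => l.2) (h ε).1 (h ε).2 _
    (fun _ => HEq.rfl)

theorem Z_barCode (x : P.V ⟨1, ε⟩) : P.Z (tangle barCode_planar (barCode_fits ε)) (P.vec₁ x) =
    P.bar x := by
  have : IsEmpty (barTangle ε).Loop := inferInstanceAs (IsEmpty Empty)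
  have h : ∀ ε, Describes barCode unitEquiv (barTangle ε) (fun l : Fin 2 => l.1) := by
    unfold Describes
    decide +kernel
  exact Z_tangle (e := unitEquiv) (b' := fun _ => ⟨1, ε⟩) (w := fun _ => x) P barCode_planar
    (barCode_fits ε) (fun _ => rfl) (barTangle ε)
    (fun l : Fin 2 => l.1) Fin.val_injective (fun l : Fin 2 => l.2) (h ε).1 (h ε).2 _
    (fun _ => HEq.rfl)

theorem Z_fourierCode (x : P.V ⟨2, ε⟩) : P.Z (tangle fourierCode_planar (fourierCode_fits ε))
    (P.vec₁ x) = P.fourier x := by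
  have : IsEmpty (fourierTangle ε).Loop := inferInstanceAs (IsEmpty Empty)
  have h : ∀ ε, Describes fourierCode unitEquiv (fourierTangle ε) (fun l : Fin 4 => l.1) := by
    unfold Describes
    decide +kernel
  exact Z_tangle (e := unitEquiv) (b' := fun _ => ⟨2, ε⟩) (w := fun _ => x) P fourierCode_planar
    (fourierCode_fits ε) (fun _ => rfl) (fourierTangle ε)
    (fun l : Fin 4 => l.1) Fin.val_injective (fun l : Fin 4 => l.2) (h ε).1 (h ε).2 _
    (fun _ => HEq.rfl)

theorem Z_onLeftCode (x : P.V ⟨1, ε⟩) : P.Z (tangle onLeftCode_planar (onLeftCode_fits ε)) (P.vec₁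
    x) = P.onLeft x := by
  have : IsEmpty (rightStringTangle ε).Loop := inferInstanceAs (IsEmpty Empty)
  have h : ∀ ε, Describes onLeftCode unitEquiv (rightStringTangle ε) (fun l : Fin 3 => l.1) := by
    unfold Describes
    decide +kernel
  exact Z_tangle (e := unitEquiv) (b' := fun _ => ⟨1, ε⟩) (w := fun _ => x) P onLeftCode_planar
    (onLeftCode_fits ε) (fun _ => rfl) (rightStringTangle ε)
    (fun l : Fin 3 => l.1) Fin.val_injective (fun l : Fin 3 => l.2) (h ε).1 (h ε).2 _
    (fun _ => HEq.rfl)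

theorem Z_onRightCode (x : P.V ⟨1, !ε⟩) : P.Z (tangle onRightCode_planar (onRightCode_fits ε))
    (P.vec₁ x) = P.onRight x := by
  have : IsEmpty (leftStringTangle ε).Loop := inferInstanceAs (IsEmpty Empty)
  have h : ∀ ε, Describes onRightCode unitEquiv (leftStringTangle ε) (fun l : Fin 3 => l.1) := by
    unfold Describes
    decide +kernel
  exact Z_tangle (e := unitEquiv) (b' := fun _ => ⟨1, !ε⟩) (w := fun _ => x) P onRightCode_planar
    (onRightCode_fits ε) (fun _ => rfl) (leftStringTangle ε)
    (fun l : Fin 3 => l.1) Fin.val_injective (fun l : Fin 3 => l.2) (h ε).1 (h ε).2 _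
    (fun _ => HEq.rfl)

theorem Z_convCode (y : P.V ⟨1, ε⟩) (w : P.V ⟨2, !ε⟩) :
    P.Z (tangle convCode_planar (convCode_fits ε)) (P.vec₂ y w) = P.conv y w := by
  have : IsEmpty (convTangle ε).Loop := inferInstanceAs (IsEmpty Empty)
  have h : ∀ ε, Describes convCode (Equiv.refl _) (convTangle ε) (fun l : Fin 3 => l.1) := by
    unfold Describes
    decide +kernel
  exact Z_tangle (e := Equiv.refl _) (b' := convBox ε) P convCode_planar (convCode_fits ε)
    (Fin.forall_fin_two.2 ⟨rfl, rfl⟩)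
    (convTangle ε) (fun l : Fin 3 => l.1) Fin.val_injective (fun l : Fin 3 => l.2) (h ε).1 (h ε).2
      _ _
    (Fin.forall_fin_two.2 ⟨HEq.rfl, HEq.rfl⟩)

end Code

namespace CStarPlanarAlgebra

open Code

variable (P : CStarPlanarAlgebra.{u}) {ε : Bool}

/-- The rotation of `2`-boxes by `180°`. -/
noncomputable def halfTurn (x : P.V ⟨2, ε⟩) : P.V ⟨2, ε⟩ := P.Z (tangle halfTurnCode_planar
    (halfTurnCode_fits ε)) (P.vec₁ x)

/-- The counterclockwise rotation of `2`-boxes by `90°`. -/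
noncomputable def fourierInv (x : P.V ⟨2, ε⟩) : P.V ⟨2, !ε⟩ := P.Z (tangle fourierInvCode_planar
    (fourierInvCode_fits ε)) (P.vec₁ x)

/-- The clockwise rotation by `90°` of `2`-boxes with the opposite shading. -/
noncomputable def fourierBack (x : P.V ⟨2, !ε⟩) : P.V ⟨2, ε⟩ := P.Z (tangle fourierCode₂_planar
    (fourierCode₂_fits ε)) (P.vec₁ x)

/-- A `2`-box with `1`-boxes at its lower strings, as a `2`-box. -/
noncomputable def triple (c : P.V ⟨1, ε⟩) (a : P.V ⟨2, !ε⟩) (s : P.V ⟨1, ε⟩) : P.V ⟨2, ε⟩ :=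
  P.Z (tangle tripleCode_planar (tripleCode_fits ε)) (P.vec₃ c a s)

/-- The mirror image of `triple`. -/
noncomputable def tripleMirror (c : P.V ⟨1, ε⟩) (a : P.V ⟨2, !ε⟩) (s : P.V ⟨1, ε⟩) : P.V ⟨2, ε⟩ :=
  P.Z (tangle tripleMirrorCode_planar (tripleMirrorCode_fits ε)) (P.vec₃ c a s)

end CStarPlanarAlgebra

/-! ### Decompositions of tangles: one code as a composite in several ways -/

namespace Code

variable (P : CStarPlanarAlgebra.{u}) {ε : Bool}

/-- The lists are the certificates for `Composite`: the images of the regions of the outer tangle,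
those of the inserted tangles, and for every region of the composite one piece to which all its
other pieces are connected. Here as below, a second decomposition of the same code gives an identity
between boxes. -/
theorem Z_onLeftMulCode_left (y z : P.V ⟨1, ε⟩) : P.Z (tangle onLeftMulCode_planar
    (onLeftMulCode_fits ε)) (P.vec₂ y z) = P.onLeft (y * z) :=
  (Z_comp_one P (u := P.vec₁ (y * z)) [0, 1, 2] [0, 1]
    [(0, 0), (0, 1), (0, 2)] (by decide +kernel) (Z_mulCode₁ P y z).symm).trans (Z_onLeftCode P _)

theorem Z_onLeftMulCode_right (y z : P.V ⟨1, ε⟩) : P.Z (tangle onLeftMulCode_planar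
    (onLeftMulCode_fits ε)) (P.vec₂ y z) = P.onLeft y * P.onLeft z :=
  (Z_comp_two P (u := P.vec₂ (P.onLeft y) (P.onLeft z)) ![0] ![1] (by decide)
    [0, 1, 2, 1, 1] [0, 1, 2] [0, 1, 2]
    [(0, 0), (0, 1), (0, 2)] (by decide +kernel) (by intro i; fin_cases i; rfl)
      (by intro i; fin_cases i; rfl)
    (by intro i; fin_cases i; rfl) (by intro i; fin_cases i; rfl) (Z_onLeftCode P y).symm
    (Z_onLeftCode P z).symm).trans (Z_mulCode₂ P _ _)

theorem Z_oneCode₂_onLeft (v) : P.Z (tangle oneCode₂_planar (oneCode₂_fits ε)) v = P.onLeft (1 :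
    P.V ⟨1, ε⟩) :=
  (Z_comp_one P (b := ![⟨1, ε⟩]) (c := ![]) (v := v) (hS := oneCode₁_planar) (fS := oneCode₁_fits
    ε) (u := P.vec₁ (1 : P.V ⟨1, ε⟩)) [0, 1, 2] [0, 1]
    [(0, 0), (0, 1), (0, 2)] (by decide +kernel) (Z_oneCode₁ P v).symm).trans (Z_onLeftCode P _)

theorem Z_halfTurnMulCode_left (x y : P.V ⟨2, ε⟩) : P.Z (tangle halfTurnMulCode_planar
    (halfTurnMulCode_fits ε)) (P.vec₂ x y) = P.halfTurn (x * y) :=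
  (Z_comp_one P (u := P.vec₁ (x * y)) [2, 3, 0, 1] [2, 3, 0, 1, 4]
    [(0, 2), (0, 3), (0, 0), (0, 1), (1, 4)] (by decide +kernel) (Z_mulCode₂ P x y).symm).trans rfl

theorem Z_halfTurnMulCode_right (x y : P.V ⟨2, ε⟩) : P.Z (tangle halfTurnMulCode_planar
    (halfTurnMulCode_fits ε)) (P.vec₂ x y) = P.halfTurn y * P.halfTurn x :=
  (Z_comp_two P (u := P.vec₂ (P.halfTurn y) (P.halfTurn x)) ![1] ![0] (by decide)
    [0, 1, 2, 3, 4] [2, 3, 0, 4] [2, 4, 0, 1]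
    [(0, 0), (0, 1), (0, 2), (0, 3), (0, 4)] (by decide +kernel) (by intro i; fin_cases i; rfl)
      (by intro i; fin_cases i; rfl)
    (by intro i; fin_cases i; rfl) (by intro i; fin_cases i; rfl) (rfl : P.halfTurn y = P.Z _
      (P.vec₁ y))
    (rfl : P.halfTurn x = P.Z _ (P.vec₁ x))).trans (Z_mulCode₂ P _ _)

theorem Z_halfTurnOnLeftCode_left (y : P.V ⟨1, ε⟩) : P.Z (tangle halfTurnOnLeftCode_planar
    (halfTurnOnLeftCode_fits ε)) (P.vec₁ y) = P.halfTurn (P.onLeft y) :=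
  (Z_comp_one P (u := P.vec₁ (P.onLeft y)) [2, 1, 0, 1] [2, 1, 0]
    [(0, 2), (0, 1), (0, 0)] (by decide +kernel) (Z_onLeftCode P y).symm).trans rfl

theorem Z_halfTurnOnLeftCode_right (y : P.V ⟨1, ε⟩) : P.Z (tangle halfTurnOnLeftCode_planar
    (halfTurnOnLeftCode_fits ε)) (P.vec₁ y) = P.onRight (P.bar y) :=
  (Z_comp_one P (u := P.vec₁ (P.bar y)) [0, 1, 2] [2, 1]
    [(0, 0), (0, 1), (0, 2)] (by decide +kernel) (Z_barCode P y).symm).trans (Z_onRightCode P _)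

theorem Z_idCode₂_halfTurn (x : P.V ⟨2, ε⟩) : P.Z (tangle idCode₂_planar (idCode₂_fits ε)) (P.vec₁
    x) = P.halfTurn (P.halfTurn x) :=
  (Z_comp_one P (u := P.vec₁ (P.halfTurn x)) [2, 3, 0, 1] [0, 1, 2, 3]
    [(0, 2), (0, 3), (0, 0), (0, 1)] (by decide +kernel) rfl).trans rfl

theorem Z_idCode₂_fourier (x : P.V ⟨2, ε⟩) : P.Z (tangle idCode₂_planar (idCode₂_fits ε)) (P.vec₁
    x) = P.fourierBack (P.fourierInv x) :=
  (Z_comp_one P (u := P.vec₁ (P.fourierInv x)) [1, 2, 3, 0] [0, 3, 2, 1]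
    [(0, 3), (0, 0), (0, 1), (0, 2)] (by decide +kernel) rfl).trans rfl

theorem Z_halfTurnCode_fourier (x : P.V ⟨2, ε⟩) : P.Z (tangle halfTurnCode_planar
    (halfTurnCode_fits ε)) (P.vec₁ x) = P.fourierBack (P.fourier x) :=
  (Z_comp_one P (u := P.vec₁ (P.fourier x)) [3, 0, 1, 2] [0, 1, 2, 3]
    [(0, 1), (0, 2), (0, 3), (0, 0)] (by decide +kernel) (Z_fourierCode P x).symm).trans rfl

/-- Gluing fills every disc of the outer tangle, so the disc of `w`, which is to stay unchanged, is
filled with the identity tangle. -/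
theorem Z_convFourierCode (w : P.V ⟨1, ε⟩) (x : P.V ⟨2, ε⟩) : P.Z (tangle convFourierCode_planar
    (convFourierCode_fits ε)) (P.vec₂ w x) = P.conv w (P.fourier x) :=
  (Z_comp_two P (u := P.vec₂ w (P.fourier x)) ![0] ![1] (by decide)
    [0, 2, 1] [0, 2] [0, 1, 0, 2]
    [(0, 0), (0, 2), (0, 1)] (by decide +kernel) (by intro i; fin_cases i; rfl)
      (by intro i; fin_cases i; rfl)
    (by intro i; fin_cases i; rfl) (by intro i; fin_cases i; rfl) (Z_idCode₁ P w).symm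
    (Z_fourierCode P x).symm).trans (Z_convCode P _ _)

theorem Z_leftMulCode (y : P.V ⟨1, ε⟩) (x : P.V ⟨2, ε⟩) : P.Z (tangle leftMulCode_planar
    (leftMulCode_fits ε)) (P.vec₂ y x) = P.onLeft y * x :=
  (Z_comp_two P (u := P.vec₂ (P.onLeft y) x) ![0] ![1] (by decide)
    [0, 1, 2, 3, 3] [0, 3, 2] [0, 1, 2, 3]
    [(0, 0), (0, 1), (0, 2), (0, 3)] (by decide +kernel) (by intro i; fin_cases i; rfl)
      (by intro i; fin_cases i; rfl)
    (by intro i; fin_cases i; rfl) (by intro i; fin_cases i; rfl) (Z_onLeftCode P y).symm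
    (Z_idCode₂ P x).symm).trans (Z_mulCode₂ P _ _)

theorem Z_rightMulCode (x : P.V ⟨2, ε⟩) (y : P.V ⟨1, ε⟩) : P.Z (tangle rightMulCode_planar
    (rightMulCode_fits ε)) (P.vec₂ x y) = x * P.onLeft y :=
  (Z_comp_two P (u := P.vec₂ x (P.onLeft y)) ![0] ![1] (by decide)
    [0, 1, 2, 3, 1] [0, 1, 2, 3] [0, 1, 2]
    [(0, 0), (0, 1), (0, 2), (0, 3)] (by decide +kernel) (by intro i; fin_cases i; rfl)
      (by intro i; fin_cases i; rfl)
    (by intro i; fin_cases i; rfl) (by intro i; fin_cases i; rfl) (Z_idCode₂ P x).symm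
    (Z_onLeftCode P y).symm).trans (Z_mulCode₂ P _ _)

theorem Z_convLeftCode_left (w y : P.V ⟨1, ε⟩) (x : P.V ⟨2, ε⟩) : P.Z (tangle convLeftCode_planar
    (convLeftCode_fits ε)) (P.vec₃ w y x) = P.conv w (P.fourier (P.onLeft y * x)) :=
  (Z_comp_two P (u := P.vec₂ w (P.onLeft y * x)) ![0] ![1, 2] (by decide)
    [0, 1, 2] [0, 2] [0, 1, 0, 2]
    [(0, 0), (0, 1), (0, 2)] (by decide +kernel) (by intro i; fin_cases i; rfl)
      (by intro i; fin_cases i <;> rfl)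
    (by intro i; fin_cases i; rfl) (by intro i; fin_cases i <;> rfl) (Z_idCode₁ P w).symm
    (Z_leftMulCode P y x).symm).trans (Z_convFourierCode P _ _)

theorem Z_convLeftCode_right (w y : P.V ⟨1, ε⟩) (x : P.V ⟨2, ε⟩) : P.Z (tangle convLeftCode_planar
    (convLeftCode_fits ε)) (P.vec₃ w y x) = P.conv (w * y) (P.fourier x) :=
  (Z_comp_two P (u := P.vec₂ (w * y) (P.fourier x)) ![0, 1] ![2] (by decide)
    [0, 2, 1] [0, 2] [0, 1, 0, 2]
    [(0, 0), (0, 2), (0, 1)] (by decide +kernel) (by intro i; fin_cases i <;> rfl)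
      (by intro i; fin_cases i; rfl)
    (by intro i; fin_cases i <;> rfl) (by intro i; fin_cases i; rfl) (Z_mulCode₁ P w y).symm
    (Z_fourierCode P x).symm).trans (Z_convCode P _ _)

theorem Z_convRightCode_left (w : P.V ⟨1, ε⟩) (x : P.V ⟨2, ε⟩) (y : P.V ⟨1, ε⟩) : P.Z (tangle
    convRightCode_planar (convRightCode_fits ε)) (P.vec₃ w x y) = P.conv w (P.fourier (x *
    P.onLeft y)) :=
  (Z_comp_two P (u := P.vec₂ w (x * P.onLeft y)) ![0] ![1, 2] (by decide)
    [0, 1, 2] [0, 2] [0, 1, 0, 2]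
    [(0, 0), (0, 1), (0, 2)] (by decide +kernel) (by intro i; fin_cases i; rfl)
      (by intro i; fin_cases i <;> rfl)
    (by intro i; fin_cases i; rfl) (by intro i; fin_cases i <;> rfl) (Z_idCode₁ P w).symm
    (Z_rightMulCode P x y).symm).trans (Z_convFourierCode P _ _)

theorem Z_convRightCode_right (w : P.V ⟨1, ε⟩) (x : P.V ⟨2, ε⟩) (y : P.V ⟨1, ε⟩) : P.Z (tangle
    convRightCode_planar (convRightCode_fits ε)) (P.vec₃ w x y) = P.conv w (P.fourier x) * y :=
  (Z_comp_two P (u := P.vec₂ (P.conv w (P.fourier x)) y) ![0, 1] ![2] (by decide)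
    [0, 1] [0, 1, 2] [0, 1]
    [(0, 0), (0, 1), (1, 2)] (by decide +kernel) (by intro i; fin_cases i <;> rfl)
      (by intro i; fin_cases i; rfl)
    (by intro i; fin_cases i <;> rfl) (by intro i; fin_cases i; rfl) (Z_convFourierCode P w x).symm
    (Z_idCode₁ P y).symm).trans (Z_mulCode₁ P _ _)

theorem Z_convMulCode (c c' : P.V ⟨1, ε⟩) (a a' : P.V ⟨2, !ε⟩) : P.Z (tangle convMulCode_planar
    (convMulCode_fits ε)) (P.vec₄ c c' a a') = P.conv (c * c') (a * a') :=
  (Z_comp_two P (u := P.vec₂ (c * c') (a * a')) ![0, 1] ![2, 3] (by decide)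
    [0, 2, 1] [0, 2] [2, 0, 1, 0, 3]
    [(0, 0), (0, 2), (0, 1), (2, 4)] (by decide +kernel) (by intro i; fin_cases i <;> rfl)
      (by intro i; fin_cases i <;> rfl)
    (by intro i; fin_cases i <;> rfl) (by intro i; fin_cases i <;> rfl) (Z_mulCode₁ P c c').symm
    (Z_mulCode₂ P a a').symm).trans (Z_convCode P _ _)

theorem Z_convMulMulCode (c c' : P.V ⟨1, ε⟩) (a a' : P.V ⟨2, !ε⟩) (t t' : P.V ⟨1, ε⟩) : P.Z
    (tangle convMulMulCode_planar (convMulMulCode_fits ε)) (P.vec₆ c c' a a' t t') = P.conv (c *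
    c') (a * a') * (t * t') :=
  (Z_comp_two P (u := P.vec₂ (P.conv (c * c') (a * a')) (t * t')) ![0, 1, 2, 3] ![4, 5] (by decide)
    [0, 1] [0, 1, 2, 3] [0, 1]
    [(0, 0), (0, 1), (1, 2), (1, 3)] (by decide +kernel) (by intro i; fin_cases i <;> rfl)
      (by intro i; fin_cases i <;> rfl)
    (by intro i; fin_cases i <;> rfl) (by intro i; fin_cases i <;> rfl) (Z_convMulCode P c c' a
      a').symm
    (Z_mulCode₁ P t t').symm).trans (Z_mulCode₁ P _ _)

theorem Z_traceConvCode_left (c c' : P.V ⟨1, ε⟩) (a a' : P.V ⟨2, !ε⟩) (t t' : P.V ⟨1, ε⟩) : P.Z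
    (tangle traceConvCode_planar (traceConvCode_fits ε)) (P.vec₆ c c' a a' t t') = P.Z
    (traceTangle ⟨1, ε⟩) (fun _ => P.conv (c * c') (a * a') * (t * t')) :=
  (Z_comp_one P (u := P.vec₁ (P.conv (c * c') (a * a') * (t * t'))) [0, 3] [0, 3, 1, 2]
    [(0, 0), (1, 2), (1, 3), (0, 1)] (by decide +kernel) (Z_convMulMulCode P c c' a a' t
      t').symm).trans (Z_traceCode₁ P _)

theorem Z_tripleMulCode (c c' : P.V ⟨1, ε⟩) (a a' : P.V ⟨2, !ε⟩) (t t' : P.V ⟨1, ε⟩) : P.Z (tangle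
    tripleMulCode_planar (tripleMulCode_fits ε)) (P.vec₆ c c' a a' t t') = P.triple c a t' *
    P.tripleMirror c' a' t :=
  (Z_comp_two P (u := P.vec₂ (P.triple c a t') (P.tripleMirror c' a' t)) ![0, 2, 5] ![1, 3, 4]
    (by decide)
    [0, 1, 2, 3, 4] [0, 4, 2, 3] [0, 4, 2, 1]
    [(0, 0), (0, 1), (0, 2), (0, 3), (0, 4)] (by decide +kernel) (by intro i; fin_cases i <;> rfl)
      (by intro i; fin_cases i <;> rfl)
    (by intro i; fin_cases i <;> rfl) (by intro i; fin_cases i <;> rfl) (rfl : P.triple c a t' =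
      P.Z _ (P.vec₃ c a t'))
    (rfl : P.tripleMirror c' a' t = P.Z _ (P.vec₃ c' a' t))).trans (Z_mulCode₂ P _ _)

theorem Z_traceConvCode_right (c c' : P.V ⟨1, ε⟩) (a a' : P.V ⟨2, !ε⟩) (t t' : P.V ⟨1, ε⟩) : P.Z
    (tangle traceConvCode_planar (traceConvCode_fits ε)) (P.vec₆ c c' a a' t t') = P.Z
    (traceTangle ⟨2, ε⟩) (fun _ => P.triple c a t' * P.tripleMirror c' a' t) :=
  (Z_comp_one P (u := P.vec₁ (P.triple c a t' * P.tripleMirror c' a' t)) [0, 3, 2] [0, 3, 2, 3, 1]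
    [(0, 0), (1, 4), (0, 2), (0, 1)] (by decide +kernel) (Z_tripleMulCode P c c' a a' t
      t').symm).trans (Z_traceCode₂ P _)

end Code
end PFPlanar

/-! ### Planar identities, the exchange algebra, positivity of the convolution -/

namespace PFPlanar

namespace CStarPlanarAlgebra

open Code

variable (P : CStarPlanarAlgebra.{u}) {ε : Bool}

theorem onLeft_mul (y z : P.V ⟨1, ε⟩) : P.onLeft (y * z) = P.onLeft y * P.onLeft z :=
  (Z_onLeftMulCode_left P y z).symm.trans (Z_onLeftMulCode_right P y z)

theorem onLeft_one : P.onLeft (1 : P.V ⟨1, ε⟩) = 1 :=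
  (Z_oneCode₂_onLeft P _).symm.trans (Z_oneCode₂ P finZeroElim)

theorem halfTurn_mul (x y : P.V ⟨2, ε⟩) : P.halfTurn (x * y) = P.halfTurn y * P.halfTurn x :=
  (Z_halfTurnMulCode_left P x y).symm.trans (Z_halfTurnMulCode_right P x y)

theorem halfTurn_onLeft (y : P.V ⟨1, ε⟩) : P.halfTurn (P.onLeft y) = P.onRight (P.bar y) :=
  (Z_halfTurnOnLeftCode_left P y).symm.trans (Z_halfTurnOnLeftCode_right P y)

theorem halfTurn_halfTurn (x : P.V ⟨2, ε⟩) : P.halfTurn (P.halfTurn x) = x :=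
  (Z_idCode₂_halfTurn P x).symm.trans (Z_idCode₂ P x)

theorem fourierBack_fourierInv (x : P.V ⟨2, ε⟩) : P.fourierBack (P.fourierInv x) = x :=
  (Z_idCode₂_fourier P x).symm.trans (Z_idCode₂ P x)

theorem fourierBack_fourier (x : P.V ⟨2, ε⟩) : P.fourierBack (P.fourier x) = P.halfTurn x :=
  (Z_halfTurnCode_fourier P x).symm

/-- In `conv w (fourier x)` the lower left string of `x` is joined to the top of `w`, and the upper
left string of `x` is the top of the result. As the first factor of a product is drawn below the
second, a 1-box under `x` on the left string multiplies `w` on the right, and in the next lemma one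
above `x` multiplies the result on the right. -/
theorem conv_fourier_onLeft_mul (w y : P.V ⟨1, ε⟩) (x : P.V ⟨2, ε⟩) :
    P.conv w (P.fourier (P.onLeft y * x)) = P.conv (w * y) (P.fourier x) :=
  (Z_convLeftCode_left P w y x).symm.trans (Z_convLeftCode_right P w y x)

theorem conv_fourier_mul_onLeft (w : P.V ⟨1, ε⟩) (x : P.V ⟨2, ε⟩) (y : P.V ⟨1, ε⟩) :
    P.conv w (P.fourier (x * P.onLeft y)) = P.conv w (P.fourier x) * y :=
  (Z_convRightCode_left P w x y).symm.trans (Z_convRightCode_right P w x y)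

/-- One closed diagram cut along two different lines. For `c' = star c`, `a' = star a` and `t = t'`
self-adjoint, the second cut separates a 2-box from its mirror image, so the right-hand side becomes
a trace of the form tr(T T*). -/
theorem trace_conv_mul (c c' : P.V ⟨1, ε⟩) (a a' : P.V ⟨2, !ε⟩) (t t' : P.V ⟨1, ε⟩) :
    P.Z (traceTangle ⟨1, ε⟩) (fun _ => P.conv (c * c') (a * a') * (t * t')) =
      P.Z (traceTangle ⟨2, ε⟩) (fun _ => P.triple c a t' * P.tripleMirror c' a' t) :=
  (Z_traceConvCode_left P c c' a a' t t').symm.trans (Z_traceConvCode_right P c c' a a' t t')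

theorem star_onLeft (y : P.V ⟨1, ε⟩) : star (P.onLeft y) = P.onLeft (star y) := by
  rw [← Z_onLeftCode, ← Z_onLeftCode]
  refine (star_Z P (hC' := onLeftCode_planar) (h' := onLeftCode_fits ε) (by decide +kernel) _).trans
    (congrArg _ (funext ?_))
  intro i; fin_cases i; rfl

theorem star_conv (y : P.V ⟨1, ε⟩) (w : P.V ⟨2, !ε⟩) :
    star (P.conv y w) = P.conv (star y) (star w) := by
  rw [← Z_convCode, ← Z_convCode]
  refine (star_Z P (hC' := convCode_planar) (h' := convCode_fits ε) (by decide +kernel) _).trans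
    (congrArg _ (funext ?_))
  intro i; fin_cases i <;> rfl

/-- A reflection reverses the sense of rotation. -/
theorem star_fourier (x : P.V ⟨2, ε⟩) : star (P.fourier x) = P.fourierInv (star x) := by
  rw [← Z_fourierCode]
  refine (star_Z P (hC' := fourierInvCode_planar) (h' := fourierInvCode_fits ε)
    (by decide +kernel) _).trans (congrArg _ (funext ?_))
  intro i; fin_cases i; rfl

theorem star_triple (c : P.V ⟨1, ε⟩) (a : P.V ⟨2, !ε⟩) (s : P.V ⟨1, ε⟩) :
    star (P.triple c a s) = P.tripleMirror (star c) (star a) (star s) := by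
  refine (star_Z P (hC' := tripleMirrorCode_planar) (h' := tripleMirrorCode_fits ε)
    (by decide +kernel) _).trans (congrArg _ (funext ?_))
  intro i; fin_cases i <;> rfl

/-- The linear map `onLeft`. -/
noncomputable def onLeftLinear : P.V ⟨1, ε⟩ →ₗ[ℂ] P.V ⟨2, ε⟩ :=
  (P.Z (rightStringTangle ε)).toLinearMap (fun _ => 0) ()

theorem onLeftLinear_apply (y : P.V ⟨1, ε⟩) : P.onLeftLinear y = P.onLeft y :=
  congrArg (P.Z (rightStringTangle ε)) (funext fun _ => rfl)

/-- The convolution with a `2`-box, as a linear map. -/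
noncomputable def convLinear (w : P.V ⟨2, !ε⟩) : P.V ⟨1, ε⟩ →ₗ[ℂ] P.V ⟨1, ε⟩ :=
  (P.Z (convTangle ε)).toLinearMap (fun | 0 => 0 | 1 => w) 0

theorem convLinear_apply (w : P.V ⟨2, !ε⟩) (y : P.V ⟨1, ε⟩) : P.convLinear w y = P.conv y w :=
  congrArg (P.Z (convTangle ε)) (funext (by intro i; fin_cases i <;> rfl))

/-- The trace of boxes obtained by closing them on the right. -/
noncomputable def trace (B : BoxType) : P.V B →ₗ[ℂ] ℂ :=
  P.tr₀ B.shaded ∘ₗ (P.Z (traceTangle B)).toLinearMap (fun _ => 0) ()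

theorem trace_apply {B : BoxType} (x : P.V B) :
    P.trace B x = P.tr₀ B.shaded (P.Z (traceTangle B) (fun _ => x)) :=
  congrArg (fun v => P.tr₀ B.shaded (P.Z (traceTangle B) v)) (funext fun _ => rfl)

theorem trace_star_mul_self_nonneg {B : BoxType} (x : P.V B) :
    0 ≤ (P.trace B (star x * x)).re := by
  rcases eq_or_ne x 0 with rfl | hx
  · simp
  · rw [trace_apply]
    exact (P.tr_pos B x hx).1.le

theorem trace_star_mul_self_pos {B : BoxType} {x : P.V B} (hx : x ≠ 0) :
    0 < (P.trace B (star x * x)).re := by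
  rw [trace_apply]
  exact (P.tr_pos B x hx).1

/-- A self-adjoint Fourier transform means invariance under the half turn up to the involution. -/
theorem star_eq_halfTurn {x : P.V ⟨2, ε⟩} (hx : star (P.fourier x) = P.fourier x) :
    star x = P.halfTurn x := by
  rw [← P.fourierBack_fourier, ← hx, P.star_fourier, P.fourierBack_fourierInv]

/-- The half turn reverses products and carries `onRight (bar y)` to `onLeft y`, and it carries `x`
to `star x` because x̂ is self-adjoint. So the relation defining 𝒜 becomes commutation of `star x`
with `onLeft y`; now take adjoints. -/
theorem mem_exchangeA_iff {x : P.V ⟨2, ε⟩} (hx : star (P.fourier x) = P.fourier x)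
    (y : P.V ⟨1, ε⟩) : y ∈ P.exchangeA x ↔ star y ∈ P.exchangeB x := by
  have hi := (Function.LeftInverse.injective P.halfTurn_halfTurn : Function.Injective
    (P.halfTurn (ε := ε)))
  change x * P.onRight (P.bar y) = P.onRight (P.bar y) * x ↔
    x * P.onLeft (star y) = P.onLeft (star y) * x
  rw [← P.halfTurn_onLeft, ← hi.eq_iff, P.halfTurn_mul, P.halfTurn_mul, P.halfTurn_halfTurn,
    ← P.star_eq_halfTurn hx, ← star_inj, star_mul, star_mul, star_star, P.star_onLeft]

/-- The algebra `ℬ` of `1`-boxes which pass through `x` on the left string. -/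
noncomputable def exchangeSubalgebra (x : P.V ⟨2, ε⟩) : Subalgebra ℂ (P.V ⟨1, ε⟩) where
  carrier := P.exchangeB x
  mul_mem' {y z} hy hz := by
    change x * P.onLeft (y * z) = P.onLeft (y * z) * x
    rw [P.onLeft_mul, ← mul_assoc, (hy : x * P.onLeft y = _), mul_assoc,
      (hz : x * P.onLeft z = _), mul_assoc]
  add_mem' {y z} hy hz := by
    change x * P.onLeft (y + z) = P.onLeft (y + z) * x
    rw [← P.onLeftLinear_apply, map_add, P.onLeftLinear_apply, P.onLeftLinear_apply, mul_add,
      add_mul, (hy : x * P.onLeft y = _), (hz : x * P.onLeft z = _)]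
  algebraMap_mem' r := by
    change x * P.onLeft (algebraMap ℂ _ r) = P.onLeft (algebraMap ℂ _ r) * x
    rw [Algebra.algebraMap_eq_smul_one, ← P.onLeftLinear_apply, map_smul, P.onLeftLinear_apply,
      P.onLeft_one, mul_smul_comm, smul_mul_assoc, mul_one, one_mul]

/-- The exchange algebra `𝒞`. -/
noncomputable def exchangeStarSubalgebra (x : P.V ⟨2, ε⟩)
    (hx : star (P.fourier x) = P.fourier x) : StarSubalgebra ℂ (P.V ⟨1, ε⟩) where
  carrier := P.exchangeC x
  mul_mem' {y z} hy hz := ⟨(P.mem_exchangeA_iff hx _).2 (by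
    rw [star_mul]
    exact (P.exchangeSubalgebra x).mul_mem ((P.mem_exchangeA_iff hx _).1 hz.1)
      ((P.mem_exchangeA_iff hx _).1 hy.1)), (P.exchangeSubalgebra x).mul_mem hy.2 hz.2⟩
  add_mem' {y z} hy hz := ⟨(P.mem_exchangeA_iff hx _).2 (by
    rw [star_add]
    exact (P.exchangeSubalgebra x).add_mem ((P.mem_exchangeA_iff hx _).1 hy.1)
      ((P.mem_exchangeA_iff hx _).1 hz.1)), (P.exchangeSubalgebra x).add_mem hy.2 hz.2⟩
  algebraMap_mem' r := ⟨(P.mem_exchangeA_iff hx _).2 (by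
    rw [← algebraMap_star_comm]
    exact (P.exchangeSubalgebra x).algebraMap_mem _), (P.exchangeSubalgebra x).algebraMap_mem r⟩
  star_mem' {y} hy := ⟨(P.mem_exchangeA_iff hx _).2 (by rw [star_star]; exact hy.2),
    (P.mem_exchangeA_iff hx _).1 hy.1⟩

/-- Elements of `ℬ` pass through the convolution with `x̂`. -/
theorem conv_mul_of_mem_exchangeB {x : P.V ⟨2, ε⟩} {y : P.V ⟨1, ε⟩} (hy : y ∈ P.exchangeB x)
    (w : P.V ⟨1, ε⟩) : P.conv (w * y) (P.fourier x) = P.conv w (P.fourier x) * y := by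
  rw [← P.conv_fourier_onLeft_mul, ← P.conv_fourier_mul_onLeft, (hy : x * P.onLeft y = _)]

/-- The adjoint of the rule for ℬ, applied to `star y`: convolution with the self-adjoint x̂
commutes with the involution, and y ∈ 𝒜 means `star y` ∈ ℬ. -/
theorem conv_mul_of_mem_exchangeC {x : P.V ⟨2, ε⟩} (hx : star (P.fourier x) = P.fourier x)
    {y : P.V ⟨1, ε⟩} (hy : y ∈ P.exchangeC x) (w : P.V ⟨1, ε⟩) :
    P.conv (y * w) (P.fourier x) = y * P.conv w (P.fourier x) := by
  have h := P.conv_mul_of_mem_exchangeB ((P.mem_exchangeA_iff hx y).1 hy.1) (star w)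
  rw [← star_inj, P.star_conv, star_mul, star_mul, hx, h, P.star_conv, hx]

/-- The convolution of positive elements is positive. -/
theorem conv_nonneg (c : P.V ⟨1, ε⟩) (a : P.V ⟨2, !ε⟩) :
    IsPos (P.conv (c * star c) (a * star a)) := by
  -- The box spaces carry no order of their own; the spectral order, whose positive cone is that of
  -- `IsPos`, is introduced locally.
  let _ := CStarAlgebra.spectralOrder (P.V ⟨1, ε⟩)
  have := CStarAlgebra.spectralOrderedRing (P.V ⟨1, ε⟩)
  set b := P.conv (c * star c) (a * star a) with hb
  have hsa : IsSelfAdjoint b := by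
    rw [IsSelfAdjoint, hb, P.star_conv]
    simp
  -- This is tr(T T*) for T = `triple c a t`, by the second cut of the diagram.
  have key : ∀ t : P.V ⟨1, ε⟩, IsSelfAdjoint t → 0 ≤ (P.trace ⟨1, ε⟩ (b * (t * t))).re := by
    intro t ht
    have h1 := P.trace_star_mul_self_nonneg (star (P.triple c a t))
    rw [star_star, P.star_triple, ht.star_eq] at h1
    rw [P.trace_apply] at h1 ⊢
    rwa [hb, P.trace_conv_mul]
  have hn : IsSelfAdjoint b⁻ := (CFC.negPart_nonneg b).isSelfAdjoint
  have hsq : CFC.sqrt b⁻ * CFC.sqrt b⁻ = b⁻ := CFC.sqrt_mul_sqrt_self _ (CFC.negPart_nonneg b)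
  have hs : star (CFC.sqrt b⁻) = CFC.sqrt b⁻ := (CFC.sqrt_nonneg b⁻).isSelfAdjoint.star_eq
  -- Positivity and faithfulness of the trace are given on elements s* s only, so (b⁻)³ is written
  -- in this form with s = √(b⁻) b⁻.
  have hbn : b * (b⁻ * b⁻) = -(star (CFC.sqrt b⁻ * b⁻) * (CFC.sqrt b⁻ * b⁻)) := by
    have h1 : b * b⁻ = -(b⁻ * b⁻) := by
      nth_rw 1 [← CFC.posPart_sub_negPart b hsa]
      rw [sub_mul, CFC.posPart_mul_negPart, zero_sub]
    rw [star_mul, hs, hn.star_eq, mul_assoc b⁻, ← mul_assoc (CFC.sqrt b⁻) (CFC.sqrt b⁻) b⁻, hsq, ←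
      mul_assoc, h1,
      neg_mul, mul_assoc]
  have h0 : CFC.sqrt b⁻ * b⁻ = 0 := by
    by_contra h
    have h1 := P.trace_star_mul_self_pos h
    have h2 := key b⁻ hn
    rw [hbn, map_neg, Complex.neg_re] at h2
    linarith
  have h3 : b⁻ = 0 := by
    have h2 : star b⁻ * b⁻ = 0 := by
      rw [hn.star_eq]
      nth_rw 1 [← hsq]
      rw [mul_assoc, h0, mul_zero]
    exact CStarRing.star_mul_self_eq_zero_iff _ |>.1 h2
  have hb0 : 0 ≤ b := by
    rw [← CFC.posPart_sub_negPart b hsa, h3, sub_zero]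
    exact CFC.posPart_nonneg b
  exact CStarAlgebra.nonneg_iff_eq_mul_star_self.1 hb0

end CStarPlanarAlgebra

end PFPlanar

/-! ### Range projections and kernels of positive elements -/

namespace PFPlanar

section SpectralTheory

/-- By spectral mapping for the minimal polynomial, spectral values are among its roots. Finiteness
makes every real function admissible in the continuous functional calculus. -/
theorem spectrum_finite {𝕜 A : Type*} [Field 𝕜] [Ring A] [Algebra 𝕜 A] [FiniteDimensional 𝕜 A]
    (a : A) : (spectrum 𝕜 a).Finite := by
  classical
  refine ((minpoly 𝕜 a).roots.toFinset.finite_toSet).subset fun t ht => ?_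
  have hi : IsIntegral 𝕜 a := .of_finite 𝕜 a
  have h := spectrum.subset_polynomial_aeval a (minpoly 𝕜 a) ⟨t, ht, rfl⟩
  rw [minpoly.aeval, spectrum.mem_iff, sub_zero] at h
  simp only [Finset.mem_coe, Multiset.mem_toFinset, Polynomial.mem_roots (minpoly.ne_zero hi),
    Polynomial.IsRoot.def]
  by_contra h0
  exact h ((IsUnit.mk0 _ h0).map (algebraMap 𝕜 A))

variable {A : Type u} [CStarAlgebra A]

/-- Turns statements about supports into statements about right annihilators, which are antitone on
the positive cone. -/
theorem mul_eq_self_iff {a e : A} (ha : star a = a) (he : star e = e) :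
    e * a = a ↔ a * (1 - e) = 0 := by
  rw [← star_inj, star_mul, ha, he, mul_sub, mul_one, sub_eq_zero, eq_comm]

theorem proj_mul_smul_eq {b e : A} {c : ℝ} (h : e * b = b) : e * (c • b) = c • b := by
  rw [mul_smul_comm, h]

section Order

variable [PartialOrder A] [StarOrderedRing A]

theorem isPos_iff_nonneg {y : A} : IsPos y ↔ 0 ≤ y :=
  CStarAlgebra.nonneg_iff_eq_mul_star_self.symm

/-- v* a v = (√a v)* (√a v). -/
theorem nonneg_mul_eq_zero {a v : A} (ha : 0 ≤ a) (h : star v * a * v = 0) : a * v = 0 := by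
  have hs : star (CFC.sqrt a) = CFC.sqrt a := (CFC.sqrt_nonneg a).isSelfAdjoint.star_eq
  have h1 : CFC.sqrt a * v = 0 := by
    refine (CStarRing.star_mul_self_eq_zero_iff _).1 ?_
    rw [star_mul, hs, mul_assoc, ← mul_assoc (CFC.sqrt a), CFC.sqrt_mul_sqrt_self a ha, ← mul_assoc,
      h]
  rw [← CFC.sqrt_mul_sqrt_self a ha, mul_assoc, h1, mul_zero]

/-- The kernel of a positive element contains the kernels of its majorants. -/
theorem mul_eq_zero_of_le {a b v : A} (ha : 0 ≤ a) (hab : a ≤ b) (h : b * v = 0) : a * v = 0 := by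
  refine nonneg_mul_eq_zero ha (le_antisymm ?_ (star_left_conjugate_nonneg ha v))
  calc star v * a * v ≤ star v * b * v := star_left_conjugate_le_conjugate hab v
    _ = 0 := by rw [mul_assoc, h, mul_zero]

theorem proj_mul_eq_of_le {a b e : A} (he : IsStarProjection e) (ha : 0 ≤ a) (hab : a ≤ b)
    (h : e * b = b) : e * a = a := by
  have hb : IsSelfAdjoint b := (ha.trans hab).isSelfAdjoint
  rw [mul_eq_self_iff ha.isSelfAdjoint.star_eq he.isSelfAdjoint.star_eq]
  exact mul_eq_zero_of_le ha hab ((mul_eq_self_iff hb.star_eq he.isSelfAdjoint.star_eq).1 h)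

/-- Positive elements that dominate each other up to positive factors have the same kernel, hence
the same support. This is how ζ inherits the support of the chosen eigenvector. -/
theorem IsRangeProjection.of_le {y z q : A} (h : IsRangeProjection y q) {c C : ℝ} (hc : 0 < c)
    (hy : 0 ≤ y) (hyz : c • y ≤ z) (hzy : z ≤ C • y) : IsRangeProjection z q := by
  have hcy : 0 ≤ c • y := smul_nonneg hc.le hy
  refine ⟨h.1, proj_mul_eq_of_le h.1 (hcy.trans hyz) hzy (proj_mul_smul_eq h.2.1),
    fun e he hez => h.2.2 e he ?_⟩
  have := proj_mul_smul_eq (c := c⁻¹) (proj_mul_eq_of_le he hcy hyz hez)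
  rwa [smul_smul, inv_mul_cancel₀ hc.ne', one_smul] at this

variable [FiniteDimensional ℂ A]

/-- The projection is the indicator function of t ≠ 0 applied to y. The spectrum is finite, so 0 is
isolated from the rest, and the projection is comparable with y from both sides; this comparison
bounds the orbit of p_max. -/
theorem exists_rangeProjection {y : A} (hy : 0 ≤ y) : ∃ q : A, IsRangeProjection y q ∧
    ∃ c C : ℝ, 0 < c ∧ c • y ≤ q ∧ q ≤ C • y := by
  have : FiniteDimensional ℝ A := FiniteDimensional.complexToReal A
  have hfin : (spectrum ℝ y).Finite := spectrum_finite y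
  have hsa : IsSelfAdjoint y := hy.isSelfAdjoint
  have hcont : ∀ f : ℝ → ℝ, ContinuousOn f (spectrum ℝ y) := fun f => hfin.continuousOn f
  have hpos : ∀ t ∈ spectrum ℝ y, 0 ≤ t := fun t ht => spectrum_nonneg_of_nonneg hy ht
  -- With the convention 0⁻¹ = 0 this is the indicator function of t ≠ 0.
  set g : ℝ → ℝ := fun t => t * t⁻¹ with hg
  -- The left factor y gives the minimality: e y = y implies e q = q.
  have hq : cfc g y = y * cfc (fun t : ℝ => t⁻¹) y := by
    rw [hg, cfc_mul _ _ y (hcont _) (hcont _), cfc_id' ℝ y]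
  obtain ⟨C, hC⟩ := (hfin.image fun t => t⁻¹).bddAbove
  obtain ⟨K, hK⟩ := hfin.bddAbove
  have hcfc : ∀ c : ℝ, cfc (fun t : ℝ => c * t) y = c • y := fun c => cfc_const_mul_id c y
  -- K bounds the spectrum and C bounds the inverses of its elements. The maximum with 1 keeps the
  -- lower constant positive also for y = 0.
  refine ⟨cfc g y, ⟨⟨?_, cfc_predicate g y⟩, ?_, fun e _ hey => ?_⟩, (max K 1)⁻¹, C,
    inv_pos.2 (by positivity), ?_, ?_⟩
  · change cfc g y * cfc g y = cfc g y
    rw [← cfc_mul _ _ y (hcont _) (hcont _)]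
    congr 1
    funext t
    by_cases ht : t = 0 <;> simp [hg, ht]
  · nth_rw 2 [← cfc_id' ℝ y]
    rw [← cfc_mul _ _ y (hcont _) (hcont _)]
    nth_rw 2 [← cfc_id' ℝ y]
    congr 1
    funext t
    by_cases ht : t = 0 <;> simp [hg, ht]
  · rw [hq, ← mul_assoc, hey]
  · rw [← hcfc]
    refine cfc_mono (fun t ht => ?_) (hcont _) (hcont _)
    by_cases h0 : t = 0
    · simp [hg, h0]
    · simp only [hg, mul_inv_cancel₀ h0]
      rw [inv_mul_le_iff₀ (by positivity), mul_one]
      exact (hK ht).trans (le_max_left _ _)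
  · rw [← hcfc]
    refine cfc_mono (fun t ht => ?_) (hcont _) (hcont _)
    by_cases h0 : t = 0
    · simp [hg, h0]
    · have h1 := mul_le_mul_of_nonneg_right (hC ⟨t, ht, rfl⟩) (hpos t ht)
      simpa [hg, h0, mul_assoc] using h1

/-- A set of positive elements which is closed under addition has an element whose kernel is
contained in the kernels of all the others. -/
theorem exists_minimal_kernel {S : Set A} (h0 : S.Nonempty) (hS : ∀ y ∈ S, 0 ≤ y)
    (hadd : ∀ y ∈ S, ∀ z ∈ S, y + z ∈ S) : ∃ y ∈ S, ∀ z ∈ S, ∀ v, y * v = 0 → z * v = 0 := by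
  let d : S → ℕ := fun y => Module.finrank ℂ (LinearMap.ker (LinearMap.mulLeft ℂ (y : A)))
  have : Nonempty S := h0.to_subtype
  obtain ⟨⟨y, hy⟩, hmin⟩ : ∃ y : S, ∀ z, d y ≤ d z :=
    ⟨Function.argmin d, fun z => Function.argmin_le d z⟩
  refine ⟨y, hy, fun z hz v hv => ?_⟩
  -- The kernel of y + z lies in that of y; as the latter has least dimension, they coincide, so the
  -- kernel of y also lies in that of z.
  have hle : LinearMap.ker (LinearMap.mulLeft ℂ (y + z)) ≤ LinearMap.ker (LinearMap.mulLeft ℂ y) :=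
    fun w hw => mul_eq_zero_of_le (hS y hy) (le_add_of_nonneg_right (hS z hz)) hw
  have heq := Submodule.eq_of_le_of_finrank_le hle (hmin ⟨y + z, hadd y hy z hz⟩)
  have hv' : v ∈ LinearMap.ker (LinearMap.mulLeft ℂ (y + z)) := heq ▸ (show v ∈ LinearMap.ker _
    from hv)
  exact mul_eq_zero_of_le (hS z hz) (le_add_of_nonneg_left (hS y hy)) hv'

end Order

end SpectralTheory

/-! ### Orbits of growth r^j and the Abel limit of the resolvent -/

section PowerBounded

variable {V : Type*} [NormedAddCommGroup V] [NormedSpace ℂ V]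

/-- The vectors whose orbits grow at most like `r ^ j`. -/
def boundedOrbits (Φ : Module.End ℂ V) (r : ℝ) : Submodule ℂ V where
  carrier := {w | ∃ K : ℝ, ∀ j : ℕ, ‖(Φ ^ j) w‖ ≤ K * r ^ j}
  zero_mem' := ⟨0, fun j => by simp⟩
  add_mem' := by
    rintro v w ⟨K, hK⟩ ⟨L, hL⟩
    refine ⟨K + L, fun j => ?_⟩
    rw [map_add, add_mul]
    exact (norm_add_le _ _).trans (add_le_add (hK j) (hL j))
  smul_mem' := by
    rintro c w ⟨K, hK⟩
    refine ⟨‖c‖ * K, fun j => ?_⟩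
    rw [map_smul, norm_smul, mul_assoc]
    exact mul_le_mul_of_nonneg_left (hK j) (norm_nonneg _)

variable {Φ : Module.End ℂ V} {r : ℝ}

theorem map_mem_boundedOrbits {w : V} (hw : w ∈ boundedOrbits Φ r) : Φ w ∈ boundedOrbits Φ r := by
  obtain ⟨K, hK⟩ := hw
  refine ⟨K * r, fun j => ?_⟩
  have := hK (j + 1)
  rwa [pow_succ, Module.End.mul_apply, pow_succ', ← mul_assoc] at this

/-- On the vectors with orbits of growth `r ^ j` the eigenvalue `r` is semisimple. -/
theorem eq_zero_of_boundedOrbits (hr : 0 ≤ r) {v w : V} (hv : v ∈ boundedOrbits Φ r)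
    (hvw : Φ v = (r : ℂ) • v + w) (hw : Φ w = (r : ℂ) • w) : w = 0 := by
  obtain ⟨K, hK⟩ := hv
  have hpw : ∀ j : ℕ, (Φ ^ j) w = ((r : ℂ) ^ j) • w := by
    intro j
    induction j with
    | zero => simp
    | succ j ih => rw [pow_succ', Module.End.mul_apply, ih, map_smul, hw, smul_smul, pow_succ]
  -- The powers of a Jordan block of size two. The coefficient j + 1 of w is incompatible with
  -- growth r^j unless w = 0.
  have hp : ∀ j : ℕ, (Φ ^ (j + 1)) v = ((r : ℂ) ^ (j + 1)) • v + ((j + 1 : ℂ) * (r : ℂ) ^ j) • w :=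
    by
    intro j
    induction j with
    | zero => simp [hvw]
    | succ j ih =>
      rw [pow_succ', Module.End.mul_apply, ih, map_add, map_smul, map_smul, hvw, hw, smul_add,
        smul_smul, smul_smul, add_assoc, ← add_smul]
      congr 2
      push_cast
      ring
  have hb : ∀ j : ℕ, ((j : ℝ) + 1) * r ^ j * ‖w‖ ≤ (K + ‖v‖) * r * r ^ j := by
    intro j
    have h1 : ‖((j + 1 : ℂ) * (r : ℂ) ^ j) • w‖ = ((j : ℝ) + 1) * r ^ j * ‖w‖ := by
      rw [norm_smul, norm_mul, norm_pow, Complex.norm_real, Real.norm_of_nonneg hr]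
      congr 2
      exact_mod_cast Complex.norm_natCast (j + 1)
    have h2 : ‖((r : ℂ) ^ (j + 1)) • v‖ = r ^ (j + 1) * ‖v‖ := by
      rw [norm_smul, norm_pow, Complex.norm_real, Real.norm_of_nonneg hr]
    have h3 := hK (j + 1)
    rw [← h1, ← add_sub_cancel_left (((r : ℂ) ^ (j + 1)) • v) (((j + 1 : ℂ) * (r : ℂ) ^ j) • w),
      ← hp]
    refine (norm_sub_le _ _).trans ?_
    rw [h2]
    have h4 : (K + ‖v‖) * r * r ^ j = K * r ^ (j + 1) + r ^ (j + 1) * ‖v‖ := by ring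
    rw [h4]
    exact add_le_add_left h3 _
  -- For r = 0 the right-hand side of `hb` vanishes because of its separate factor r, so j = 0 is
  -- enough; for r > 0 cancel r^j and let j grow.
  rcases hr.eq_or_lt with rfl | hr
  · have := hb 0
    simp only [pow_zero, mul_zero, zero_mul, CharP.cast_eq_zero, zero_add, one_mul] at this
    exact norm_le_zero_iff.1 this
  · have hb' : ∀ j : ℕ, ((j : ℝ) + 1) * ‖w‖ ≤ (K + ‖v‖) * r := fun j =>
      le_of_mul_le_mul_right (by linarith [hb j]) (pow_pos hr j)
    by_contra hw0
    have hw1 : 0 < ‖w‖ := norm_pos_iff.2 hw0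
    obtain ⟨j, hj⟩ := exists_nat_gt ((K + ‖v‖) * r / ‖w‖)
    rw [div_lt_iff₀ hw1] at hj
    linarith [hb' j]

theorem norm_resolvent_term_le (hr : 0 ≤ r) {w : V} {K z : ℝ} (hK : ∀ j : ℕ, ‖(Φ ^ j) w‖ ≤ K * r ^
    j)
    (hz : r < z) (j : ℕ) : ‖((z : ℂ) ^ (j + 1))⁻¹ • (Φ ^ j) w‖ ≤ K / z * (r / z) ^ j := by
  have hz0 : 0 < z := hr.trans_lt hz
  rw [norm_smul, norm_inv, norm_pow, Complex.norm_real, Real.norm_of_nonneg hz0.le]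
  calc (z ^ (j + 1))⁻¹ * ‖(Φ ^ j) w‖ ≤ (z ^ (j + 1))⁻¹ * (K * r ^ j) :=
        mul_le_mul_of_nonneg_left (hK j) (by positivity)
    _ = K / z * (r / z) ^ j := by
        rw [div_pow, pow_succ]
        field_simp

/-- Summing the geometric majorant. Hence (z - r) times the resolvent stays bounded on such a vector
as z decreases to r. -/
theorem norm_resolvent_le (hr : 0 ≤ r) {w : V} {K z : ℝ} (hK : ∀ j : ℕ, ‖(Φ ^ j) w‖ ≤ K * r ^ j)
    (hz : r < z) : ‖∑' j : ℕ, ((z : ℂ) ^ (j + 1))⁻¹ • (Φ ^ j) w‖ ≤ K / (z - r) := by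
  have hz0 : 0 < z := hr.trans_lt hz
  have hg := (hasSum_geometric_of_lt_one (by positivity) ((div_lt_one hz0).2 hz)).mul_left (K / z)
  refine (tsum_of_norm_bounded hg (norm_resolvent_term_le hr hK hz)).trans (le_of_eq ?_)
  have : z - r ≠ 0 := by linarith
  have : 1 - r / z ≠ 0 := by rw [one_sub_div hz0.ne']; exact div_ne_zero this hz0.ne'
  field_simp

variable [FiniteDimensional ℂ V]

/-- Vectors with orbits of growth `r ^ j` are sums of an eigenvector and an element of
`(Φ - r) V`. -/
theorem exists_eigenvector_add (hr : 0 ≤ r) {p : V} (hp : p ∈ boundedOrbits Φ r) :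
    ∃ u v, Φ u = (r : ℂ) • u ∧ v ∈ boundedOrbits Φ r ∧ p = u + ((r : ℂ) • v - Φ v) := by
  let W := boundedOrbits Φ r
  -- On the invariant subspace W of bounded orbits, r - Φ has kernel and range meeting only in 0; by
  -- rank and nullity W is their direct sum.
  let N : Module.End ℂ W := (r : ℂ) • LinearMap.id - Φ.restrict (fun _ => map_mem_boundedOrbits)
  have hN : ∀ w : W, (N w : V) = (r : ℂ) • (w : V) - Φ w := fun w => rfl
  have hdis : LinearMap.ker N ⊓ LinearMap.range N = ⊥ := by
    rw [eq_bot_iff]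
    rintro _ ⟨hw, v, rfl⟩
    have h1 : Φ (N v : V) = (r : ℂ) • (N v : V) := by
      have := congrArg Subtype.val (LinearMap.mem_ker.1 hw)
      rw [hN, ZeroMemClass.coe_zero, sub_eq_zero] at this
      exact this.symm
    -- Φ v = r v - N v with N v an eigenvector: a Jordan block, excluded on W.
    have h2 : -(N v : V) = 0 := eq_zero_of_boundedOrbits hr v.2
      (by rw [hN]; abel) (by rw [map_neg, h1, smul_neg])
    exact (Submodule.mem_bot _).2 (Subtype.ext (neg_eq_zero.1 h2))
  have htop : LinearMap.ker N ⊔ LinearMap.range N = ⊤ := by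
    apply Submodule.eq_top_of_finrank_eq
    have h1 := Submodule.finrank_sup_add_finrank_inf_eq (LinearMap.ker N) (LinearMap.range N)
    rw [hdis, finrank_bot, add_zero] at h1
    rw [h1, add_comm, LinearMap.finrank_range_add_finrank_ker]
  obtain ⟨u, hu, _, ⟨v, rfl⟩, h⟩ := Submodule.mem_sup.1 (htop ▸ Submodule.mem_top (x := (⟨p, hp⟩ :
    W)))
  refine ⟨u, v, ?_, v.2, ?_⟩
  · have := congrArg Subtype.val (LinearMap.mem_ker.1 hu)
    rw [hN, ZeroMemClass.coe_zero, sub_eq_zero] at this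
    exact this.symm
  · rw [← hN]
    exact (congrArg Subtype.val h).symm

theorem summable_resolvent (hr : 0 ≤ r) {w : V} (hw : w ∈ boundedOrbits Φ r) {z : ℝ} (hz : r < z) :
    Summable fun j : ℕ => ((z : ℂ) ^ (j + 1))⁻¹ • (Φ ^ j) w := by
  obtain ⟨K, hK⟩ := hw
  have := FiniteDimensional.complete ℂ V
  have hz0 : 0 < z := hr.trans_lt hz
  exact Summable.of_norm_bounded ((summable_geometric_of_lt_one (by positivity)
    ((div_lt_one hz0).2 hz)).mul_left (K / z)) (norm_resolvent_term_le hr hK hz)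

/-- The resolvent series inverts `z - Φ`. -/
theorem resolvent_apply_sub (hr : 0 ≤ r) {w : V} (hw : w ∈ boundedOrbits Φ r) {z : ℝ} (hz : r < z) :
    ∑' j : ℕ, ((z : ℂ) ^ (j + 1))⁻¹ • (Φ ^ j) ((z : ℂ) • w - Φ w) = w := by
  have hz0 : (z : ℂ) ≠ 0 := by exact_mod_cast (hr.trans_lt hz).ne'
  have hs := summable_resolvent hr hw hz
  -- The series applied to z w - Φ w is the telescoping series of the differences a j - a (j + 1),
  -- with sum a 0 = w.
  let a : ℕ → V := fun j => ((z : ℂ) ^ j)⁻¹ • (Φ ^ j) w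
  have ha : Summable a := by
    refine (hs.const_smul (z : ℂ)).congr fun j => ?_
    rw [smul_smul, pow_succ, mul_inv, mul_comm, mul_assoc, inv_mul_cancel₀ hz0, mul_one]
  have hterm : ∀ j, ((z : ℂ) ^ (j + 1))⁻¹ • (Φ ^ j) ((z : ℂ) • w - Φ w) = a j - a (j + 1) := by
    intro j
    have h1 : ((z : ℂ) ^ (j + 1))⁻¹ * z = ((z : ℂ) ^ j)⁻¹ := by
      rw [pow_succ, mul_inv, mul_assoc, inv_mul_cancel₀ hz0, mul_one]
    rw [map_sub, map_smul, smul_sub, smul_smul, h1, ← Module.End.mul_apply, ← pow_succ]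
  rw [tsum_congr hterm, ha.tsum_sub ((summable_nat_add_iff 1).2 ha), ha.tsum_eq_zero_add]
  simp [a]

/-- The Abel limit of the orbit of a vector with growth `r ^ j` exists and is an eigenvector. -/
theorem exists_tendsto_resolvent (hr : 0 ≤ r) {p : V} (hp : p ∈ boundedOrbits Φ r) :
    ∃ u, Φ u = (r : ℂ) • u ∧ Filter.Tendsto
      (fun z : ℝ => ((z : ℂ) - r) • ∑' j : ℕ, ((z : ℂ) ^ (j + 1))⁻¹ • (Φ ^ j) p)
      (nhdsWithin r (Set.Ioi r)) (nhds u) := by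
  obtain ⟨u, v, hu, hv, rfl⟩ := exists_eigenvector_add hr hp
  refine ⟨u, hu, ?_⟩
  have hu' : u ∈ boundedOrbits Φ r := by
    refine ⟨‖u‖, fun j => ?_⟩
    have : (Φ ^ j) u = ((r : ℂ) ^ j) • u := by
      induction j with
      | zero => simp
      | succ j ih => rw [pow_succ', Module.End.mul_apply, ih, map_smul, hu, smul_smul, pow_succ]
    rw [this, norm_smul, norm_pow, Complex.norm_real, Real.norm_of_nonneg hr, mul_comm]
  obtain ⟨K, hK⟩ := id hv
  have key : ∀ z : ℝ, r < z →
      ‖((z : ℂ) - r) • ∑' j : ℕ, ((z : ℂ) ^ (j + 1))⁻¹ • (Φ ^ j) (u + ((r : ℂ) • v - Φ v)) - u‖ ≤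
        (z - r) * (‖v‖ + K) := by
    intro z hz
    have hzr : (z : ℂ) - r ≠ 0 := by
      rw [sub_ne_zero]; exact_mod_cast hz.ne'
    have hzr' : ‖(z : ℂ) - r‖ = z - r := by
      rw [← Complex.ofReal_sub, Complex.norm_real, Real.norm_of_nonneg (by linarith)]
    -- Both parts are expressed by values of z - Φ, which the resolvent inverts: u = (z - r)⁻¹ (z -
    -- Φ) u, and (r - Φ) v = (z - Φ) v - (z - r) v. After multiplication by z - r the second part is
    -- O(z - r).
    have h1 : u + ((r : ℂ) • v - Φ v) = ((z : ℂ) - r)⁻¹ • ((z : ℂ) • u - Φ u) +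
        (((z : ℂ) • v - Φ v) - ((z : ℂ) - r) • v) := by
      rw [hu, ← sub_smul, smul_smul, inv_mul_cancel₀ hzr, one_smul, sub_smul]
      abel
    have hmem : ∀ w ∈ boundedOrbits Φ r, (z : ℂ) • w - Φ w ∈ boundedOrbits Φ r := fun w hw =>
      sub_mem (Submodule.smul_mem _ _ hw) (map_mem_boundedOrbits hw)
    have s1 := summable_resolvent hr (hmem u hu') hz
    have s2 := summable_resolvent hr (hmem v hv) hz
    have s3 := summable_resolvent hr hv hz
    have h2 : ∑' j : ℕ, ((z : ℂ) ^ (j + 1))⁻¹ • (Φ ^ j) (u + ((r : ℂ) • v - Φ v)) =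
        ((z : ℂ) - r)⁻¹ • u + (v - ((z : ℂ) - r) •
          ∑' j : ℕ, ((z : ℂ) ^ (j + 1))⁻¹ • (Φ ^ j) v) := by
      refine Eq.trans ?_ (congrArg₂ (fun a b => ((z : ℂ) - r)⁻¹ • a + (b - ((z : ℂ) - r) •
        ∑' j : ℕ, ((z : ℂ) ^ (j + 1))⁻¹ • (Φ ^ j) v)) (resolvent_apply_sub hr hu' hz)
        (resolvent_apply_sub hr hv hz))
      rw [h1, ← s1.tsum_const_smul, ← s3.tsum_const_smul, ← s2.tsum_sub (s3.const_smul _),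
        ← (s1.const_smul _).tsum_add (s2.sub (s3.const_smul _))]
      refine tsum_congr fun j => ?_
      rw [map_add, map_sub, map_smul, map_smul, smul_add, smul_sub, smul_comm, smul_comm (_ - _) _
        ((Φ ^ j) v)]
    rw [h2, smul_add, smul_smul, mul_inv_cancel₀ hzr, one_smul, add_sub_cancel_left, norm_smul,
      hzr']
    refine mul_le_mul_of_nonneg_left ((norm_sub_le _ _).trans (add_le_add le_rfl ?_)) (by linarith)
    rw [norm_smul, hzr']
    calc (z - r) * _ ≤ (z - r) * (K / (z - r)) :=
          mul_le_mul_of_nonneg_left (norm_resolvent_le hr hK hz) (by linarith)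
      _ = K := mul_div_cancel₀ _ (by linarith)
  rw [tendsto_iff_norm_sub_tendsto_zero]
  refine squeeze_zero' (Filter.Eventually.of_forall fun _ => norm_nonneg _)
    (Filter.eventually_of_mem self_mem_nhdsWithin key) ?_
  have : Filter.Tendsto (fun z : ℝ => (z - r) * (‖v‖ + K)) (nhds r) (nhds ((r - r) * (‖v‖ + K))) :=
    (Continuous.tendsto (by fun_prop) r)
  rw [sub_self, zero_mul] at this
  exact this.mono_left nhdsWithin_le_nhds

end PowerBounded

end PFPlanar

/-! ### Perron–Frobenius theory of a positive map -/

namespace PFPlanar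

section PerronFrobenius

variable {A : Type u} [CStarAlgebra A] {Φ : Module.End ℂ A} {r : ℝ}

theorem map_smul_real (Φ : Module.End ℂ A) (c : ℝ) (y : A) : Φ (c • y) = c • Φ y := by
  rw [← Complex.coe_smul, map_smul, Complex.coe_smul]

theorem pow_apply_eigenvector {y : A} (hy : Φ y = (r : ℂ) • y) (j : ℕ) : (Φ ^ j) y = r ^ j • y := by
  induction j with
  | zero => simp
  | succ j ih =>
    rw [pow_succ', Module.End.mul_apply, ih, map_smul_real, hy, Complex.coe_smul, smul_smul,
      pow_succ]

/-- The resolvent maps an eigenvector y to (z - r)⁻¹ y, so the expression under the limit is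
constantly y. -/
theorem tendsto_resolvent_eigenvector [FiniteDimensional ℂ A] (hr : 0 ≤ r) {y : A} (hy : Φ y = (r :
    ℂ) • y) :
    y ∈ boundedOrbits Φ r ∧
    Filter.Tendsto (fun z : ℝ => ((z : ℂ) - r) • ∑' j : ℕ, ((z : ℂ) ^ (j + 1))⁻¹ • (Φ ^ j) y)
      (nhdsWithin r (Set.Ioi r)) (nhds y) := by
  have hmem : y ∈ boundedOrbits Φ r := ⟨‖y‖, fun j => by
    rw [pow_apply_eigenvector hy, norm_smul, Real.norm_of_nonneg (pow_nonneg hr j), mul_comm]⟩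
  refine ⟨hmem, tendsto_const_nhds.congr' (Filter.eventually_of_mem self_mem_nhdsWithin
    fun z (hz : r < z) => ?_)⟩
  have h := resolvent_apply_sub hr hmem hz
  rw [hy, ← sub_smul] at h
  dsimp only
  rw [← (summable_resolvent hr hmem hz).tsum_const_smul]
  nth_rw 1 [← h]
  exact tsum_congr fun j => by rw [map_smul, smul_comm]

variable [PartialOrder A] [StarOrderedRing A]

theorem pow_mono (hΦ : ∀ y : A, 0 ≤ y → 0 ≤ Φ y) (j : ℕ) {y z : A} (h : y ≤ z) :
    (Φ ^ j) y ≤ (Φ ^ j) z := by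
  induction j with
  | zero => simpa using h
  | succ j ih =>
    rw [pow_succ', Module.End.mul_apply, Module.End.mul_apply, ← sub_nonneg, ← map_sub]
    exact hΦ _ (sub_nonneg.2 ih)

/-- 0 ≤ Φ^j p ≤ C r^j y, and the norm is monotone on the positive cone. The growth bound thus comes
from the eigenvector and needs no knowledge of the spectral radius of Φ. -/
theorem mem_boundedOrbits_of_le (hΦ : ∀ y : A, 0 ≤ y → 0 ≤ Φ y) (hr : 0 ≤ r) {y p : A}
    (hy : Φ y = (r : ℂ) • y) {C : ℝ} (hp : 0 ≤ p) (hpy : p ≤ C • y) : p ∈ boundedOrbits Φ r := by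
  refine ⟨‖C • y‖, fun j => ?_⟩
  have h0 : 0 ≤ (Φ ^ j) p := by simpa using pow_mono hΦ j hp
  have h1 := pow_mono hΦ j hpy
  rw [map_smul_real, pow_apply_eigenvector hy, smul_comm] at h1
  refine (CStarAlgebra.norm_le_norm_of_nonneg_of_le h0 h1).trans (le_of_eq ?_)
  rw [norm_smul, Real.norm_of_nonneg (pow_nonneg hr j), mul_comm]

/-- a y a* is a positive eigenvector, so its support lies under p. Hence y annihilates a* (1 - p),
and so does p, being at most C y. The adjoint of p a* (1 - p) = 0 is the claim. -/
theorem proj_commute_of_intertwines {y p : A} (hy : 0 ≤ y) {C : ℝ} (hp : IsRangeProjection y p)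
    (hpy : p ≤ C • y) (hE : Φ y = (r : ℂ) • y) (hmax : ∀ z, 0 ≤ z → Φ z = (r : ℂ) • z → p * z = z)
    {a : A} (hl : ∀ w, Φ (a * w) = a * Φ w) (hr : ∀ w, Φ (w * star a) = Φ w * star a) :
    p * (a * p) = a * p := by
  have hps := hp.1.isSelfAdjoint.star_eq
  have hz : 0 ≤ a * y * star a := star_right_conjugate_nonneg hy a
  have h1 := hmax _ hz (by rw [hr, hl, hE, mul_smul_comm, smul_mul_assoc])
  have h2 : y * (star a * (1 - p)) = 0 := by
    refine nonneg_mul_eq_zero hy ?_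
    have h3 := (mul_eq_self_iff hz.isSelfAdjoint.star_eq hps).1 h1
    rw [star_mul, star_star, mul_assoc, mul_assoc, ← mul_assoc y, ← mul_assoc a, ← mul_assoc a, h3,
      mul_zero]
  have h4 : p * (star a * (1 - p)) = 0 :=
    mul_eq_zero_of_le (by simpa [hps, hp.1.isIdempotentElem.eq] using star_mul_self_nonneg p) hpy
      (by rw [smul_mul_assoc, h2, smul_zero])
  rw [← star_inj, star_mul, star_mul, star_sub, star_one, star_star, hps, star_zero,
    sub_mul, sub_mul, one_mul, sub_eq_zero] at h4
  rw [← mul_assoc]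
  exact h4.symm

variable [FiniteDimensional ℂ A]

/-- The largest range projection of the positive eigenvectors of a positive map. -/
theorem exists_max_rangeProjection (Φ : Module.End ℂ A) (r : ℝ) :
    ∃ y p : A, 0 ≤ y ∧ Φ y = (r : ℂ) • y ∧ IsRangeProjection y p ∧
      (∃ c C : ℝ, 0 < c ∧ c • y ≤ p ∧ p ≤ C • y) ∧
      ∀ z, 0 ≤ z → Φ z = (r : ℂ) • z → p * z = z := by
  -- The positive eigenvectors, together with 0, form a set closed under addition; 0 shows that it
  -- is not empty.
  obtain ⟨y, ⟨hy, hy'⟩, hmin⟩ := exists_minimal_kernel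
    (S := {y : A | 0 ≤ y ∧ Φ y = (r : ℂ) • y}) ⟨0, le_rfl, by simp⟩ (fun y hy => hy.1)
    (fun y hy z hz => ⟨add_nonneg hy.1 hz.1, by rw [map_add, hy.2, hz.2, smul_add]⟩)
  obtain ⟨p, hp, hc⟩ := exists_rangeProjection hy
  refine ⟨y, p, hy, hy', hp, hc, fun z hz hz' => ?_⟩
  have hps := hp.1.isSelfAdjoint.star_eq
  rw [mul_eq_self_iff hz.isSelfAdjoint.star_eq hps]
  exact hmin z ⟨hz, hz'⟩ _ ((mul_eq_self_iff hy.isSelfAdjoint.star_eq hps).1 hp.2.1)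

/-- The Abel limit of the orbit of a positive element between two multiples of an eigenvector lies
between the same multiples. -/
theorem resolvent_mono (hΦ : ∀ y : A, 0 ≤ y → 0 ≤ Φ y) (hr : 0 ≤ r) {v w ζ ξ : A}
    (hv : v ∈ boundedOrbits Φ r) (hw : w ∈ boundedOrbits Φ r) (hvw : v ≤ w)
    (hζ : Filter.Tendsto (fun z : ℝ => ((z : ℂ) - r) • ∑' j : ℕ, ((z : ℂ) ^ (j + 1))⁻¹ • (Φ ^ j) v)
      (nhdsWithin r (Set.Ioi r)) (nhds ζ))
    (hξ : Filter.Tendsto (fun z : ℝ => ((z : ℂ) - r) • ∑' j : ℕ, ((z : ℂ) ^ (j + 1))⁻¹ • (Φ ^ j) w)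
      (nhdsWithin r (Set.Ioi r)) (nhds ξ)) : ζ ≤ ξ := by
  refine le_of_tendsto_of_tendsto hζ hξ (Filter.eventually_of_mem self_mem_nhdsWithin
    fun z (hz : r < z) => ?_)
  -- The scalars z - r and z^(-j-1) are nonnegative reals written as complex numbers; only as real
  -- scalars are they known to preserve the order.
  have h1 : ∀ y : A, ((z : ℂ) - r) • y = (z - r) • y := fun y => by
    rw [← Complex.ofReal_sub, Complex.coe_smul]
  have h2 : ∀ (j : ℕ) (y : A), ((z : ℂ) ^ (j + 1))⁻¹ • y = ((z ^ (j + 1))⁻¹ : ℝ) • y := fun j y =>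
    by
    rw [← Complex.ofReal_pow, ← Complex.ofReal_inv, Complex.coe_smul]
  have hz0 : 0 < z := hr.trans_lt hz
  dsimp only
  rw [h1, h1]
  refine smul_le_smul_of_nonneg_left ?_ (by linarith)
  refine (summable_resolvent hr hv hz).tsum_le_tsum (fun j => ?_) (summable_resolvent hr hw hz)
  rw [h2, h2]
  exact smul_le_smul_of_nonneg_left (pow_mono hΦ j hvw) (by positivity)

/-- The Perron-Frobenius theorem for a positive map: the eigenvector of maximal support. -/
theorem exists_perron_eigenvector (hΦ : ∀ y : A, 0 ≤ y → 0 ≤ Φ y) (hr : 0 ≤ r) :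
    ∃ y p ζ : A, 0 ≤ y ∧ Φ y = (r : ℂ) • y ∧ IsRangeProjection y p ∧
      (∀ z, 0 ≤ z → Φ z = (r : ℂ) • z → p * z = z) ∧
      (∀ z : ℝ, r < z → Summable fun j : ℕ => ((z : ℂ) ^ (j + 1))⁻¹ • (Φ ^ j) p) ∧
      Filter.Tendsto
        (fun z : ℝ => ((z : ℂ) - r) • ∑' j : ℕ, ((z : ℂ) ^ (j + 1))⁻¹ • (Φ ^ j) p)
        (nhdsWithin r (Set.Ioi r)) (nhds ζ) ∧
      0 ≤ ζ ∧ Φ ζ = (r : ℂ) • ζ ∧ IsRangeProjection ζ p ∧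
      ∀ S : Set A, (∀ a ∈ S, star a ∈ S) → (∀ a ∈ S, ∀ w, Φ (a * w) = a * Φ w) →
        (∀ a ∈ S, ∀ w, Φ (w * a) = Φ w * a) → ∀ a ∈ S, p * a = a * p ∧ ζ * a = a * ζ := by
  obtain ⟨y, p, hy, hE, hp, ⟨c, C, hc, hyp, hpy⟩, hmax⟩ := exists_max_rangeProjection Φ r
  have hps := hp.1.isSelfAdjoint.star_eq
  have hp0 : 0 ≤ p := (smul_nonneg hc.le hy).trans hyp
  have hmem := mem_boundedOrbits_of_le hΦ hr hE hp0 hpy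
  obtain ⟨ζ, hζE, hζ⟩ := exists_tendsto_resolvent hr hmem
  have hsm : ∀ s : ℝ, Φ (s • y) = (r : ℂ) • s • y := fun s => by
    rw [map_smul_real, hE, smul_comm]
  obtain ⟨m1, t1⟩ := tendsto_resolvent_eigenvector hr (hsm c)
  obtain ⟨m2, t2⟩ := tendsto_resolvent_eigenvector hr (hsm C)
  -- c y and C y are their own Abel limits, so monotonicity traps ζ between them.
  have h1 : c • y ≤ ζ := resolvent_mono hΦ hr m1 hmem hyp t1 hζ
  have h2 : ζ ≤ C • y := resolvent_mono hΦ hr hmem m2 hpy hζ t2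
  refine ⟨y, p, ζ, hy, hE, hp, hmax, fun z hz => summable_resolvent hr hmem hz, hζ,
    (smul_nonneg hc.le hy).trans h1, hζE, hp.of_le hc hy h1 h2, fun S hs hl hr' a ha => ?_⟩
  -- p a p = a p and p a* p = a* p; the adjoint of the second is p a p = p a.
  have hpa : p * a = a * p := by
    have e1 := proj_commute_of_intertwines hy hp hpy hE hmax (hl a ha) (hr' _ (hs a ha))
    have e2 := proj_commute_of_intertwines hy hp hpy hE hmax (hl _ (hs a ha))
      (by rw [star_star]; exact hr' a ha)
    rw [← star_inj, star_mul, star_mul, star_star, hps] at e2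
    rw [← e1, ← mul_assoc, e2]
  -- Every Φ^j p commutes with a, hence so do the resolvent sums and their limit.
  refine ⟨hpa, tendsto_nhds_unique (hζ.mul_const a) ?_⟩
  refine (hζ.const_mul a).congr' (Filter.eventually_of_mem self_mem_nhdsWithin
    fun z (hz : r < z) => ?_)
  have hs := summable_resolvent hr hmem hz
  have hcomm : ∀ j : ℕ, a * (Φ ^ j) p = (Φ ^ j) p * a := by
    have g1 : ∀ (j : ℕ) (w : A), (Φ ^ j) (a * w) = a * (Φ ^ j) w := by
      intro j
      induction j with
      | zero => simp
      | succ j ih => intro w; rw [pow_succ, Module.End.mul_apply, Module.End.mul_apply, hl a ha, ih]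
    have g2 : ∀ (j : ℕ) (w : A), (Φ ^ j) (w * a) = (Φ ^ j) w * a := by
      intro j
      induction j with
      | zero => simp
      | succ j ih => intro w; rw [pow_succ, Module.End.mul_apply, Module.End.mul_apply, hr' a ha,
        ih]
    intro j
    rw [← g1, ← g2, hpa]
  dsimp only
  rw [mul_smul_comm, smul_mul_assoc, ← hs.tsum_mul_left, ← hs.tsum_mul_right]
  exact congrArg _ (tsum_congr fun j => by rw [mul_smul_comm, smul_mul_assoc, hcomm])

end PerronFrobenius

end PFPlanar

/-! ### Double commutants of self-adjoint elements in a corner -/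

namespace PFPlanar

section DoubleCommutant

theorem commute_aeval {R : Type*} [Ring R] [Algebra ℂ R] {e z : R} (hz : Commute e z) (f :
    Polynomial ℂ) :
    Commute e (Polynomial.aeval z f) := by
  induction f using Polynomial.induction_on' with
  | add f g hf hg => rw [map_add]; exact hf.add_right hg
  | monomial n c =>
    rw [Polynomial.aeval_monomial, ← Algebra.smul_def]
    exact (hz.pow_right n).smul_right c

variable {A : Type u} [CStarAlgebra A]

theorem cornerRep_apply {e a : A} (v : cornerSpace e) : (cornerRep e a v : A) = e * (a * v) := rfl

theorem mul_of_mem_cornerSpace {e : A} (he : e * e = e) (v : cornerSpace e) : e * (v : A) = v := by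
  obtain ⟨_, w, rfl⟩ := v
  change e * (e * w) = e * w
  rw [← mul_assoc, he]

/-- On e A the element e z acts like z, because e commutes with z and acts there as the identity; so
do the polynomials. -/
theorem aeval_cornerRep {e z : A} (he : e * e = e) (hz : Commute e z) (f : Polynomial ℂ)
    (v : cornerSpace e) :
    (Polynomial.aeval (cornerRep e (e * z)) f v : A) = Polynomial.aeval z f * v := by
  have h1 : ∀ v : cornerSpace e, (cornerRep e (e * z) v : A) = z * v := fun v => by
    rw [cornerRep_apply, ← mul_assoc, ← mul_assoc, he, hz.eq, mul_assoc, mul_of_mem_cornerSpace he]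
  induction f using Polynomial.induction_on' generalizing v with
  | add f g hf hg =>
    rw [map_add, map_add, add_mul, ← hf, ← hg]
    rfl
  | monomial n c =>
    rw [Polynomial.aeval_monomial, Polynomial.aeval_monomial, ← Algebra.smul_def,
      ← Algebra.smul_def, smul_mul_assoc, LinearMap.smul_apply, Submodule.coe_smul]
    congr 1
    induction n generalizing v with
    | zero => simp
    | succ n ih => rw [pow_succ, Module.End.mul_apply, ih, h1, pow_succ, mul_assoc]

theorem star_aeval {z : A} (hz : IsSelfAdjoint z) (f : Polynomial ℂ) :
    star (Polynomial.aeval z f) = Polynomial.aeval z (f.map (starRingEnd ℂ)) := by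
  induction f using Polynomial.induction_on' with
  | add f g hf hg => rw [map_add, star_add, hf, hg, Polynomial.map_add, map_add]
  | monomial n c =>
    rw [Polynomial.map_monomial, Polynomial.aeval_monomial, Polynomial.aeval_monomial,
      ← Algebra.smul_def, ← Algebra.smul_def, star_smul, star_pow, hz.star_eq, starRingEnd_apply]

variable [FiniteDimensional ℂ A]

/-- A self-adjoint element is annihilated by a polynomial with simple roots. -/
theorem exists_squarefree_aeval_eq_zero {z : A} (hz : IsSelfAdjoint z) :
    ∃ f : Polynomial ℂ, Squarefree f ∧ Polynomial.aeval z f = 0 := by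
  classical
  have hfin : (spectrum ℂ z).Finite := spectrum_finite z
  have : IsStarNormal z := hz.isStarNormal
  -- One linear factor for each spectral value: the roots are distinct, and the product vanishes on
  -- the spectrum, hence at z by functional calculus.
  refine ⟨∏ t ∈ hfin.toFinset, (Polynomial.X - Polynomial.C t), ?_, ?_⟩
  · exact (Polynomial.separable_prod_X_sub_C_iff'.2 fun _ _ _ _ h => h).squarefree
  · rw [← cfc_polynomial _ z]
    refine (cfc_congr fun t ht => ?_).trans (cfc_const_zero ℂ z)
    rw [Polynomial.eval_prod]
    exact Finset.prod_eq_zero (hfin.mem_toFinset.2 ht) (by simp)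

theorem isSemisimple_cornerRep {e z : A} (he : e * e = e) (hz : IsSelfAdjoint z)
    (hez : Commute e z) : (cornerRep e (e * z)).IsSemisimple := by
  obtain ⟨f, hf, hf0⟩ := exists_squarefree_aeval_eq_zero hz
  refine Module.End.isSemisimple_of_squarefree_aeval_eq_zero hf
    (LinearMap.ext fun v => Subtype.ext ?_)
  rw [aeval_cornerRep he hez, hf0, zero_mul]
  rfl

/-- The double commutant of a self-adjoint element consists of its polynomials. -/
theorem mem_doubleCommutant_iff {e z : A} (he : e * e = e) (hz : IsSelfAdjoint z)
    (hez : Commute e z) (b : A) :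
    b ∈ doubleCommutant e (e * z) ↔ ∃ f : Polynomial ℂ, b = Polynomial.aeval z f * e := by
  set T := cornerRep e (e * z) with hT
  constructor
  · rintro ⟨hb, hbT⟩
    -- e is a vector of e A from which an element b = e b e can be recovered, as b = b e. It
    -- generates the cyclic subspace Y of the polynomials in T applied to e.
    let v₀ : cornerSpace e := ⟨e, e, he⟩
    let Y : Submodule ℂ (cornerSpace e) :=
      LinearMap.range ((LinearMap.applyₗ v₀) ∘ₗ (Polynomial.aeval T).toLinearMap)
    have hY : Y ∈ Module.End.invtSubmodule T := by
      rw [Module.End.mem_invtSubmodule]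
      rintro _ ⟨f, rfl⟩
      refine ⟨Polynomial.X * f, ?_⟩
      simp [Module.End.mul_apply]
    obtain ⟨Y', hY', hc⟩ := Module.End.isSemisimple_iff.1 (isSemisimple_cornerRep he hz hez) Y hY
    have hv₀ : v₀ ∈ Y := ⟨1, by simp⟩
    -- By semisimplicity Y has an invariant complement, so the projection onto Y commutes with T,
    -- and therefore with b. Thus b maps e into Y, which yields the polynomial.
    let π : Module.End ℂ (cornerSpace e) := Y.subtype ∘ₗ Submodule.projectionOnto Y Y' hc
    have hπ : ∀ v ∈ Y, π v = v := fun v hv =>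
      congrArg Subtype.val (Submodule.projectionOnto_apply_left hc ⟨v, hv⟩)
    have hπ' : ∀ v ∈ Y', π v = 0 := fun v hv =>
      congrArg Subtype.val ((Submodule.projectionOnto_apply_eq_zero_iff hc).2 hv)
    have hcomm : T * π = π * T := by
      refine LinearMap.ext fun v => ?_
      obtain ⟨w, hw, w', hw', rfl⟩ := Submodule.mem_sup.1 (hc.sup_eq_top ▸ Submodule.mem_top (x :=
        v))
      rw [Module.End.mul_apply, Module.End.mul_apply, map_add, map_add, map_add, map_add, hπ w hw,
        hπ' w' hw', hπ _ (hY hw), hπ' _ (hY' hw'), map_zero]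
    have h1 := hbT π (fun S hS => by rw [Set.mem_singleton_iff.1 hS]; exact hcomm)
    have h2 : cornerRep e b v₀ ∈ Y := by
      have h3 := LinearMap.congr_fun h1 v₀
      rw [Module.End.mul_apply, Module.End.mul_apply, hπ _ hv₀] at h3
      rw [← h3]
      exact (Submodule.projectionOnto Y Y' hc _).2
    obtain ⟨f, hf⟩ := h2
    refine ⟨f, ?_⟩
    have h3 := congrArg Subtype.val hf
    change (Polynomial.aeval T f v₀ : A) = e * (b * e) at h3
    rw [aeval_cornerRep he hez] at h3
    rw [← hb, mul_assoc, ← h3]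
  · rintro ⟨f, rfl⟩
    have hc := commute_aeval hez f
    refine ⟨by rw [← mul_assoc, hc.eq, mul_assoc, mul_assoc, he, he], ?_⟩
    have h1 : cornerRep e (Polynomial.aeval z f * e) = Polynomial.aeval T f := by
      refine LinearMap.ext fun v => Subtype.ext ?_
      rw [aeval_cornerRep he hez, cornerRep_apply, ← mul_assoc, ← mul_assoc, hc.eq, mul_assoc _ e e,
        he, mul_assoc, mul_of_mem_cornerSpace he]
    rw [h1]
    intro S hS
    exact (commute_aeval (hS T rfl).symm f).eq

/-- The double commutant of `e z` as a *-algebra with unit `e`. -/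
def doubleCommutantAlgebra {e z : A} (he : IsStarProjection e) (hz : IsSelfAdjoint z)
    (hez : Commute e z) : NonUnitalStarSubalgebra ℂ A where
  carrier := doubleCommutant e (e * z)
  zero_mem' := (mem_doubleCommutant_iff he.isIdempotentElem.eq hz hez _).2 ⟨0, by simp⟩
  add_mem' {a b} ha hb := by
    simp only [mem_doubleCommutant_iff he.isIdempotentElem.eq hz hez] at ha hb ⊢
    obtain ⟨⟨f, rfl⟩, ⟨g, rfl⟩⟩ := And.intro ha hb
    exact ⟨f + g, by rw [map_add, add_mul]⟩
  mul_mem' {a b} ha hb := by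
    simp only [mem_doubleCommutant_iff he.isIdempotentElem.eq hz hez] at ha hb ⊢
    obtain ⟨⟨f, rfl⟩, ⟨g, rfl⟩⟩ := And.intro ha hb
    refine ⟨f * g, ?_⟩
    rw [map_mul, mul_assoc, ← mul_assoc e, (commute_aeval hez g).eq, mul_assoc _ e e,
      he.isIdempotentElem.eq, mul_assoc]
  smul_mem' c a ha := by
    simp only [mem_doubleCommutant_iff he.isIdempotentElem.eq hz hez] at ha ⊢
    obtain ⟨f, rfl⟩ := ha
    exact ⟨c • f, by rw [map_smul, smul_mul_assoc]⟩
  star_mem' {a} ha := by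
    simp only [mem_doubleCommutant_iff he.isIdempotentElem.eq hz hez] at ha ⊢
    obtain ⟨f, rfl⟩ := ha
    exact ⟨f.map (starRingEnd ℂ), by
      rw [star_mul, he.isSelfAdjoint.star_eq, star_aeval hz, (commute_aeval hez _).eq]⟩

end DoubleCommutant

end PFPlanar

/-! ### Commuting algebras, matrix units and the tensor product -/

namespace PFPlanar

section TensorDecomposition

open TensorProduct

variable {A : Type u} [CStarAlgebra A]

/-- The multiplication map `b ⊗ d ↦ b d`. -/
noncomputable def tensorMul (M D : NonUnitalStarSubalgebra ℂ A) : M ⊗[ℂ] D →ₗ[ℂ] A :=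
  TensorProduct.lift ((LinearMap.mul ℂ A).domRestrict₁₂ M.toSubmodule D.toSubmodule)

variable {M D : NonUnitalStarSubalgebra ℂ A}

theorem tensorMul_tmul (m : M) (d : D) : tensorMul M D (m ⊗ₜ d) = m * d := rfl

theorem range_tensorMul :
    LinearMap.range (tensorMul M D) = productSpan (M : Set A) (D : Set A) := by
  rw [LinearMap.range_eq_map, ← TensorProduct.span_tmul_eq_top, Submodule.map_span, productSpan]
  congr 1
  ext w
  constructor
  · rintro ⟨_, ⟨m, d, rfl⟩, rfl⟩
    exact ⟨m, m.2, d, d.2, rfl⟩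
  · rintro ⟨m, hm, d, hd, rfl⟩
    exact ⟨_, ⟨⟨m, hm⟩, ⟨d, hd⟩, rfl⟩, rfl⟩

variable (hMD : ∀ m ∈ M, ∀ d ∈ D, m * d = d * m)
include hMD

theorem tensorMul_mul (x y : M ⊗[ℂ] D) :
    tensorMul M D (x * y) = tensorMul M D x * tensorMul M D y := by
  induction x using TensorProduct.induction_on with
  | zero => simp
  | add a b ha hb => rw [add_mul, map_add, map_add, add_mul, ha, hb]
  | tmul m d =>
    induction y using TensorProduct.induction_on with
    | zero => simp
    | add a b ha hb => rw [mul_add, map_add, map_add, mul_add, ha, hb]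
    | tmul m' d' =>
      rw [Algebra.TensorProduct.tmul_mul_tmul, tensorMul_tmul, tensorMul_tmul, tensorMul_tmul]
      change (m * m' : A) * (d * d') = m * d * (m' * d')
      rw [mul_assoc, mul_assoc, ← mul_assoc (d : A), ← hMD m' m'.2 d d.2, mul_assoc]

/-- The adjoint of m d is d* m*, so compatibility with the involution depends on M and D commuting.
-/
theorem tensorMul_star (x : M ⊗[ℂ] D) : tensorMul M D (star x) = star (tensorMul M D x) := by
  induction x using TensorProduct.induction_on with
  | zero => simp
  | add a b ha hb => rw [star_add, map_add, map_add, star_add, ha, hb]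
  | tmul m d =>
    rw [TensorProduct.star_tmul, tensorMul_tmul, tensorMul_tmul, hMD m m.2 d d.2, star_mul]
    rfl

/-- The algebra generated by two commuting algebras. -/
noncomputable def productAlgebra : NonUnitalStarSubalgebra ℂ A where
  carrier := productSpan (M : Set A) (D : Set A)
  zero_mem' := zero_mem _
  add_mem' := add_mem
  smul_mem' c _ h := Submodule.smul_mem _ c h
  mul_mem' {a b} ha hb := by
    rw [SetLike.mem_coe, ← range_tensorMul] at *
    obtain ⟨x, rfl⟩ := ha
    obtain ⟨y, rfl⟩ := hb
    exact ⟨x * y, tensorMul_mul hMD x y⟩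
  star_mem' {a} ha := by
    change a ∈ productSpan (M : Set A) (D : Set A) at ha
    change star a ∈ productSpan (M : Set A) (D : Set A)
    rw [← range_tensorMul] at *
    obtain ⟨x, rfl⟩ := ha
    exact ⟨star x, tensorMul_star hMD x⟩

/-- Commuting algebras `M` and `D` generate their tensor product if `D` is a matrix algebra the unit
of which acts as the identity on `M`. -/
theorem tensorMul_injective {n : ℕ} (φ : D ≃⋆ₐ[ℂ] Matrix (Fin n) (Fin n) ℂ)
    (hM : ∀ m ∈ M, m * (φ.symm 1 : D) = m) : Function.Injective (tensorMul M D) := by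
  -- Matrix units of D. Every tensor is a sum of m_ij ⊗ E_ij, so it suffices to recover the
  -- coefficients from the product.
  let E : Fin n → Fin n → D := fun i j => φ.symm (Matrix.single i j 1)
  have hE : ∀ i j k l, E i j * E k l = if j = k then E i l else 0 := by
    intro i j k l
    simp only [E, ← map_mul]
    split_ifs with h
    · subst h
      simp
    · rw [Matrix.single_mul_single_of_ne _ _ _ _ h, map_zero]
  have hspan : ∀ d : D, d = ∑ i, ∑ j, φ d i j • E i j := by
    intro d
    apply EquivLike.injective φ
    simp only [map_sum, map_smul, E, StarAlgEquiv.apply_symm_apply, Matrix.smul_single, smul_eq_mul,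
      mul_one]
    exact Matrix.matrix_eq_sum_single (φ d)
  have hrep : ∀ x : M ⊗[ℂ] D, ∃ m : Fin n → Fin n → M, x = ∑ i, ∑ j, m i j ⊗ₜ E i j := by
    intro x
    induction x using TensorProduct.induction_on with
    | zero => exact ⟨0, by simp⟩
    | add a b ha hb =>
      obtain ⟨m, rfl⟩ := ha
      obtain ⟨m', rfl⟩ := hb
      exact ⟨m + m', by simp [TensorProduct.add_tmul, Finset.sum_add_distrib]⟩
    | tmul m d =>
      refine ⟨fun i j => φ d i j • m, ?_⟩
      nth_rw 1 [hspan d]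
      simp only [TensorProduct.tmul_sum, TensorProduct.tmul_smul, TensorProduct.smul_tmul']
  rw [injective_iff_map_eq_zero]
  intro x hx
  obtain ⟨m, rfl⟩ := hrep x
  have hone : (∑ k, (E k k : A)) = (φ.symm 1 : D) := by
    have : φ.symm 1 = ∑ k, E k k := by
      rw [← map_sum, Matrix.sum_single_one]
    rw [this]
    exact (map_sum (NonUnitalStarSubalgebraClass.subtype D) _ _).symm
  have hz : ∀ i j, m i j = 0 := by
    intro i j
    -- Compressing by E_ki on the left and E_jk on the right isolates the coefficient m_ij.
    have h1 : ∀ k, (E k i : A) * tensorMul M D (∑ i, ∑ j, m i j ⊗ₜ E i j) * E j k =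
        m i j * E k k := by
      intro k
      simp only [map_sum, tensorMul_tmul, Finset.mul_sum, Finset.sum_mul]
      have h2 : ∀ a b, (E k i : A) * (m a b * E a b) * E j k =
          if a = i then if b = j then (m i j : A) * E k k else 0 else 0 := by
        intro a b
        rw [← mul_assoc, ← hMD _ (m a b).2 _ (E k i).2, mul_assoc, mul_assoc]
        have h3 : (E k i : A) * ((E a b : A) * E j k) = ((E k i * (E a b * E j k) : D) : A) := rfl
        rw [h3, hE]
        by_cases ha : a = i <;> by_cases hb : b = j
        · subst ha; subst hb; simp [hE]
        · simp [ha, hb]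
        · subst hb; simp [hE, ha, Ne.symm ha]
        · simp [ha, hb]
      simp [h2]
    -- Summing over k replaces E_kk by the unit of D, which acts as the identity on M. For n = 0
    -- this unit is 0, so that M vanishes.
    have h4 : (m i j : A) * (φ.symm 1 : D) = 0 := by
      rw [← hone, Finset.mul_sum]
      refine Finset.sum_eq_zero fun k _ => ?_
      rw [← h1 k, hx, mul_zero, zero_mul]
    rw [hM _ (m i j).2] at h4
    exact Subtype.ext h4
  simp [hz]

/-- The isomorphism `b ⊗ d ↦ b d` for commuting algebras `M` and `D`. -/
theorem exists_tensorEquiv (h : Function.Injective (tensorMul M D)) :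
    ∃ Ψ : M ⊗[ℂ] D ≃⋆ₐ[ℂ] productAlgebra hMD, ∀ (m : M) (d : D), (Ψ (m ⊗ₜ d) : A) = m * d := by
  let L : M ⊗[ℂ] D → productAlgebra hMD := fun x =>
    ⟨tensorMul M D x, (range_tensorMul (M := M) (D := D)).le (LinearMap.mem_range_self _ x)⟩
  have hL : Function.Bijective L := by
    refine ⟨fun x y hxy => h (congrArg Subtype.val hxy), ?_⟩
    rintro ⟨w, hw⟩
    obtain ⟨x, rfl⟩ := (range_tensorMul (M := M) (D := D)).ge hw
    exact ⟨x, rfl⟩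
  exact ⟨{ Equiv.ofBijective L hL with
    map_mul' := fun x y => Subtype.ext (tensorMul_mul hMD x y)
    map_add' := fun x y => Subtype.ext (map_add _ x y)
    map_star' := fun x => Subtype.ext (tensorMul_star hMD x)
    map_smul' := fun c x => Subtype.ext (map_smul _ c x) }, fun _ _ => rfl⟩

omit hMD

variable [FiniteDimensional ℂ A]

/-- Products with a direct summand isomorphic to a matrix algebra. -/
theorem exists_tensor_decomposition {ζ : A} (hζ : IsSelfAdjoint ζ) {C : StarSubalgebra ℂ A}
    (hC : ∀ y ∈ C, ζ * y = y * ζ) (hD : IsDirectSummand D C) {n : ℕ}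
    (φ : D ≃⋆ₐ[ℂ] Matrix (Fin n) (Fin n) ℂ) :
    ∃ e : A, IsUnionOfProjections (D : Set A) e ∧
      productSpan (doubleCommutant 1 ζ) (D : Set A) =
        productSpan (doubleCommutant e (e * ζ)) (D : Set A) ∧
      ∃ M N : NonUnitalStarSubalgebra ℂ A, (M : Set A) = doubleCommutant e (e * ζ) ∧
        (N : Set A) = productSpan (doubleCommutant e (e * ζ)) (D : Set A) ∧
        ∃ Ψ : M ⊗[ℂ] D ≃⋆ₐ[ℂ] N, ∀ (m : M) (d : D), (Ψ (m ⊗ₜ d) : A) = m * d := by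
  -- The unit of D, which is the projection p_𝒟.
  set u : D := φ.symm 1 with hu
  have hul : ∀ d : D, u * d = d := fun d => EquivLike.injective φ (by rw [map_mul]; simp [hu])
  have hur : ∀ d : D, d * u = d := fun d => EquivLike.injective φ (by rw [map_mul]; simp [hu])
  have hus : star u = u := by rw [hu, ← map_star, star_one]
  have hDC : ∀ d ∈ D, d ∈ C := by
    obtain ⟨D', h, -⟩ := hD
    exact fun d hd => (h d).2 ⟨d, hd, 0, D'.zero_mem, (add_zero d).symm⟩
  have he : IsStarProjection (u : A) :=
    ⟨congrArg Subtype.val (hul u), congrArg Subtype.val hus⟩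
  have hez : Commute (u : A) ζ := (hC _ (hDC _ u.2)).symm
  have hed : ∀ d ∈ D, (u : A) * d = d := fun d hd => congrArg Subtype.val (hul ⟨d, hd⟩)
  have hmem := mem_doubleCommutant_iff he.isIdempotentElem.eq hζ hez
  have hmem1 := mem_doubleCommutant_iff (e := 1) (one_mul 1) hζ (Commute.one_left ζ)
  rw [one_mul] at hmem1
  -- f(ζ) e d = f(ζ) d = d f(ζ) = d f(ζ) e, because d ∈ 𝒞 commutes with ζ and e is the unit of D.
  have hMD : ∀ m ∈ doubleCommutantAlgebra he hζ hez, ∀ d ∈ D, m * d = d * m := by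
    intro m hm d hd
    obtain ⟨f, rfl⟩ := (hmem m).1 hm
    have h1 : Commute d (Polynomial.aeval ζ f) := commute_aeval (hC d (hDC d hd)).symm f
    rw [mul_assoc, hed d hd, ← mul_assoc, h1.eq, mul_assoc]
    congr 1
    exact (congrArg Subtype.val (hur ⟨d, hd⟩)).symm
  have hM : ∀ m ∈ doubleCommutantAlgebra he hζ hez, m * (u : A) = m := by
    intro m hm
    obtain ⟨f, rfl⟩ := (hmem m).1 hm
    rw [mul_assoc, he.isIdempotentElem.eq]
  -- The unit dominates all projections of D and is one of them, so it is their supremum in A.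
  refine ⟨u, ⟨he, fun q hq _ => hed q hq, fun q _ hq => hq u u.2 he⟩, ?_,
    doubleCommutantAlgebra he hζ hez, productAlgebra hMD, rfl, rfl,
    exists_tensorEquiv hMD (tensorMul_injective hMD φ hM)⟩
  -- Already the generating products agree: f(ζ) d = (f(ζ) e) d since e d = d, with the same
  -- polynomial on both sides.
  unfold productSpan
  congr 1
  ext w
  constructor
  · rintro ⟨b, hb, d, hd, rfl⟩
    obtain ⟨f, rfl⟩ := (hmem1 b).1 hb
    exact ⟨_, (hmem _).2 ⟨f, rfl⟩, d, hd, by rw [mul_one, mul_assoc, hed d hd]⟩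
  · rintro ⟨b, hb, d, hd, rfl⟩
    obtain ⟨f, rfl⟩ := (hmem b).1 hb
    exact ⟨_, (hmem1 _).2 ⟨f, rfl⟩, d, hd, by rw [mul_one, mul_assoc, hed d hd]⟩

end TensorDecomposition

end PFPlanar

/-! ### The theorem for the map y ↦ y * x̂ -/

theorem theorem5p4 (P : PFPlanar.CStarPlanarAlgebra.{u}) (ε : Bool) (x : P.V ⟨2, ε⟩)
    (hx : P.FPositive x) :
    ∃ (p ζ : P.V ⟨1, ε⟩) (C : StarSubalgebra ℂ (P.V ⟨1, ε⟩)),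
      P.IsPMax x p ∧ P.IsMaxSupportEigenvector x p ζ ∧
      (C : Set (P.V ⟨1, ε⟩)) = P.exchangeC x ∧
      ((∀ y ∈ C, p * y = y * p) ∧ (∀ y ∈ C, ζ * y = y * ζ)) ∧
      (∀ y ∈ C, ζ * y ∈ P.eigenspace x) ∧
      (∀ (n : ℕ) (D : NonUnitalStarSubalgebra ℂ (P.V ⟨1, ε⟩)),
        PFPlanar.IsDirectSummand D C → Nonempty (D ≃⋆ₐ[ℂ] Matrix (Fin n) (Fin n) ℂ) →
        ∃ pD : P.V ⟨1, ε⟩, PFPlanar.IsUnionOfProjections (D : Set (P.V ⟨1, ε⟩)) pD ∧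
          PFPlanar.productSpan (PFPlanar.doubleCommutant 1 ζ) (D : Set (P.V ⟨1, ε⟩)) =
            PFPlanar.productSpan (PFPlanar.doubleCommutant pD (pD * ζ)) (D : Set (P.V ⟨1, ε⟩)) ∧
          ∃ M N : NonUnitalStarSubalgebra ℂ (P.V ⟨1, ε⟩),
            (M : Set (P.V ⟨1, ε⟩)) = PFPlanar.doubleCommutant pD (pD * ζ) ∧
            (N : Set (P.V ⟨1, ε⟩)) = PFPlanar.productSpan
              (PFPlanar.doubleCommutant pD (pD * ζ)) (D : Set (P.V ⟨1, ε⟩)) ∧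
            ∃ Ψ : TensorProduct ℂ M D ≃⋆ₐ[ℂ] N,
              ∀ (m : M) (d : D), (Ψ (TensorProduct.tmul ℂ m d) : P.V ⟨1, ε⟩) = m * d) := by
  let _ := CStarAlgebra.spectralOrder (P.V ⟨1, ε⟩)
  have := CStarAlgebra.spectralOrderedRing (P.V ⟨1, ε⟩)
  obtain ⟨a, ha⟩ := hx
  have hsa : star (P.fourier x) = P.fourier x := by rw [ha, star_mul, star_star]
  let Φ : Module.End ℂ (P.V ⟨1, ε⟩) := P.convLinear (P.fourier x)
  have hΦ : ∀ y : P.V ⟨1, ε⟩, Φ y = P.conv y (P.fourier x) := P.convLinear_apply _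
  have hpos : ∀ y : P.V ⟨1, ε⟩, 0 ≤ y → 0 ≤ Φ y := fun y hy => by
    obtain ⟨c, rfl⟩ := PFPlanar.isPos_iff_nonneg.2 hy
    rw [hΦ, ha]
    exact PFPlanar.isPos_iff_nonneg.1 (P.conv_nonneg c a)
  have hpow : ∀ (p : P.V ⟨1, ε⟩) (j : ℕ), P.convPow x p j = (Φ ^ j) p := fun p j => by
    rw [Module.End.pow_apply]
    exact congrFun (congrArg (fun f => f^[j]) (funext fun y => (hΦ y).symm)) p
  have hE : ∀ y, y ∈ P.eigenspace x ↔ Φ y = (P.radius x : ℂ) • y := fun y => by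
    rw [hΦ]
    rfl
  -- The Perron–Frobenius argument asks of r only that r ≥ 0, which is clear for the real value of a
  -- spectral radius.
  obtain ⟨y, p, ζ, hy, hyE, hyp, hmax, hsum, hlim, hζ, hζE, hζp, hcomm⟩ :=
    PFPlanar.exists_perron_eigenvector (r := P.radius x) hpos ENNReal.toReal_nonneg
  -- 𝒞 is closed under the involution, and its elements can be pulled out of Φ on both sides.
  have hC := hcomm (P.exchangeStarSubalgebra x hsa) (fun _ h => star_mem h)
    (fun b hb w => by rw [hΦ, hΦ, P.conv_mul_of_mem_exchangeC hsa hb])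
    (fun b hb w => by rw [hΦ, hΦ, P.conv_mul_of_mem_exchangeB hb.2])
  refine ⟨p, ζ, P.exchangeStarSubalgebra x hsa,
    ⟨⟨y, (hE y).2 hyE, PFPlanar.isPos_iff_nonneg.2 hy, hyp⟩, ?_⟩,
    ⟨⟨?_, ?_⟩, (hE ζ).2 hζE, PFPlanar.isPos_iff_nonneg.2 hζ, hζp⟩, rfl,
    ⟨fun b hb => (hC b hb).1, fun b hb => (hC b hb).2⟩, fun b hb => ?_, ?_⟩
  · rintro q ⟨z, hz, hz0, hzq⟩
    -- p fixes each positive eigenvector z, so by minimality the range projection of z lies under p.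
    exact hzq.2.2 p hyp.1 (hmax z (PFPlanar.isPos_iff_nonneg.1 hz0) ((hE z).1 hz))
  · simpa only [hpow] using hsum
  · simpa only [hpow] using hlim
  -- Φ(ζ b) = Φ(ζ) b = r ζ b; only b ∈ ℬ is needed.
  · rw [hE, hΦ, P.conv_mul_of_mem_exchangeB hb.2, ← hΦ, hζE, smul_mul_assoc]
  · rintro n D hD ⟨φ⟩
    exact PFPlanar.exists_tensor_decomposition hζ.isSelfAdjoint (fun b hb => (hC b hb).2) hD φ
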